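/- **Setting.** Fix a countably infinite set $\mathcal C$ of constants, used as standard names (distinct constants denote distinct objects). *Knowledge bases.* A DL-Lite$_{\mathcal A}$ TBox $T$ is a finite set of inclusions $B_1\sqsubseteq B_2$, $B_1\sqsubseteq\neg B_2$, $R_1\sqsubseteq R_2$, $R_1\sqsubseteq\neg R_2$ and functionality assertions $(\mathsf{funct}\,R)$, where $R::=P\mid P^-$ ($P$ a role name) and $B::=N\mid\exists R$ ($N$ a concept name), such that if $(\mathsf{funct}\,R)\in T$ then neither $R$ nor its inverse is the right-hand side of a positive role inclusion. An ABox $A$ is a finite set of facts $N(c)$, $P(c,c')$ with constants from $\mathcal C$; $\mathrm{adom}(A)$ is the set of constants in $A$. $A$ is $T$-consistent if $(T,A)$ has a first-order model. A repair of $A$ is a maximal $T$-consistent subset of $A$. *Queries.* A Boolean UCQ is AR-entailed by $(T,A)$ if it is true in every model of $(T,A_r)$ for every repair $A_r$ of $A$. ECQs are $Q::=[q]\mid\neg Q\mid Q\wedge Q\mid\exists x.Q$ with $q$ a UCQ (possibly mentioning constants). A closed ECQ is evaluated over $(T,A)$ by reading $[q]$ as AR-entailment, letting quantifiers range over $\mathrm{adom}(A)$.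 The consistent-query answers to $Q$ are the substitutions of its free variables by elements of $\mathrm{adom}(A)$ that make it true. *KABs.* A KAB $\mathcal K=(T,A_0,\Gamma,\Pi)$ consists of a DL-Lite$_{\mathcal A}$ TBox $T$, a $T$-consistent ABox $A_0$, a finite set $\Gamma$ of actions and a finite set $\Pi$ of rules $Q\mapsto\alpha$ with $\alpha\in\Gamma$ and $Q$ an ECQ whose free variables are exactly the parameters of $\alpha$. An action has a finite list of distinct parameters and finitely many effects $[q^+]\wedge Q^-\rightsquigarrow E$, where $q^+$ is a UCQ, $Q^-$ an ECQ, and $E$ a finite set of atoms over constants, variables and service-call terms $f(\vec x)$; the free variables of $Q^-$ and the variables of $E$ are free variables of $q^+$ or parameters. *Inconsistency-tolerant semantics (it-KABs).* States are pairs $\langle A,m\rangle$ of an ABox, possibly $T$-inconsistent, and a partial map $m$ from ground service calls to $\mathcal C$; the initial state is $\langle A_0,\emptyset\rangle$. There is a transition $\langle A,m\rangle\Rightarrow\langle A',m'\rangle$ iff for some rule $Q\mapsto\alpha$ in $\Pi$ and some consistent-query answer $\sigma$ to $Q$ over $(T,A)$ the following holds. Let $D$ be the union of the sets $E\sigma\rho$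 over the effects $[q^+]\wedge Q^-\rightsquigarrow E$ of $\alpha$ and the consistent-query answers $\rho$ to $([q^+]\wedge Q^-)\sigma$ over $(T,A)$. Then some function $\theta$ from the service calls in $D$ to $\mathcal C$, agreeing with $m$ on common arguments, satisfies $A'=D\theta$ and $m'=m\cup\theta$. The transition system $\Upsilon^{it}_{\mathcal K}$ consists of the states reachable from the initial state. $\mathcal K$ is *run-bounded* if there is a $b\in\mathbb N$ such that along every (finite or infinite) run of $\Upsilon^{it}_{\mathcal K}$ starting in the initial state fewer than $b$ constants occur in the ABoxes. *Logic.* The formulae of $\mu\mathcal L_A^{\mathrm{CQA}}$ are $$\Phi::=Q\mid\neg\Phi\mid\Phi\wedge\Phi\mid\exists x.\Phi\mid\langle-\rangle\Phi\mid Z\mid\mu Z.\Phi,$$ where $Q$ is an ECQ and in $\mu Z.\Phi$ the free occurrences of $Z$ in $\Phi$ are under an even number of negations. They are interpreted over $\Upsilon^{it}_{\mathcal K}$ as usual in the $\mu$-calculus; a query $Q$ (its free variables replaced by their values) is evaluated over the ABox of the state by consistent query answering, and $\exists x$ ranges over the active domain of the ABox of the current state. **Theorem.** Verification of $\mu\mathcal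 L_A^{\mathrm{CQA}}$ properties over run-bounded it-KABs is decidable: there is an algorithm that, given any run-bounded it-KAB $\mathcal K$ and any closed $\mu\mathcal L_A^{\mathrm{CQA}}$ formula $\Phi$ (a bound $b$ is not part of the input), halts and correctly answers whether the initial state of $\Upsilon^{it}_{\mathcal K}$ satisfies $\Phi$. -/

import Mathlib

namespace ITKAB

/-! ## Individuals, service calls, assertions

The countably infinite set of individual constants, the concept names, the role names, the
names of service functions, and the individual and predicate variables are all copies of `ℕ`. -/

/-- Concept and role atoms `N(t)`, `P(t, t')` over terms from `τ`. -/
inductive Atom (τ : Type) : Type where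
  | concept (N : ℕ) (t : τ)
  | role (P : ℕ) (t t' : τ)
  deriving DecidableEq

/-- The terms occurring in an atom. -/
def Atom.terms {τ : Type} : Atom τ → List τ
  | .concept _ t => [t]
  | .role _ t t' => [t, t']

/-- Replace every term of an atom. -/
def Atom.map {τ υ : Type} (g : τ → υ) : Atom τ → Atom υ
  | .concept N t => .concept N (g t)
  | .role P t t' => .role P (g t) (g t')

/-- ABox membership assertions. -/
abbrev Fact : Type := Atom ℕ

/-- ABoxes. -/
abbrev ABox : Type := Finset Fact

/-- The domain of an ABox: the constants that occur in it. -/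
def adom (A : ABox) : Set ℕ := {c | ∃ F ∈ A, c ∈ F.terms}

/-- A service call `f(v₁, …, vₙ)`; a function symbol is a name together with its arity. -/
abbrev SCall : Type := ℕ × List ℕ

/-! ## DL-Lite knowledge bases -/

/-- Role expressions `P` and `P⁻`. -/
inductive DLRole : Type where
  | name (P : ℕ)
  | inv (P : ℕ)

/-- The inverse of a role expression. -/
def DLRole.inverse : DLRole → DLRole
  | .name P => .inv P
  | .inv P => .name P

/-- Concept expressions `N` and `∃R`. -/
inductive DLConcept : Type where
  | name (N : ℕ)
  | ex (R : DLRole)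

/-- A TBox: positive and negative inclusions between concepts and between roles, and
functionality assertions. -/
structure TBox : Type where
  /-- `B₁ ⊑ B₂` -/
  posC : List (DLConcept × DLConcept)
  /-- `B₁ ⊑ ¬B₂` -/
  negC : List (DLConcept × DLConcept)
  /-- `R₁ ⊑ R₂` -/
  posR : List (DLRole × DLRole)
  /-- `R₁ ⊑ ¬R₂` -/
  negR : List (DLRole × DLRole)
  /-- `(funct R)` -/
  func : List DLRole

/-- The syntactic restriction of DL-Lite_A: a role that is functional, or whose inverse is
functional, is not specialized, i.e. is not on the right of a positive role inclusion. -/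
def TBox.IsDLLiteA (T : TBox) : Prop :=
  ∀ R ∈ T.func, ∀ p ∈ T.posR, p.2 ≠ R ∧ p.2 ≠ R.inverse

/-- First-order interpretations of the vocabulary. Constants are standard names, so that
different constants denote different objects (unique name assumption). -/
structure Interp : Type 1 where
  Dom : Type
  const : ℕ → Dom
  una : Function.Injective const
  conc : ℕ → Dom → Prop
  role : ℕ → Dom → Dom → Prop

namespace Interp

/-- Extension of a role expression. -/
def roleExt (I : Interp) : DLRole → I.Dom → I.Dom → Prop
  | .name P => fun a b => I.role P a b
  | .inv P => fun a b => I.role P b a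

/-- Extension of a concept expression. -/
def concExt (I : Interp) : DLConcept → I.Dom → Prop
  | .name N => fun a => I.conc N a
  | .ex R => fun a => ∃ b, I.roleExt R a b

/-- Truth of an atom whose terms are interpreted by `e`. -/
def satAtom (I : Interp) {τ : Type} (e : τ → I.Dom) : Atom τ → Prop
  | .concept N t => I.conc N (e t)
  | .role P t t' => I.role P (e t) (e t')

/-- Satisfaction of a TBox. -/
structure SatTBox (I : Interp) (T : TBox) : Prop where
  posC : ∀ p ∈ T.posC, ∀ a, I.concExt p.1 a → I.concExt p.2 a
  negC : ∀ p ∈ T.negC, ∀ a, I.concExt p.1 a → ¬ I.concExt p.2 a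
  posR : ∀ p ∈ T.posR, ∀ a b, I.roleExt p.1 a b → I.roleExt p.2 a b
  negR : ∀ p ∈ T.negR, ∀ a b, I.roleExt p.1 a b → ¬ I.roleExt p.2 a b
  func : ∀ R ∈ T.func, ∀ a b c, I.roleExt R a b → I.roleExt R a c → b = c

/-- `I` is a model of the knowledge base `(T, A)`. -/
def IsModel (I : Interp) (T : TBox) (A : ABox) : Prop :=
  I.SatTBox T ∧ ∀ F ∈ A, I.satAtom I.const F

end Interp

/-- `A` is `T`-consistent: `(T, A)` has a model. -/
def Consistent (T : TBox) (A : ABox) : Prop := ∃ I : Interp, I.IsModel T A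

/-- `R ∈ rep(A, T)`: `R` is a maximal `T`-consistent subset of `A`. -/
def IsRepair (T : TBox) (A R : ABox) : Prop :=
  Maximal (fun B : ABox => B ⊆ A ∧ Consistent T B) R

/-! ## Queries -/

/-- Terms of queries. -/
inductive QTerm : Type where
  | var (x : ℕ)
  | const (c : ℕ)

/-- The variables of a query term. -/
def QTerm.vars : QTerm → List ℕ
  | .var x => [x]
  | .const _ => []

/-- A conjunctive query `∃ bound. ⋀ atoms`. -/
structure CQ : Type where
  bound : List ℕ
  atoms : List (Atom QTerm)

/-- A union of conjunctive queries: the disjunction of the members of the list. -/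
abbrev UCQ : Type := List CQ

/-- The free variables of a UCQ. -/
def ucqFV (q : UCQ) : Set ℕ :=
  {x | ∃ d ∈ q, x ∉ d.bound ∧ ∃ a ∈ d.atoms, ∃ t ∈ a.terms, x ∈ t.vars}

/-- Value of a query term under an assignment of the variables to domain elements. -/
def Interp.termVal (I : Interp) (e : ℕ → I.Dom) : QTerm → I.Dom
  | .var x => e x
  | .const c => I.const c

/-- `qv` is true in `I`, where `qv` is obtained from `q` by replacing every free variable `x`
by the constant `v x`. -/
def Interp.satUCQ (I : Interp) (q : UCQ) (v : ℕ → ℕ) : Prop :=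
  ∃ d ∈ q, ∃ e : ℕ → I.Dom, (∀ x, x ∉ d.bound → e x = I.const (v x)) ∧
    ∀ a ∈ d.atoms, I.satAtom (I.termVal e) a

/-- AR-consistent entailment: `qv` is true in every model of `(T, R)`, for every repair `R` of
`A` with `T`. -/
def cqa (T : TBox) (A : ABox) (q : UCQ) (v : ℕ → ℕ) : Prop :=
  ∀ R : ABox, IsRepair T A R → ∀ I : Interp, I.IsModel T R → I.satUCQ q v

/-- ECQs. -/
inductive ECQ : Type where
  | atom (q : UCQ)
  | neg (Q : ECQ)
  | and (Q₁ Q₂ : ECQ)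
  | ex (x : ℕ) (Q : ECQ)

/-- The free variables of an ECQ. -/
def ECQ.FV : ECQ → Set ℕ
  | .atom q => ucqFV q
  | .neg Q => Q.FV
  | .and Q₁ Q₂ => Q₁.FV ∪ Q₂.FV
  | .ex x Q => Q.FV \ {x}

/-- The Boolean ECQ `Qv` (free variables replaced by constants according to `v`) evaluates to
true over `(T, A)` under consistent query answering; quantifiers range over `adom A`. The
consistent-query answers to `Q` are thus the `v` with values in `adom A` on the free variables
of `Q` for which this holds. -/
def ECQ.holds (T : TBox) (A : ABox) : ECQ → (ℕ → ℕ) → Prop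
  | .atom q, v => cqa T A q v
  | .neg Q, v => ¬ Q.holds T A v
  | .and Q₁ Q₂, v => Q₁.holds T A v ∧ Q₂.holds T A v
  | .ex x Q, v => ∃ d ∈ adom A, Q.holds T A (Function.update v x d)

/-! ## Knowledge and action bases -/

/-- Terms in the right-hand side of an effect: constants, variables, and Skolem terms
`f(x₁, …, xₙ)` with variables as arguments. -/
inductive ETerm : Type where
  | base (t : QTerm)
  | call (f : ℕ) (args : List ℕ)

/-- The variables of an effect term. -/
def ETerm.vars : ETerm → List ℕ
  | .base t => t.vars
  | .call _ args => args

/-- Ground terms: constants and service calls. -/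
inductive GTerm : Type where
  | const (c : ℕ)
  | call (s : SCall)

/-- Instantiate the variables of an effect term by constants. -/
def ETerm.ground (ρ : ℕ → ℕ) : ETerm → GTerm
  | .base (.var x) => .const (ρ x)
  | .base (.const c) => .const c
  | .call f args => .call (f, args.map ρ)

/-- Replace a service call by its result. -/
def GTerm.eval (θ : SCall → ℕ) : GTerm → ℕ
  | .const c => c
  | .call s => θ s

/-- An effect specification `[q⁺] ∧ Q⁻ ⇝ E`. -/
structure Effect : Type where
  qpos : UCQ
  qneg : ECQ
  facts : List (Atom ETerm)

/-- An action with its input parameters and its effects. -/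
structure Action : Type where
  params : List ℕ
  effects : List Effect

/-- A knowledge and action base `(T, A₀, Γ, Π)`. A condition/action rule `Q ↦ α` is the pair of
`Q` and the position of `α` in the list of actions. -/
structure KAB : Type where
  tbox : TBox
  abox : List Fact
  actions : List Action
  rules : List (ECQ × ℕ)

/-- Syntactic well-formedness of an action: the parameters are distinct, and the variables of
`Q⁻` and of the right-hand side are free variables of `q⁺` or parameters. -/
structure Action.WF (α : Action) : Prop where
  nodup : α.params.Nodup
  qneg : ∀ e ∈ α.effects, ∀ x ∈ e.qneg.FV, x ∈ ucqFV e.qpos ∨ x ∈ α.params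
  facts : ∀ e ∈ α.effects, ∀ a ∈ e.facts, ∀ t ∈ a.terms, ∀ x ∈ t.vars,
    x ∈ ucqFV e.qpos ∨ x ∈ α.params

/-- The defining conditions of a KAB: the TBox is a DL-Lite_A TBox, the initial ABox is
`T`-consistent, the actions are well-formed, and every rule `Q ↦ α` refers to an action whose
parameters are exactly the free variables of `Q`. -/
structure KAB.WF (K : KAB) : Prop where
  tbox : K.tbox.IsDLLiteA
  consistent : Consistent K.tbox K.abox.toFinset
  actions : ∀ α ∈ K.actions, α.WF
  rules : ∀ r ∈ K.rules, ∃ α, K.actions[r.2]? = some α ∧ ∀ x, x ∈ r.1.FV ↔ x ∈ α.params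

/-! ## The inconsistency-tolerant transition system -/

/-- A state: an ABox and a service call map (a partial function from service calls to
constants). -/
structure KState : Type where
  abox : ABox
  scmap : SCall → Option ℕ

/-- `σ` is a legal choice of parameters for `α` over `A`: for some rule `Q ↦ α`, the tuple of
parameters is a consistent-query answer to `Q`. -/
def KAB.Legal (K : KAB) (A : ABox) (α : Action) (σ : ℕ → ℕ) : Prop :=
  ∃ r ∈ K.rules, K.actions[r.2]? = some α ∧ (∀ p ∈ α.params, σ p ∈ adom A) ∧
    r.1.holds K.tbox A σ

/-- `do(T, A, ασ)`: the union over the effects `[q⁺] ∧ Q⁻ ⇝ E` of `α` and over the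
consistent-query answers `ρ` to `([q⁺] ∧ Q⁻)σ` of the sets of facts `Eσρ`. The valuation `ρ`
below is the combination of `σ` and `ρ`. -/
def doFacts (T : TBox) (A : ABox) (α : Action) (σ : ℕ → ℕ) : Set (Atom GTerm) :=
  {F | ∃ e ∈ α.effects, ∃ ρ : ℕ → ℕ,
    (∀ p ∈ α.params, ρ p = σ p) ∧
    (∀ x ∈ ucqFV e.qpos, x ∉ α.params → ρ x ∈ adom A) ∧
    (ECQ.and (ECQ.atom e.qpos) e.qneg).holds T A ρ ∧
    ∃ a ∈ e.facts, F = a.map (ETerm.ground ρ)}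

/-- The service calls that occur in a set of facts. -/
def calls (E : Set (Atom GTerm)) : Set SCall := {s | ∃ F ∈ E, GTerm.call s ∈ F.terms}

/-- `ασ` leads from `s` to `s'`: `ασ` is legal in `s`, and the service calls issued by it are
evaluated by some `θ` (of which only the values on these calls matter) that agrees with the
service call map of `s`. The new ABox need not be `T`-consistent. -/
def KAB.Exec (K : KAB) (s : KState) (α : Action) (σ : ℕ → ℕ) (s' : KState) : Prop :=
  K.Legal s.abox α σ ∧
  ∃ θ : SCall → ℕ,
    (∀ c ∈ calls (doFacts K.tbox s.abox α σ), ∀ d, s.scmap c = some d → θ c = d) ∧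
    (s'.abox : Set Fact) = Atom.map (GTerm.eval θ) '' doFacts K.tbox s.abox α σ ∧
    (∀ c ∈ calls (doFacts K.tbox s.abox α σ), s'.scmap c = some (θ c)) ∧
    (∀ c ∉ calls (doFacts K.tbox s.abox α σ), s'.scmap c = s.scmap c)

/-- One step of the it-transition system. -/
def KAB.Step (K : KAB) (s s' : KState) : Prop :=
  ∃ α ∈ K.actions, ∃ σ : ℕ → ℕ, K.Exec s α σ s'

/-- The initial state `⟨A₀, ∅⟩`. -/
def KAB.init (K : KAB) : KState := ⟨K.abox.toFinset, fun _ => none⟩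

/-- Transition systems whose states carry ABoxes. -/
structure TransSys : Type 1 where
  St : Type
  init : St
  abox : St → ABox
  step : St → St → Prop

/-- The it-transition system of `K`. Its states are those reachable from the initial one. -/
def KAB.itSys (K : KAB) : TransSys where
  St := {s : KState // Relation.ReflTransGen K.Step K.init s}
  init := ⟨K.init, .refl⟩
  abox s := s.1.abox
  step s s' := K.Step s.1 s'.1

/-- `τ 0, τ 1, …` up to index `N` (all of them when `N = ⊤`) is a finite or infinite run. -/
def TransSys.IsRun (U : TransSys) (τ : ℕ → U.St) (N : ℕ∞) : Prop :=
  τ 0 = U.init ∧ ∀ i : ℕ, (i : ℕ∞) < N → U.step (τ i) (τ (i + 1))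

/-- One bound `b` on the number of constants that occur along a run works for all runs. -/
def TransSys.RunBounded (U : TransSys) : Prop :=
  ∃ b : ℕ, ∀ (τ : ℕ → U.St) (N : ℕ∞), U.IsRun τ N →
    {c : ℕ | ∃ i : ℕ, (i : ℕ∞) ≤ N ∧ c ∈ adom (U.abox (τ i))}.encard < b

/-! ## The temporal logic -/

/-- Formulae of the first-order `μ`-calculus. -/
inductive MuForm : Type where
  | query (Q : ECQ)
  | neg (φ : MuForm)
  | and (φ ψ : MuForm)
  | ex (x : ℕ) (φ : MuForm)
  | dia (φ : MuForm)
  | pvar (Z : ℕ)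
  | mu (Z : ℕ) (φ : MuForm)

namespace MuForm

/-- Free individual variables. -/
def FV : MuForm → Set ℕ
  | query Q => Q.FV
  | neg φ => φ.FV
  | and φ ψ => φ.FV ∪ ψ.FV
  | ex x φ => φ.FV \ {x}
  | dia φ => φ.FV
  | pvar _ => ∅
  | mu _ φ => φ.FV

/-- Free predicate variables. -/
def PV : MuForm → Set ℕ
  | query _ => ∅
  | neg φ => φ.PV
  | and φ ψ => φ.PV ∪ ψ.PV
  | ex _ φ => φ.PV
  | dia φ => φ.PV
  | pvar Z => {Z}
  | mu Z φ => φ.PV \ {Z}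

/-- Every free occurrence of `Z` is under an even (for `true`; odd, for `false`) number of
negations. -/
def Polarity (Z : ℕ) : Bool → MuForm → Prop
  | _, query _ => True
  | b, neg φ => Polarity Z (!b) φ
  | b, and φ ψ => Polarity Z b φ ∧ Polarity Z b ψ
  | b, ex _ φ => Polarity Z b φ
  | b, dia φ => Polarity Z b φ
  | b, pvar Y => Y = Z → b = true
  | b, mu Y φ => Y = Z ∨ Polarity Z b φ

/-- Syntactic monotonicity: in each subformula `μZ.φ`, the free occurrences of `Z` in `φ` are
under an even number of negations. -/
def Monotone : MuForm → Prop
  | query _ => True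
  | neg φ => φ.Monotone
  | and φ ψ => φ.Monotone ∧ ψ.Monotone
  | ex _ φ => φ.Monotone
  | dia φ => φ.Monotone
  | pvar _ => True
  | mu Z φ => Polarity Z true φ ∧ φ.Monotone

/-- Closed formulae of the `μ`-calculus. -/
structure IsSentence (φ : MuForm) : Prop where
  fv : φ.FV = ∅
  pv : φ.PV = ∅
  monotone : φ.Monotone

/-- The extension of a formula in a transition system, with local queries evaluated by
consistent query answering; `μZ.φ` is the least fixpoint, as the intersection of all
pre-fixpoints. -/
def sem (T : TBox) (U : TransSys) : MuForm → (ℕ → ℕ) → (ℕ → Set U.St) → Set U.St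
  | query Q, v, _ => {s | Q.holds T (U.abox s) v}
  | neg φ, v, V => (sem T U φ v V)ᶜ
  | and φ ψ, v, V => sem T U φ v V ∩ sem T U ψ v V
  | ex x φ, v, V => {s | ∃ d ∈ adom (U.abox s), s ∈ sem T U φ (Function.update v x d) V}
  | dia φ, v, V => {s | ∃ s', U.step s s' ∧ s' ∈ sem T U φ v V}
  | pvar Z, _, V => V Z
  | mu Z φ, v, V => ⋂₀ {X | sem T U φ v (Function.update V Z X) ⊆ X}

end MuForm

/-- `K`, under the inconsistency-tolerant semantics, satisfies the closed formula `φ` (the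
valuations do not matter when `φ` is closed). -/
def KAB.Satisfies (K : KAB) (φ : MuForm) : Prop :=
  ∀ v V, K.itSys.init ∈ φ.sem K.tbox K.itSys v V

/-! ## Codes of problem instances

Finite objects are coded by natural numbers in the usual way: tagged tuples through the pairing
function, lists by iterated pairing. -/

/-- Codes of lists. -/
def codeList {α : Type} (c : α → ℕ) : List α → ℕ
  | [] => 0
  | a :: l => Nat.pair (c a) (codeList c l) + 1

/-- Codes of pairs. -/
def codePair {α β : Type} (c : α → ℕ) (d : β → ℕ) (p : α × β) : ℕ := Nat.pair (c p.1) (d p.2)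

/-- Codes of atoms. -/
def Atom.code {τ : Type} (c : τ → ℕ) : Atom τ → ℕ
  | .concept N t => Nat.pair 0 (Nat.pair N (c t))
  | .role P t t' => Nat.pair 1 (Nat.pair P (Nat.pair (c t) (c t')))

/-- Codes of roles. -/
def DLRole.code : DLRole → ℕ
  | .name P => Nat.pair 0 P
  | .inv P => Nat.pair 1 P

/-- Codes of concepts. -/
def DLConcept.code : DLConcept → ℕ
  | .name N => Nat.pair 0 N
  | .ex R => Nat.pair 1 R.code

/-- Codes of TBoxes. -/
def TBox.code (T : TBox) : ℕ :=
  Nat.pair (codeList (codePair DLConcept.code DLConcept.code) T.posC)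
    (Nat.pair (codeList (codePair DLConcept.code DLConcept.code) T.negC)
      (Nat.pair (codeList (codePair DLRole.code DLRole.code) T.posR)
        (Nat.pair (codeList (codePair DLRole.code DLRole.code) T.negR)
          (codeList DLRole.code T.func))))

/-- Codes of query terms. -/
def QTerm.code : QTerm → ℕ
  | .var x => Nat.pair 0 x
  | .const c => Nat.pair 1 c

/-- Codes of conjunctive queries. -/
def CQ.code (q : CQ) : ℕ :=
  Nat.pair (codeList id q.bound) (codeList (Atom.code QTerm.code) q.atoms)

/-- Codes of ECQs. -/
def ECQ.code : ECQ → ℕ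
  | .atom q => Nat.pair 0 (codeList CQ.code q)
  | .neg Q => Nat.pair 1 Q.code
  | .and Q₁ Q₂ => Nat.pair 2 (Nat.pair Q₁.code Q₂.code)
  | .ex x Q => Nat.pair 3 (Nat.pair x Q.code)

/-- Codes of effect terms. -/
def ETerm.code : ETerm → ℕ
  | .base t => Nat.pair 0 t.code
  | .call f args => Nat.pair 1 (Nat.pair f (codeList id args))

/-- Codes of effects. -/
def Effect.code (e : Effect) : ℕ :=
  Nat.pair (codeList CQ.code e.qpos)
    (Nat.pair e.qneg.code (codeList (Atom.code ETerm.code) e.facts))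

/-- Codes of actions. -/
def Action.code (α : Action) : ℕ :=
  Nat.pair (codeList id α.params) (codeList Effect.code α.effects)

/-- Codes of KABs. -/
def KAB.code (K : KAB) : ℕ :=
  Nat.pair K.tbox.code
    (Nat.pair (codeList (Atom.code id) K.abox)
      (Nat.pair (codeList Action.code K.actions) (codeList (codePair ECQ.code id) K.rules)))

/-- Codes of formulae. -/
def MuForm.code : MuForm → ℕ
  | .query Q => Nat.pair 0 Q.code
  | .neg φ => Nat.pair 1 φ.code
  | .and φ ψ => Nat.pair 2 (Nat.pair φ.code ψ.code)
  | .ex x φ => Nat.pair 3 (Nat.pair x φ.code)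
  | .dia φ => Nat.pair 4 φ.code
  | .pvar Z => Nat.pair 5 Z
  | .mu Z φ => Nat.pair 6 (Nat.pair Z φ.code)

/-- The code of the instance "does `K` satisfy `φ`?" of the verification problem. -/
def instanceCode (K : KAB) (φ : MuForm) : ℕ := Nat.pair K.code φ.code

/-! Different instances have different codes. -/

theorem codeList_inj {α : Type} {c : α → ℕ} (hc : Function.Injective c) :
    Function.Injective (codeList c) := by
  intro l
  induction l with
  | nil => intro l' h; cases l' <;> simp_all [codeList]
  | cons a l ih =>
    intro l' h
    cases l' with
    | nil => simp [codeList] at h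
    | cons b l' =>
      simp only [codeList, Nat.add_right_cancel_iff, Nat.pair_eq_pair] at h
      rw [hc h.1, ih h.2]

theorem codePair_inj {α β : Type} {c : α → ℕ} {d : β → ℕ} (hc : Function.Injective c)
    (hd : Function.Injective d) : Function.Injective (codePair c d) := by
  rintro ⟨a, b⟩ ⟨a', b'⟩ h
  simp only [codePair, Nat.pair_eq_pair] at h
  rw [hc h.1, hd h.2]

theorem Atom.code_inj {τ : Type} {c : τ → ℕ} (hc : Function.Injective c) :
    Function.Injective (Atom.code c) := by
  intro a b h
  cases a <;> cases b <;> simp_all [Atom.code, Nat.pair_eq_pair, hc.eq_iff]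

theorem DLRole.code_inj : Function.Injective DLRole.code := by
  intro a b h
  cases a <;> cases b <;> simp_all [DLRole.code, Nat.pair_eq_pair]

theorem DLConcept.code_inj : Function.Injective DLConcept.code := by
  intro a b h
  cases a <;> cases b <;> simp_all [DLConcept.code, Nat.pair_eq_pair, DLRole.code_inj.eq_iff]

theorem TBox.code_inj : Function.Injective TBox.code := by
  have hC := codeList_inj (codePair_inj DLConcept.code_inj DLConcept.code_inj)
  have hR := codeList_inj (codePair_inj DLRole.code_inj DLRole.code_inj)
  have hF := codeList_inj DLRole.code_inj
  rintro ⟨⟩ ⟨⟩ h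
  simpa [TBox.code, Nat.pair_eq_pair, hC.eq_iff, hR.eq_iff, hF.eq_iff] using h

theorem QTerm.code_inj : Function.Injective QTerm.code := by
  intro a b h
  cases a <;> cases b <;> simp_all [QTerm.code, Nat.pair_eq_pair]

theorem CQ.code_inj : Function.Injective CQ.code := by
  have h1 := codeList_inj (Function.injective_id (α := ℕ))
  have h2 := codeList_inj (Atom.code_inj QTerm.code_inj)
  rintro ⟨⟩ ⟨⟩ h
  simpa [CQ.code, Nat.pair_eq_pair, h1.eq_iff, h2.eq_iff] using h

theorem ECQ.code_inj : Function.Injective ECQ.code := by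
  have hq := codeList_inj CQ.code_inj
  intro a
  induction a with
  | atom q => intro b h; cases b <;> simp_all [ECQ.code, Nat.pair_eq_pair, hq.eq_iff]
  | neg Q ih =>
    intro b h
    cases b <;> simp [ECQ.code, Nat.pair_eq_pair] at h
    rw [ih h]
  | and Q₁ Q₂ ih₁ ih₂ =>
    intro b h
    cases b <;> simp [ECQ.code, Nat.pair_eq_pair] at h
    rw [ih₁ h.1, ih₂ h.2]
  | ex x Q ih =>
    intro b h
    cases b <;> simp [ECQ.code, Nat.pair_eq_pair] at h
    rw [h.1, ih h.2]

theorem ETerm.code_inj : Function.Injective ETerm.code := by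
  have h1 := codeList_inj (Function.injective_id (α := ℕ))
  intro a b h
  cases a <;> cases b <;>
    simp_all [ETerm.code, Nat.pair_eq_pair, QTerm.code_inj.eq_iff, h1.eq_iff]

theorem Effect.code_inj : Function.Injective Effect.code := by
  have h1 := codeList_inj CQ.code_inj
  have h2 := codeList_inj (Atom.code_inj ETerm.code_inj)
  rintro ⟨⟩ ⟨⟩ h
  simpa [Effect.code, Nat.pair_eq_pair, h1.eq_iff, h2.eq_iff, ECQ.code_inj.eq_iff] using h

theorem Action.code_inj : Function.Injective Action.code := by
  have h1 := codeList_inj (Function.injective_id (α := ℕ))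
  have h2 := codeList_inj Effect.code_inj
  rintro ⟨⟩ ⟨⟩ h
  simpa [Action.code, Nat.pair_eq_pair, h1.eq_iff, h2.eq_iff] using h

theorem KAB.code_inj : Function.Injective KAB.code := by
  have h1 := codeList_inj (Atom.code_inj (Function.injective_id (α := ℕ)))
  have h2 := codeList_inj Action.code_inj
  have h3 := codeList_inj (codePair_inj ECQ.code_inj (Function.injective_id (α := ℕ)))
  rintro ⟨⟩ ⟨⟩ h
  simpa [KAB.code, Nat.pair_eq_pair, h1.eq_iff, h2.eq_iff, h3.eq_iff, TBox.code_inj.eq_iff]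
    using h

theorem MuForm.code_inj : Function.Injective MuForm.code := by
  intro a
  induction a with
  | query Q =>
    intro b h; cases b <;> simp_all [MuForm.code, Nat.pair_eq_pair, ECQ.code_inj.eq_iff]
  | pvar Z => intro b h; cases b <;> simp_all [MuForm.code, Nat.pair_eq_pair]
  | neg φ ih =>
    intro b h
    cases b <;> simp [MuForm.code, Nat.pair_eq_pair] at h
    rw [ih h]
  | dia φ ih =>
    intro b h
    cases b <;> simp [MuForm.code, Nat.pair_eq_pair] at h
    rw [ih h]
  | and φ ψ ih₁ ih₂ =>
    intro b h
    cases b <;> simp [MuForm.code, Nat.pair_eq_pair] at h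
    rw [ih₁ h.1, ih₂ h.2]
  | ex x φ ih =>
    intro b h
    cases b <;> simp [MuForm.code, Nat.pair_eq_pair] at h
    rw [h.1, ih h.2]
  | mu Z φ ih =>
    intro b h
    cases b <;> simp [MuForm.code, Nat.pair_eq_pair] at h
    rw [h.1, ih h.2]

theorem instanceCode_inj {K K' : KAB} {φ φ' : MuForm}
    (h : instanceCode K φ = instanceCode K' φ') : K = K' ∧ φ = φ' := by
  simp only [instanceCode, Nat.pair_eq_pair] at h
  exact ⟨KAB.code_inj h.1, MuForm.code_inj h.2⟩

end ITKAB

namespace ITKAB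

/-! ## The canonical model of a DL-Lite knowledge base -/

/-! The procedure searches through all numbers for a certificate, which codes a finite transition
system that agrees with the it-transition system up to renaming of constants, and then model checks
the formula on it. Every certificate that passes the primitive recursive test `checkC` gives the
correct answer (`answerC_iff`), whether or not the system is run-bounded. Run-boundedness is used
only to show that some certificate exists (`exists_checkC`), that is, for termination. This is why
no bound has to be part of the input.

Local queries are decidable because a DL-Lite_A knowledge base has a canonical model `can`, a forest
of words over role names. If the knowledge base has a model at all, `can` is a model and maps
homomorphically to every other one. So certain answers are answers in `can` (`certain_iff_can`), and
consistency says that the role facts respect functionality and that `can` does not satisfy the UCQ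
of violated negative inclusions (`consistent_iff`). A match of a conjunctive query in `can` can be
moved to words of bounded length (`CanMatch.exists_bounded`), so a finite search decides queries. An
ABox has finitely many subsets, hence repairs, AR-entailment, ECQs and successor states with
constants below a bound are computable (`cqaC_iff`, `holdsC_iff`, `mem_succC_of_step`).

The infinitely many results of service calls are tamed by genericity: queries and steps commute with
every permutation of the constants that fixes those of the specification (`ECQ.holds_perm`,
`KAB.Step.perm`). Two states are related when such a permutation maps one to the other and carries
the current values of the individual variables along (`Rel`). A value may be needed after it has
left the ABox, so an `Abstraction` must simulate steps while keeping up to `n` extra constants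
fixed. The number of values held at once is bounded by the size of the formula, so one finite system
serves a given formula. Invariance of the fixpoint logic is `MuForm.sem_compat`.

A certificate consists of a bound `M` on the constants, a bound `k` on the number of constants of a
state, and a list of states closed under those steps that stay below `M`. If `M` is at least `2 * n
+ 2 * k + 2`, there is room to rename the new constants of an arbitrary step below `M` without
touching the fixed ones, and this yields an abstraction (`abstraction_of_checkC`). If all runs use
fewer than `b` constants, the reachable states with constants below `2 * n + 2 * b + 2` form a
certificate: the constants of a state, including those in its service call map, all occur along a
run leading to it, and there are only finitely many such states.

Least fixpoints over the finite system are evaluated as intersections of pre-fixpoints, by going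
through all subsets of the list (`semC_iff`). -/

@[simp] theorem DLRole.inverse_inverse (R : DLRole) : R.inverse.inverse = R := by
  cases R <;> rfl

theorem Interp.roleExt_inverse (I : Interp) (R : DLRole) (a b : I.Dom) :
    I.roleExt R.inverse a b ↔ I.roleExt R b a := by
  cases R <;> rfl

/-- One step of the role hierarchy. -/
def TBox.roleStep (T : TBox) (R S : DLRole) : Prop :=
  (R, S) ∈ T.posR ∨ (R.inverse, S.inverse) ∈ T.posR

/-- The role hierarchy. -/
def TBox.roleSub (T : TBox) : DLRole → DLRole → Prop := Relation.ReflTransGen T.roleStep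

/-- One step of the concept hierarchy. -/
def TBox.concStep (T : TBox) (B C : DLConcept) : Prop :=
  (B, C) ∈ T.posC ∨ ∃ R S, B = .ex R ∧ C = .ex S ∧ T.roleStep R S

/-- The concept hierarchy. -/
def TBox.concSub (T : TBox) : DLConcept → DLConcept → Prop := Relation.ReflTransGen T.concStep

theorem TBox.roleStep.inverse {T : TBox} {R S : DLRole} (h : T.roleStep R S) :
    T.roleStep R.inverse S.inverse := by
  rcases h with h | h
  · exact Or.inr (by simpa using h)
  · exact Or.inl h

theorem TBox.roleSub.inverse {T : TBox} {R S : DLRole} (h : T.roleSub R S) :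
    T.roleSub R.inverse S.inverse := by
  induction h with
  | refl => exact .refl
  | tail _ h ih => exact ih.tail h.inverse

theorem TBox.roleSub.concSub {T : TBox} {R S : DLRole} (h : T.roleSub R S) :
    T.concSub (.ex R) (.ex S) := by
  induction h with
  | refl => exact .refl
  | tail _ h ih => exact ih.tail (Or.inr ⟨_, _, rfl, rfl, h⟩)

/-- The last step of a nontrivial chain into `R` is an axiom with `R` or its inverse on the right,
which DL-Lite_A forbids for functional `R`. Hence a functional role has no proper subrole. -/
theorem TBox.IsDLLiteA.eq_of_roleSub {T : TBox} (hT : T.IsDLLiteA) {R S : DLRole}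
    (hR : R ∈ T.func) (h : T.roleSub S R) : S = R := by
  rcases Relation.ReflTransGen.cases_tail h with h | ⟨U, _, h | h⟩
  · exact h.symm
  · exact absurd rfl (hT R hR _ h).1
  · exact absurd rfl (hT R hR _ h).2

/-- The role facts of an ABox. -/
def factRole (A : ABox) : DLRole → ℕ → ℕ → Prop
  | .name P, c, d => Atom.role P c d ∈ A
  | .inv P, c, d => Atom.role P d c ∈ A

theorem factRole_inverse (A : ABox) (R : DLRole) (c d : ℕ) :
    factRole A R.inverse c d ↔ factRole A R d c := by
  cases R <;> rfl

/-- The basic concepts that an ABox asserts of a constant. -/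
def baseC (A : ABox) (c : ℕ) : DLConcept → Prop
  | .name N => Atom.concept N c ∈ A
  | .ex R => ∃ d, factRole A R c d

/-- Elements of the canonical model: a constant followed by the roles (last one first) that lead
from it to the element. -/
abbrev Word : Type := ℕ × List DLRole

/-- The basic concepts of an element. -/
def wtp (T : TBox) (A : ABox) (c : ℕ) : List DLRole → DLConcept → Prop
  | [], B => ∃ B₀, baseC A c B₀ ∧ T.concSub B₀ B
  | R :: _, B => T.concSub (.ex R.inverse) B

/-- The element has a successor for the role already. -/
def whas (A : ABox) (c : ℕ) : List DLRole → DLRole → Prop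
  -- Facts about proper subroles of `R` do not count. The redundant successors are harmless for
  -- universality, and functional roles have no proper subroles.
  | [], R => baseC A c (.ex R)
  | S :: _, R => R = S.inverse

/-- The words that are generated by the chase. -/
def wvalid (T : TBox) (A : ABox) (c : ℕ) : List DLRole → Prop
  | [] => True
  | R :: ws => wvalid T A c ws ∧ wtp T A c ws (.ex R) ∧ ¬ whas A c ws R

/-- The roles of the canonical model. -/
inductive CanRel (T : TBox) (A : ABox) : DLRole → Word → Word → Prop where
  | fact {S R c d} : factRole A S c d → T.roleSub S R → CanRel T A R (c, []) (d, [])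
  | child {S R c ws} : wvalid T A c (S :: ws) → T.roleSub S R →
      CanRel T A R (c, ws) (c, S :: ws)
  | parent {S R c ws} : wvalid T A c (S :: ws) → T.roleSub S.inverse R →
      CanRel T A R (c, S :: ws) (c, ws)

/-- The canonical model. -/
def can (T : TBox) (A : ABox) : Interp where
  Dom := Word
  const c := (c, [])
  una := fun a b h => by simpa using h
  -- Words that the chase does not generate remain in the domain but lie in no concept and no role.
  conc N w := wvalid T A w.1 w.2 ∧ wtp T A w.1 w.2 (.name N)
  role P := CanRel T A (.name P)

theorem CanRel.inverse {T : TBox} {A : ABox} {R : DLRole} {w w' : Word} (h : CanRel T A R w w') :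
    CanRel T A R.inverse w' w := by
  cases h with
  | fact h h' => exact .fact ((factRole_inverse A _ _ _).2 h) h'.inverse
  | child h h' => exact .parent h h'.inverse
  | parent h h' => exact .child h (by simpa using h'.inverse)

theorem can_roleExt (T : TBox) (A : ABox) (R : DLRole) (w w' : Word) :
    (can T A).roleExt R w w' ↔ CanRel T A R w w' := by
  cases R with
  | name P => rfl
  | inv P => exact ⟨fun h => CanRel.inverse (R := .name P) h, fun h => CanRel.inverse (R := .inv P) h⟩

theorem CanRel.valid_left {T : TBox} {A : ABox} {R : DLRole} {w w' : Word}
    (h : CanRel T A R w w') : wvalid T A w.1 w.2 := by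
  cases h with
  | fact h h' => trivial
  | child h h' => exact h.1
  | parent h h' => exact h

theorem CanRel.wtp_left {T : TBox} {A : ABox} {R : DLRole} {w w' : Word}
    (h : CanRel T A R w w') : wtp T A w.1 w.2 (.ex R) := by
  cases h with
  | fact h h' => exact ⟨.ex _, ⟨_, h⟩, h'.concSub⟩
  | @child S R c ws h h' =>
    have := h.2.1
    cases ws with
    | nil => obtain ⟨B, hB, hB'⟩ := this; exact ⟨B, hB, hB'.trans h'.concSub⟩
    | cons U ws => exact Relation.ReflTransGen.trans this h'.concSub
  | parent h h' => exact h'.concSub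

/-- A required `R`-successor is a fact or the parent if `whas` holds, and otherwise it is the
generated child `R :: ws`. So membership in `∃R` can be read off the type of the word. -/
theorem can_concExt (T : TBox) (A : ABox) (B : DLConcept) (w : Word) :
    (can T A).concExt B w ↔ wvalid T A w.1 w.2 ∧ wtp T A w.1 w.2 B := by
  cases B with
  | name N => rfl
  | ex R =>
    constructor
    · rintro ⟨w', h⟩
      replace h := (can_roleExt _ _ _ _ _).1 h
      exact ⟨h.valid_left, h.wtp_left⟩
    · rintro ⟨hv, ht⟩
      obtain ⟨c, ws⟩ := w
      by_cases hh : whas A c ws R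
      · cases ws with
        | nil =>
          obtain ⟨d, hd⟩ := hh
          exact ⟨(d, []), (can_roleExt ..).2 (.fact hd .refl)⟩
        | cons S ws =>
          have hh : R = S.inverse := hh
          exact ⟨(c, ws), (can_roleExt ..).2 (.parent hv (hh ▸ .refl))⟩
      · exact ⟨(c, R :: ws), (can_roleExt ..).2 (.child ⟨hv, ht, hh⟩ .refl)⟩

/-- The role facts of `A` satisfy the functionality assertions. -/
def FactFunc (T : TBox) (A : ABox) : Prop :=
  ∀ R ∈ T.func, ∀ c d d', factRole A R c d → factRole A R c d' → d = d'

/-- The negative inclusions of the TBox. -/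
structure Interp.SatNeg (I : Interp) (T : TBox) : Prop where
  negC : ∀ p ∈ T.negC, ∀ a, I.concExt p.1 a → ¬ I.concExt p.2 a
  negR : ∀ p ∈ T.negR, ∀ a b, I.roleExt p.1 a b → ¬ I.roleExt p.2 a b

/-- A functional role has no proper subrole, so each of its edges is a fact, a generated child or a
parent edge for exactly this role. The condition `¬ whas` on generated words excludes a child next
to a fact or next to a parent. -/
theorem can_func {T : TBox} {A : ABox} (hT : T.IsDLLiteA) (hA : FactFunc T A) (R : DLRole)
    (hR : R ∈ T.func) (a b c : Word) (h : CanRel T A R a b) (h' : CanRel T A R a c) : b = c := by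
  cases h with
  | fact h₁ h₂ =>
    obtain rfl := hT.eq_of_roleSub hR h₂
    cases h' with
    | fact h₃ h₄ =>
      obtain rfl := hT.eq_of_roleSub hR h₄
      rw [hA _ hR _ _ _ h₁ h₃]
    | child h₃ h₄ =>
      obtain rfl := hT.eq_of_roleSub hR h₄
      exact absurd ⟨_, h₁⟩ h₃.2.2
  | child h₁ h₂ =>
    obtain rfl := hT.eq_of_roleSub hR h₂
    cases h' with
    | fact h₃ h₄ =>
      obtain rfl := hT.eq_of_roleSub hR h₄
      exact absurd ⟨_, h₃⟩ h₁.2.2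
    | child h₃ h₄ => obtain rfl := hT.eq_of_roleSub hR h₄; rfl
    | parent h₃ h₄ => exact absurd (hT.eq_of_roleSub hR h₄).symm h₁.2.2
  | parent h₁ h₂ =>
    cases h' with
    | child h₃ h₄ =>
      obtain rfl := hT.eq_of_roleSub hR h₄
      exact absurd (hT.eq_of_roleSub hR h₂).symm h₃.2.2
    | parent h₃ h₄ => rfl

/-- Positive inclusions hold because types and edges are closed under the hierarchies. Negative
inclusions are not built in and enter as a hypothesis. -/
theorem can_isModel {T : TBox} {A : ABox} (hT : T.IsDLLiteA) (hA : FactFunc T A)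
    (hn : (can T A).SatNeg T) : (can T A).IsModel T A := by
  refine ⟨⟨?_, hn.negC, ?_, hn.negR, ?_⟩, ?_⟩
  · intro p hp w h
    replace h := (can_concExt _ _ _ _).1 h
    refine (can_concExt _ _ _ _).2 ⟨h.1, ?_⟩
    have hs : T.concStep p.1 p.2 := Or.inl hp
    obtain ⟨c, ws⟩ := w
    cases ws with
    | nil => obtain ⟨_, B, hB, hB'⟩ := h; exact ⟨B, hB, hB'.tail hs⟩
    | cons U ws => exact Relation.ReflTransGen.tail h.2 hs
  · intro p hp w w' h
    replace h := (can_roleExt _ _ _ _ _).1 h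
    refine (can_roleExt _ _ _ _ _).2 ?_
    have hs : T.roleSub p.1 p.2 := .single (Or.inl hp)
    cases h with
    | fact h h' => exact .fact h (h'.trans hs)
    | child h h' => exact .child h (h'.trans hs)
    | parent h h' => exact .parent h (h'.trans hs)
  · intro R hR a b c h h'
    replace h := (can_roleExt _ _ _ _ _).1 h
    replace h' := (can_roleExt _ _ _ _ _).1 h'
    exact can_func hT hA R hR a b c h h'
  · rintro (⟨N, c⟩ | ⟨P, c, d⟩) hF
    · exact ⟨trivial, .name N, hF, .refl⟩
    · exact CanRel.fact (S := .name P) hF .refl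

/-! ### Universality: homomorphisms from the canonical model to all models. -/

theorem Interp.SatTBox.roleSub {I : Interp} {T : TBox} (hI : I.SatTBox T) {R S : DLRole}
    (h : T.roleSub R S) {a b : I.Dom} (hab : I.roleExt R a b) : I.roleExt S a b := by
  induction h with
  | refl => exact hab
  | tail _ h ih =>
    rcases h with h | h
    · exact hI.posR _ h _ _ ih
    · exact (I.roleExt_inverse _ _ _).1 (hI.posR _ h _ _ ((I.roleExt_inverse _ _ _).2 ih))

theorem Interp.SatTBox.concSub {I : Interp} {T : TBox} (hI : I.SatTBox T) {B C : DLConcept}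
    (h : T.concSub B C) {a : I.Dom} (ha : I.concExt B a) : I.concExt C a := by
  induction h with
  | refl => exact ha
  | tail _ h ih =>
    rcases h with h | ⟨R, S, rfl, rfl, h⟩
    · exact hI.posC _ h _ ih
    · obtain ⟨b, hb⟩ := ih
      exact ⟨b, hI.roleSub (.single h) hb⟩

open Classical in
/-- The homomorphism from the canonical model to a model. -/
noncomputable def canHom (I : Interp) (c : ℕ) : List DLRole → I.Dom
  | [] => I.const c
  | R :: ws => if h : ∃ y, I.roleExt R (canHom I c ws) y then h.choose else canHom I c ws

theorem Interp.IsModel.factRole {I : Interp} {T : TBox} {A : ABox} (hI : I.IsModel T A)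
    {R : DLRole} {c d : ℕ} (h : factRole A R c d) : I.roleExt R (I.const c) (I.const d) := by
  cases R with
  | name P => exact hI.2 _ h
  | inv P => exact hI.2 _ h

theorem Interp.IsModel.baseC {I : Interp} {T : TBox} {A : ABox} (hI : I.IsModel T A)
    {B : DLConcept} {c : ℕ} (h : baseC A c B) : I.concExt B (I.const c) := by
  cases B with
  | name P => exact hI.2 _ h
  | ex R => obtain ⟨d, hd⟩ := h; exact ⟨_, hI.factRole hd⟩

/-- By induction on the word, the image satisfies every concept in the type of the word. So the
successor that `canHom` chooses exists and its default branch is not taken on generated words. -/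
theorem canHom_child {I : Interp} {T : TBox} {A : ABox} (hI : I.IsModel T A) (c : ℕ)
    (ws : List DLRole) (hv : wvalid T A c ws) :
    (∀ B, wtp T A c ws B → I.concExt B (canHom I c ws)) ∧
    ∀ R, wtp T A c ws (.ex R) → I.roleExt R (canHom I c ws) (canHom I c (R :: ws)) := by
  have key : (∀ B, wtp T A c ws B → I.concExt B (canHom I c ws)) →
      ∀ R, wtp T A c ws (.ex R) → I.roleExt R (canHom I c ws) (canHom I c (R :: ws)) := by
    intro h R hR
    have h' : ∃ y, I.roleExt R (canHom I c ws) y := h _ hR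
    rw [canHom, dif_pos h']
    exact h'.choose_spec
  refine ⟨?_, key ?_⟩ <;>
  · induction ws with
    | nil => rintro B ⟨B₀, h, h'⟩; exact hI.1.concSub h' (hI.baseC h)
    | cons R ws ih =>
      intro B hB
      have ih := ih hv.1 (fun h R hR => by
        have h' : ∃ y, I.roleExt R (canHom I c ws) y := h _ hR
        rw [canHom, dif_pos h']
        exact h'.choose_spec)
      have h' : ∃ y, I.roleExt R (canHom I c ws) y := ih _ hv.2.1
      refine hI.1.concSub hB ⟨canHom I c ws, (I.roleExt_inverse _ _ _).2 ?_⟩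
      rw [canHom, dif_pos h']
      exact h'.choose_spec

theorem canHom_role {I : Interp} {T : TBox} {A : ABox} (hI : I.IsModel T A) {R : DLRole}
    {w w' : Word} (h : CanRel T A R w w') :
    I.roleExt R (canHom I w.1 w.2) (canHom I w'.1 w'.2) := by
  cases h with
  | fact h h' => exact hI.1.roleSub h' (hI.factRole h)
  | child h h' => exact hI.1.roleSub h' ((canHom_child hI _ _ h.1).2 _ h.2.1)
  | parent h h' =>
    exact hI.1.roleSub h' ((I.roleExt_inverse _ _ _).2 ((canHom_child hI _ _ h.1).2 _ h.2.1))

theorem canHom_conc {I : Interp} {T : TBox} {A : ABox} (hI : I.IsModel T A) {B : DLConcept}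
    {w : Word} (h : (can T A).concExt B w) : I.concExt B (canHom I w.1 w.2) := by
  rw [can_concExt] at h
  exact (canHom_child hI _ _ h.1).1 _ h.2

/-- UCQs are positive existential, hence preserved by the homomorphism `canHom`, which fixes the
constants. -/
theorem satUCQ_of_can {I : Interp} {T : TBox} {A : ABox} (hI : I.IsModel T A) {q : UCQ}
    {v : ℕ → ℕ} (h : (can T A).satUCQ q v) : I.satUCQ q v := by
  obtain ⟨d, hd, e, he, hat⟩ := h
  refine ⟨d, hd, fun x => canHom I (e x).1 (e x).2, fun x hx => ?_, fun a ha => ?_⟩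
  · simp only [he x hx]; rfl
  · have h := hat a ha
    have ht : ∀ t : QTerm, I.termVal (fun x => canHom I (e x).1 (e x).2) t =
        canHom I ((can T A).termVal e t).1 ((can T A).termVal e t).2 := by
      intro t; cases t <;> rfl
    cases a with
    | concept N t =>
      simp only [Interp.satAtom, ht]
      exact canHom_conc hI (B := .name N) h
    | role P t t' =>
      simp only [Interp.satAtom, ht]
      exact canHom_role hI (R := .name P) h

/-- A violation in the canonical model would be carried by `canHom` into any given model. For
functionality of the facts, the unique name assumption is what turns equality in the model into
equality of constants. -/
theorem consistent_iff_can {T : TBox} {A : ABox} (hT : T.IsDLLiteA) :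
    Consistent T A ↔ FactFunc T A ∧ (can T A).SatNeg T := by
  constructor
  · rintro ⟨I, hI⟩
    refine ⟨fun R hR c d d' h h' => I.una (hI.1.func R hR _ _ _ (hI.factRole h)
      (hI.factRole h')), ⟨fun p hp w h h' => ?_, fun p hp w w' h h' => ?_⟩⟩
    · exact hI.1.negC p hp _ (canHom_conc hI h) (canHom_conc hI h')
    · exact hI.1.negR p hp _ _ (canHom_role hI ((can_roleExt _ _ _ _ _).1 h))
        (canHom_role hI ((can_roleExt _ _ _ _ _).1 h'))
  · rintro ⟨h, h'⟩
    exact ⟨_, can_isModel hT h h'⟩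

theorem certain_iff_can {T : TBox} {A : ABox} (hT : T.IsDLLiteA) (hA : Consistent T A) (q : UCQ)
    (v : ℕ → ℕ) : (∀ I : Interp, I.IsModel T A → I.satUCQ q v) ↔ (can T A).satUCQ q v := by
  rw [consistent_iff_can hT] at hA
  exact ⟨fun h => h _ (can_isModel hT hA.1 hA.2), fun h I hI => satUCQ_of_can hI h⟩

theorem cqa_iff_can {T : TBox} (hT : T.IsDLLiteA) (A : ABox) (q : UCQ) (v : ℕ → ℕ) :
    cqa T A q v ↔ ∀ R, IsRepair T A R → (can T R).satUCQ q v := by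
  refine forall_congr' fun R => forall_congr' fun hR => ?_
  exact certain_iff_can hT hR.prop.2 q v

/-! ### Inconsistency expressed by a query. -/

/-- Atoms saying that `t` belongs to a basic concept; `z` is a fresh variable. -/
def DLConcept.toAtom (z : ℕ) (t : QTerm) : DLConcept → Atom QTerm
  | .name N => .concept N t
  | .ex (.name P) => .role P t (.var z)
  | .ex (.inv P) => .role P (.var z) t

/-- Atoms of role expressions. -/
def DLRole.toAtom (t t' : QTerm) : DLRole → Atom QTerm
  | .name P => .role P t t'
  | .inv P => .role P t' t

/-- The violations of the negative inclusions. -/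
def TBox.violations (T : TBox) : UCQ :=
  T.negC.map (fun p => ⟨[0, 1, 2], [p.1.toAtom 1 (.var 0), p.2.toAtom 2 (.var 0)]⟩) ++
  T.negR.map (fun p => ⟨[0, 1, 2], [p.1.toAtom (.var 0) (.var 1), p.2.toAtom (.var 0) (.var 1)]⟩)

theorem Interp.satAtom_conc (I : Interp) (e : ℕ → I.Dom) (z : ℕ) (t : QTerm) (B : DLConcept)
    (h : I.satAtom (I.termVal e) (B.toAtom z t)) : I.concExt B (I.termVal e t) := by
  rcases B with N | (P | P)
  · exact h
  · exact ⟨_, h⟩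
  · exact ⟨_, h⟩

theorem Interp.exists_satAtom_conc (I : Interp) (B : DLConcept) (a : I.Dom)
    (h : I.concExt B a) : ∃ b, ∀ (e : ℕ → I.Dom) (z : ℕ) (t : QTerm), I.termVal e t = a → e z = b →
      I.satAtom (I.termVal e) (B.toAtom z t) := by
  rcases B with N | (P | P)
  · exact ⟨a, fun e z t h₁ _ => by subst h₁; exact h⟩
  · obtain ⟨b, h⟩ := h
    exact ⟨b, fun e z t h₁ h₂ => by subst h₁ h₂; exact h⟩
  · obtain ⟨b, h⟩ := h
    exact ⟨b, fun e z t h₁ h₂ => by subst h₁ h₂; exact h⟩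

theorem Interp.satAtom_role (I : Interp) (e : ℕ → I.Dom) (t t' : QTerm) (R : DLRole) :
    I.satAtom (I.termVal e) (R.toAtom t t') ↔ I.roleExt R (I.termVal e t) (I.termVal e t') := by
  cases R <;> rfl

/-- All variables of the violation queries are among the bound variables 0, 1, 2, so `v` has no
influence. For concepts, 0 is the offending element and 1, 2 are the witnesses of the two
existential restrictions. -/
theorem Interp.satNeg_iff (I : Interp) (T : TBox) (v : ℕ → ℕ) :
    I.SatNeg T ↔ ¬ I.satUCQ T.violations v := by
  constructor
  · rintro ⟨hC, hR⟩ ⟨d, hd, e, -, hat⟩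
    simp only [TBox.violations, List.mem_append, List.mem_map] at hd
    rcases hd with ⟨p, hp, rfl⟩ | ⟨p, hp, rfl⟩
    · exact hC p hp (e 0) (I.satAtom_conc e 1 (.var 0) _ (hat _ (by simp)))
        (I.satAtom_conc e 2 (.var 0) _ (hat _ (by simp)))
    · exact hR p hp (e 0) (e 1) ((I.satAtom_role e (.var 0) (.var 1) _).1 (hat _ (by simp)))
        ((I.satAtom_role e (.var 0) (.var 1) _).1 (hat _ (by simp)))
  · intro h
    refine ⟨fun p hp a h₁ h₂ => h ?_, fun p hp a b h₁ h₂ => h ?_⟩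
    · obtain ⟨b, hb⟩ := I.exists_satAtom_conc _ _ h₁
      obtain ⟨c, hc⟩ := I.exists_satAtom_conc _ _ h₂
      refine ⟨_, List.mem_append_left _ (List.mem_map_of_mem hp), fun x => if x = 0 then a else
        if x = 1 then b else if x = 2 then c else I.const (v x), ?_, ?_⟩
      · intro x hx; simp at hx; simp [hx]
      · simp only [List.mem_cons, List.not_mem_nil, or_false, forall_eq_or_imp, forall_eq]
        exact ⟨hb _ _ _ rfl rfl, hc _ _ _ rfl rfl⟩
    · refine ⟨_, List.mem_append_right _ (List.mem_map_of_mem hp), fun x => if x = 0 then a else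
        if x = 1 then b else if x = 2 then a else I.const (v x), ?_, ?_⟩
      · intro x hx; simp at hx; simp [hx]
      · simp only [List.mem_cons, List.not_mem_nil, or_false, forall_eq_or_imp, forall_eq,
          Interp.satAtom_role]
        exact ⟨h₁, h₂⟩

/-- Consistency is thereby reduced to evaluating a UCQ in `can`, which makes sense even when `can`
is not a model. -/
theorem consistent_iff {T : TBox} {A : ABox} (hT : T.IsDLLiteA) (v : ℕ → ℕ) :
    Consistent T A ↔ FactFunc T A ∧ ¬ (can T A).satUCQ T.violations v := by
  rw [consistent_iff_can hT, Interp.satNeg_iff _ _ v]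

end ITKAB

namespace ITKAB

/-! ## Bounding the depth of matches in the canonical model -/

/-- The roles that can occur in generated words. -/
def TBox.alphabet (T : TBox) : List DLRole :=
  T.posC.flatMap (fun p => match p.2 with
    | .name _ => []
    | .ex R => [R]) ++
  T.posR.flatMap (fun p => [p.2, p.2.inverse])

theorem TBox.concStep.mem_alphabet {T : TBox} {B : DLConcept} {S : DLRole}
    (h : T.concStep B (.ex S)) : S ∈ T.alphabet := by
  simp only [TBox.alphabet, List.mem_append, List.mem_flatMap]
  rcases h with h | ⟨R, S', rfl, h', h | h⟩
  · exact Or.inl ⟨_, h, by simp⟩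
  · cases h'; exact Or.inr ⟨_, h, by simp⟩
  · cases h'; exact Or.inr ⟨_, h, by simp⟩

/-- A role is generated only if no successor for it is present, so the chain of inclusions that
demands it is nontrivial. Its last step has `∃R` on the right, which puts `R` into the finite
alphabet. -/
theorem wvalid.mem_alphabet {T : TBox} {A : ABox} {c : ℕ} {ws : List DLRole}
    (h : wvalid T A c ws) : ∀ R ∈ ws, R ∈ T.alphabet := by
  induction ws with
  | nil => simp
  | cons R ws ih =>
    obtain ⟨h₁, h₂, h₃⟩ := h
    refine List.forall_mem_cons.2 ⟨?_, ih h₁⟩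
    cases ws with
    | nil =>
      obtain ⟨B, hB, hs⟩ := h₂
      rcases Relation.ReflTransGen.cases_tail hs with rfl | ⟨C, _, hC⟩
      · exact absurd hB h₃
      · exact hC.mem_alphabet
    | cons S ws =>
      rcases Relation.ReflTransGen.cases_tail h₂ with h | ⟨C, _, hC⟩
      · exact absurd (by cases h; rfl) h₃
      · exact hC.mem_alphabet

theorem factRole.mem_adom {A : ABox} {R : DLRole} {c d : ℕ} (h : factRole A R c d) :
    c ∈ adom A ∧ d ∈ adom A := by
  cases R <;> exact ⟨⟨_, h, by simp [Atom.terms]⟩, ⟨_, h, by simp [Atom.terms]⟩⟩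

theorem baseC.mem_adom {A : ABox} {c : ℕ} {B : DLConcept} (h : baseC A c B) : c ∈ adom A := by
  cases B with
  | name N => exact ⟨_, h, by simp [Atom.terms]⟩
  | ex R => obtain ⟨d, hd⟩ := h; exact hd.mem_adom.1

theorem wvalid.mem_adom {T : TBox} {A : ABox} {c : ℕ} {ws : List DLRole} {B : DLConcept}
    (h : wvalid T A c ws) (h' : wtp T A c ws B) : c ∈ adom A := by
  induction ws generalizing B with
  | nil => obtain ⟨B, hB, _⟩ := h'; exact hB.mem_adom
  | cons R ws ih => exact ih h.1 h.2.1

theorem wvalid.of_append {T : TBox} {A : ABox} {c : ℕ} (y : List DLRole) {p : List DLRole}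
    (h : wvalid T A c (y ++ p)) : wvalid T A c p := by
  induction y with
  | nil => exact h
  | cons R y ih => exact ih h.1

/-- Below the constants, the type of an element depends only on the last role of its word, which is
the head of the list. Hence the whole subtree below it does. -/
theorem wtp_congr_head {T : TBox} {A : ABox} {c : ℕ} (y : List DLRole) {p p' : List DLRole}
    (hp : p ≠ []) (hh : p'.head? = p.head?) {B : DLConcept} :
    wtp T A c (y ++ p') B ↔ wtp T A c (y ++ p) B := by
  cases y with
  | nil => cases p <;> cases p' <;> simp_all [wtp]
  | cons => rfl

theorem whas_congr_head {A : ABox} {c : ℕ} (y : List DLRole) {p p' : List DLRole}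
    (hp : p ≠ []) (hh : p'.head? = p.head?) {R : DLRole} :
    whas A c (y ++ p') R ↔ whas A c (y ++ p) R := by
  cases y with
  | nil => cases p <;> cases p' <;> simp_all [whas]
  | cons => rfl

/-- Elements with the same last role generate the same subtree, so the part `p` of a word that is
nearest to the constant can be exchanged for any valid `p'` ending in the same role. -/
theorem wvalid.replace {T : TBox} {A : ABox} {c : ℕ} {y : List DLRole} {p p' : List DLRole}
    (hp : p ≠ []) (hh : p'.head? = p.head?) (hp' : wvalid T A c p')
    (h : wvalid T A c (y ++ p)) : wvalid T A c (y ++ p') := by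
  induction y with
  | nil => exact hp'
  | cons R y ih =>
    exact ⟨ih h.1, (wtp_congr_head y hp hh).2 h.2.1,
      fun h' => h.2.2 ((whas_congr_head y hp hh).1 h')⟩

theorem exists_append_of_not_nodup {α : Type*} {l : List α} (h : ¬ l.Nodup) :
    ∃ a x b c, l = a ++ x :: (b ++ x :: c) := by
  induction l with
  | nil => simp at h
  | cons x l ih =>
    by_cases hx : x ∈ l
    · obtain ⟨b, c, rfl⟩ := List.append_of_mem hx
      exact ⟨[], x, b, c, rfl⟩
    · obtain ⟨a, z, b, c, rfl⟩ := ih (fun hl => h (List.nodup_cons.2 ⟨hx, hl⟩))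
      exact ⟨x :: a, z, b, c, rfl⟩

/-- A pumping argument: the segment between two occurrences of a role can be cut out without
changing the last role. A word without repetitions is no longer than the alphabet. -/
theorem wvalid.exists_short {T : TBox} {A : ABox} {c : ℕ} {p : List DLRole} (hp : p ≠ [])
    (h : wvalid T A c p) : ∃ p' : List DLRole, p'.head? = p.head? ∧ wvalid T A c p' ∧
      p'.length ≤ T.alphabet.length := by
  induction hn : p.length using Nat.strong_induction_on generalizing p with
  | _ n ih =>
    by_cases hd : p.Nodup
    · exact ⟨p, rfl, h, (hd.subperm h.mem_alphabet).length_le⟩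
    · obtain ⟨a, x, b, d, rfl⟩ := exists_append_of_not_nodup hd
      have hx : wvalid T A c (x :: d) := wvalid.of_append (a ++ x :: b) (by simpa using h)
      have hv : wvalid T A c (a ++ x :: d) := wvalid.replace (p := x :: (b ++ x :: d)) (by simp) (by simp) hx h
      obtain ⟨p', h₁, h₂, h₃⟩ := ih _ (by rw [← hn]; simp) (by simp) hv rfl
      exact ⟨p', by rw [h₁]; cases a <;> rfl, h₂, h₃⟩

/-! ### Moving matches to short words. -/

/-- Replace the prefixes of length `l + 1` of long words according to `f`. -/
def shiftWord (l : ℕ) (f : ℕ → List DLRole → List DLRole) (w : Word) : Word :=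
  if w.2.length ≤ l then w
  else (w.1, w.2.take (w.2.length - (l + 1)) ++ f w.1 (w.2.drop (w.2.length - (l + 1))))

/-- `f` replaces valid words by short ones with the same last role. -/
def Shortens (T : TBox) (A : ABox) (f : ℕ → List DLRole → List DLRole) : Prop :=
  ∀ c p, wvalid T A c p → p ≠ [] → (f c p).head? = p.head? ∧ wvalid T A c (f c p) ∧
    (f c p).length ≤ T.alphabet.length

section shift

variable {T : TBox} {A : ABox} {l : ℕ} {f : ℕ → List DLRole → List DLRole}

/-- Only the part near the constant is replaced, and its last role is kept, so `wvalid.replace` and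
`wtp_congr_head` apply. -/
theorem shiftWord_spec (hf : Shortens T A f) {c : ℕ} {ws : List DLRole} (hv : wvalid T A c ws) :
    wvalid T A c (shiftWord l f (c, ws)).2 ∧
    ∀ B, wtp T A c ws B → wtp T A c (shiftWord l f (c, ws)).2 B := by
  rw [shiftWord]
  split_ifs with h
  · exact ⟨hv, fun B h => h⟩
  · have hne : ws.drop (ws.length - (l + 1)) ≠ [] := by
      simp only [ne_eq, List.drop_eq_nil_iff]; simp at h; omega
    have hsplit := List.take_append_drop (ws.length - (l + 1)) ws
    have hv' : wvalid T A c (ws.drop (ws.length - (l + 1))) := by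
      refine wvalid.of_append (ws.take (ws.length - (l + 1))) ?_
      rwa [hsplit]
    obtain ⟨h₁, h₂, -⟩ := hf c _ hv' hne
    refine ⟨wvalid.replace hne h₁ h₂ (by rwa [hsplit]), fun B hB => ?_⟩
    exact (wtp_congr_head _ hne h₁).2 (by rwa [hsplit])

theorem shiftWord_length (hf : Shortens T A f) {c : ℕ} {ws : List DLRole} (hl : T.alphabet.length ≤ l)
    (hv : wvalid T A c ws) :
    (shiftWord l f (c, ws)).2.length ≤ ws.length ∧
    (l < ws.length → (shiftWord l f (c, ws)).2.length < ws.length) := by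
  rw [shiftWord]
  split_ifs with h
  · exact ⟨le_rfl, fun h' => absurd h' (by simpa using h)⟩
  · have hne : ws.drop (ws.length - (l + 1)) ≠ [] := by
      simp only [ne_eq, List.drop_eq_nil_iff]; simp at h; omega
    have hv' : wvalid T A c (ws.drop (ws.length - (l + 1))) := by
      refine wvalid.of_append (ws.take (ws.length - (l + 1))) ?_
      rwa [List.take_append_drop]
    obtain ⟨-, -, h₃⟩ := hf c _ hv' hne
    simp only [List.length_append, List.length_take] at h ⊢
    omega

/-- An edge can break only if the child is shifted and its parent is not, which means that the
parent has length exactly `l`. Otherwise both stay, or both have the same part replaced. -/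
theorem shiftWord_child (hf : Shortens T A f) {c : ℕ} {ws : List DLRole} {S : DLRole} (h : ws.length ≠ l)
    (hv : wvalid T A c (S :: ws)) :
    ∃ ws', shiftWord l f (c, ws) = (c, ws') ∧ shiftWord l f (c, S :: ws) = (c, S :: ws') ∧
      wvalid T A c (S :: ws') := by
  have hv' := (shiftWord_spec (l := l) hf hv).1
  simp only [shiftWord, List.length_cons] at hv' ⊢
  by_cases h' : ws.length ≤ l
  · rw [if_pos h', if_pos (by omega)]
    exact ⟨ws, rfl, rfl, hv⟩
  · have e : ws.length + 1 - (l + 1) = (ws.length - (l + 1)) + 1 := by omega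
    rw [if_neg h', if_neg (by omega)]
    rw [if_neg (by omega)] at hv'
    simp only [e, List.take_succ_cons, List.drop_succ_cons, List.cons_append] at hv' ⊢
    exact ⟨_, rfl, rfl, hv'⟩

theorem CanRel.shift (hf : Shortens T A f) {R : DLRole} {w w' : Word} (h : CanRel T A R w w') (hw : w.2.length ≠ l)
    (hw' : w'.2.length ≠ l) : CanRel T A R (shiftWord l f w) (shiftWord l f w') := by
  cases h with
  | fact h h' => simpa [shiftWord] using CanRel.fact h h'
  | child h h' =>
    obtain ⟨ws', h₁, h₂, h₃⟩ := shiftWord_child hf hw h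
    rw [h₁, h₂]; exact .child h₃ h'
  | parent h h' =>
    obtain ⟨ws', h₁, h₂, h₃⟩ := shiftWord_child hf hw' h
    rw [h₁, h₂]; exact .parent h₃ h'

end shift

/-- Values of query terms in the canonical model. -/
def wval (e : ℕ → Word) : QTerm → Word
  | .var x => e x
  | .const c => (c, [])

/-- Truth of query atoms in the canonical model. -/
def CanSat (T : TBox) (A : ABox) (e : ℕ → Word) : Atom QTerm → Prop
  | .concept N t => wvalid T A (wval e t).1 (wval e t).2 ∧
      wtp T A (wval e t).1 (wval e t).2 (.name N)
  | .role P t t' => CanRel T A (.name P) (wval e t) (wval e t')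

/-- `e` is a match of the conjunctive query `d` in the canonical model. -/
def CanMatch (T : TBox) (A : ABox) (d : CQ) (v : ℕ → ℕ) (e : ℕ → Word) : Prop :=
  (∀ x, x ∉ d.bound → e x = (v x, [])) ∧ ∀ a ∈ d.atoms, CanSat T A e a

/-- If some value is too long, there is a length `l` that no value has. Edges never cross this gap,
so all words beyond it can be pulled towards their constants simultaneously by `shiftWord` without
destroying the match. The total length of the values drops, so the process ends. -/
theorem CanMatch.exists_short {T : TBox} {A : ABox} {d : CQ} {v : ℕ → ℕ} {e : ℕ → Word}
    (h : CanMatch T A d v e) (hv : ∀ x, wvalid T A (e x).1 (e x).2) :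
    ∃ e' : ℕ → Word, CanMatch T A d v e' ∧ (∀ x, wvalid T A (e' x).1 (e' x).2) ∧
      ∀ x, (e' x).2.length ≤ T.alphabet.length + d.bound.length + 1 := by
  induction hn : (d.bound.map fun x => (e x).2.length).sum using Nat.strong_induction_on
    generalizing e with
  | _ n ih =>
    by_cases hb : ∀ x, (e x).2.length ≤ T.alphabet.length + d.bound.length + 1
    · exact ⟨e, h, hv, hb⟩
    push Not at hb
    obtain ⟨x₀, hx₀⟩ := hb
    -- Pigeonhole: the interval has one more length than there are bound variables. Its lower end
    -- exceeds the alphabet so that shifting shortens, and it exceeds 0, the length of all constants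
    -- and free variables.
    obtain ⟨l, hl, hl'⟩ : ∃ l ∈ Finset.Icc (T.alphabet.length + 1)
        (T.alphabet.length + d.bound.length + 1),
        l ∉ (d.bound.map fun x => (e x).2.length).toFinset := by
      refine Finset.exists_mem_notMem_of_card_lt_card ?_
      refine (List.toFinset_card_le _).trans_lt ?_
      simp only [List.length_map, Nat.card_Icc]
      omega
    simp only [Finset.mem_Icc, List.mem_toFinset, List.mem_map, not_exists, not_and] at hl hl'
    have hlen : ∀ x, (e x).2.length ≠ l := by
      intro x
      by_cases hx : x ∈ d.bound
      · exact hl' x hx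
      · rw [h.1 x hx]; simp; omega
    have hex : ∀ c p, ∃ p', wvalid T A c p → p ≠ [] → p'.head? = p.head? ∧ wvalid T A c p' ∧
        p'.length ≤ T.alphabet.length := by
      intro c p
      by_cases hp : wvalid T A c p ∧ p ≠ []
      · obtain ⟨p', hp'⟩ := hp.1.exists_short hp.2
        exact ⟨p', fun _ _ => hp'⟩
      · exact ⟨p, fun h h' => absurd ⟨h, h'⟩ hp⟩
    choose f hf using hex
    have hsz := fun x => shiftWord_length (l := l) hf (by omega) (hv x)
    have hterm : ∀ t : QTerm, wval (fun x => shiftWord l f (e x)) t =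
        shiftWord l f (wval e t) := by
      rintro (x | c)
      · rfl
      · simp [wval, shiftWord]
    have htl : ∀ t : QTerm, (wval e t).2.length ≠ l := by
      rintro (x | c)
      · exact hlen x
      · simp [wval]; omega
    have hx₀b : x₀ ∈ d.bound := by
      by_contra hx
      rw [h.1 x₀ hx] at hx₀
      simp at hx₀
    have hval : ∀ x, wvalid T A (shiftWord l f (e x)).1 (shiftWord l f (e x)).2 := by
      intro x
      have h₁ : (shiftWord l f (e x)).1 = (e x).1 := by rw [shiftWord]; split_ifs <;> rfl
      rw [h₁]; exact (shiftWord_spec (l := l) hf (hv x)).1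
    refine ih _ ?_ (e := fun x => shiftWord l f (e x)) ⟨?_, ?_⟩ hval rfl
    · rw [← hn]
      -- No value grows, and the value of `x₀` lies beyond the gap, so it shrinks strictly.
      exact List.sum_lt_sum _ _ (fun x _ => (hsz x).1) ⟨x₀, hx₀b, (hsz x₀).2 (by omega)⟩
    · intro x hx
      simp [h.1 x hx, shiftWord]
    · rintro (⟨N, t⟩ | ⟨P, t, t'⟩) ha
      · have h₀ := h.2 _ ha
        simp only [CanSat, hterm] at h₀ ⊢
        set w := wval e t with hw
        have h₁ : (shiftWord l f w).1 = w.1 := by rw [shiftWord]; split_ifs <;> rfl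
        refine ⟨?_, ?_⟩
        · rw [h₁]; exact (shiftWord_spec (l := l) hf h₀.1).1
        · rw [h₁]; exact (shiftWord_spec (l := l) hf h₀.1).2 _ h₀.2
      · have h₀ := h.2 _ ha
        simp only [CanSat, hterm] at h₀ ⊢
        exact CanRel.shift hf h₀ (htl t) (htl t')

/-- This makes the search for a match finite. Variables that occur in an atom have generated words
rooted in the active domain as values, and these can be shortened. Bound variables without
occurrence may take the default value `(0, [])`. -/
theorem CanMatch.exists_bounded {T : TBox} {A : ABox} {d : CQ} {v : ℕ → ℕ} {e : ℕ → Word}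
    (h : CanMatch T A d v e) :
    ∃ e' : ℕ → Word, CanMatch T A d v e' ∧ ∀ x ∈ d.bound, e' x = (0, []) ∨
      ((e' x).1 ∈ adom A ∧ (∀ R ∈ (e' x).2, R ∈ T.alphabet) ∧
        (e' x).2.length ≤ T.alphabet.length + d.bound.length + 1) := by
  classical
  let occ : ℕ → Prop := fun x => ∃ a ∈ d.atoms, ∃ t ∈ a.terms, x ∈ t.vars
  have hclean : ∀ {e : ℕ → Word}, CanMatch T A d v e →
      CanMatch T A d v fun x => if x ∈ d.bound ∧ ¬ occ x then (0, []) else e x := by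
    intro e h
    refine ⟨fun x hx => by simp [hx, h.1 x hx], fun a ha => ?_⟩
    have hterm : ∀ t ∈ a.terms,
        wval (fun x => if x ∈ d.bound ∧ ¬ occ x then (0, []) else e x) t = wval e t := by
      rintro (x | c) ht
      · simp only [wval]
        rw [if_neg]
        rintro ⟨-, h⟩
        exact h ⟨a, ha, _, ht, by simp [QTerm.vars]⟩
      · rfl
    have h₀ := h.2 a ha
    cases a with
    | concept N t =>
      simp only [CanSat] at h₀ ⊢
      rwa [hterm t (by simp [Atom.terms])]
    | role P t t' =>
      simp only [CanSat] at h₀ ⊢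
      rwa [hterm t (by simp [Atom.terms]), hterm t' (by simp [Atom.terms])]
  have hocc : ∀ {e : ℕ → Word}, CanMatch T A d v e → ∀ x, occ x →
      wvalid T A (e x).1 (e x).2 ∧ (e x).1 ∈ adom A := by
    rintro e h x ⟨a, ha, t, ht, hx⟩
    obtain rfl : t = .var x := by cases t <;> simp_all [QTerm.vars]
    have h₀ := h.2 a ha
    cases a with
    | concept N t =>
      simp only [Atom.terms, List.mem_singleton] at ht
      subst ht
      exact ⟨h₀.1, h₀.1.mem_adom h₀.2⟩
    | role P t t' =>
      simp only [Atom.terms, List.mem_cons, List.not_mem_nil, or_false] at ht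
      rcases ht with rfl | rfl
      · exact ⟨h₀.valid_left, h₀.valid_left.mem_adom h₀.wtp_left⟩
      · exact ⟨h₀.inverse.valid_left, h₀.inverse.valid_left.mem_adom h₀.inverse.wtp_left⟩
  obtain ⟨e₁, h₁, hv₁, hl₁⟩ := (hclean h).exists_short (fun x => by
    by_cases hx : x ∈ d.bound ∧ ¬ occ x
    · simp [hx, wvalid]
    · simp only [hx, if_false]
      by_cases ho : occ x
      · exact (hocc h x ho).1
      · have : x ∉ d.bound := fun hb => hx ⟨hb, ho⟩
        rw [h.1 x this]; trivial)
  -- The default values are restored because `CanMatch.exists_short` does not say where it puts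
  -- variables without occurrence.
  refine ⟨_, hclean h₁, fun x hx => ?_⟩
  by_cases ho : occ x
  · have hx' : ¬ (x ∈ d.bound ∧ ¬ occ x) := fun h => h.2 ho
    simp only [hx', if_false]
    exact Or.inr ⟨(hocc h₁ x ho).2, (hv₁ x).mem_alphabet, hl₁ x⟩
  · left; simp [hx, ho]

theorem can_satUCQ_iff (T : TBox) (A : ABox) (q : UCQ) (v : ℕ → ℕ) :
    (can T A).satUCQ q v ↔ ∃ d ∈ q, ∃ e : ℕ → Word, CanMatch T A d v e := by
  have hterm : ∀ (e : ℕ → Word) (t : QTerm), (can T A).termVal e t = wval e t := by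
    rintro e (x | c) <;> rfl
  have hsat : ∀ (e : ℕ → Word) (a : Atom QTerm),
      (can T A).satAtom ((can T A).termVal e) a ↔ CanSat T A e a := by
    rintro e (⟨N, t⟩ | ⟨P, t, t'⟩)
    · have := hterm e t
      simp only [Interp.satAtom, CanSat, ← this]; rfl
    · have := hterm e t
      have := hterm e t'
      simp only [Interp.satAtom, CanSat, ← hterm]; rfl
  constructor
  · rintro ⟨d, hd, e, he, h⟩
    exact ⟨d, hd, e, he, fun a ha => (hsat e a).1 (h a ha)⟩
  · rintro ⟨d, hd, e, he, h⟩
    exact ⟨d, hd, e, he, fun a ha => (hsat e a).2 (h a ha)⟩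

end ITKAB

namespace ITKAB

/-! ## Primitive recursive list programs -/

-- With these closure properties available to `fun_prop`, a program composed of the list operations
-- below is primitive recursive by inspection of its definition.
attribute [fun_prop] Primrec Primrec.id Primrec.const Primrec.comp Primrec.pair

section primrec

variable {α β γ σ : Type*} [Primcodable α] [Primcodable β] [Primcodable γ] [Primcodable σ]

@[fun_prop]
theorem primrec_fst {f : α → β × γ} (h : Primrec f) : Primrec fun a => (f a).1 :=
  Primrec.fst.comp h

@[fun_prop]
theorem primrec_snd {f : α → β × γ} (h : Primrec f) : Primrec fun a => (f a).2 :=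
  Primrec.snd.comp h

@[fun_prop]
theorem primrec_natPair {f g : α → ℕ} (h : Primrec f) (h' : Primrec g) :
    Primrec fun a => Nat.pair (f a) (g a) :=
  Primrec₂.natPair.comp h h'

@[fun_prop]
theorem primrec_unpair {f : α → ℕ} (h : Primrec f) : Primrec fun a => Nat.unpair (f a) :=
  Primrec.unpair.comp h

@[fun_prop]
theorem primrec_add {f g : α → ℕ} (h : Primrec f) (h' : Primrec g) :
    Primrec fun a => f a + g a :=
  Primrec.nat_add.comp h h'

@[fun_prop]
theorem primrec_mul {f g : α → ℕ} (h : Primrec f) (h' : Primrec g) :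
    Primrec fun a => f a * g a :=
  Primrec.nat_mul.comp h h'

@[fun_prop]
theorem primrec_sub {f g : α → ℕ} (h : Primrec f) (h' : Primrec g) :
    Primrec fun a => f a - g a :=
  Primrec.nat_sub.comp h h'

@[fun_prop]
theorem primrec_decide_eq {f g : α → β} {_ : ∀ a, Decidable (f a = g a)} (h : Primrec f)
    (h' : Primrec g) : Primrec fun a => decide (f a = g a) :=
  PrimrecPred.decide (PrimrecRel.comp Primrec.eq h h')

@[fun_prop]
theorem primrec_decide_le {f g : α → ℕ} (h : Primrec f) (h' : Primrec g) :
    Primrec fun a => decide (f a ≤ g a) :=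
  PrimrecPred.decide (PrimrecRel.comp Primrec.nat_le h h')

@[fun_prop]
theorem primrec_decide_lt {f g : α → ℕ} (h : Primrec f) (h' : Primrec g) :
    Primrec fun a => decide (f a < g a) :=
  PrimrecPred.decide (PrimrecRel.comp Primrec.nat_lt h h')

@[fun_prop]
theorem primrec_not {f : α → Bool} (h : Primrec f) : Primrec fun a => !(f a) :=
  Primrec.not.comp h

@[fun_prop]
theorem primrec_and {f g : α → Bool} (h : Primrec f) (h' : Primrec g) :
    Primrec fun a => f a && g a :=
  Primrec.and.comp h h'

@[fun_prop]
theorem primrec_or {f g : α → Bool} (h : Primrec f) (h' : Primrec g) :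
    Primrec fun a => f a || g a :=
  Primrec.or.comp h h'

@[fun_prop]
theorem primrec_cond {c : α → Bool} {f g : α → β} (hc : Primrec c) (h : Primrec f)
    (h' : Primrec g) : Primrec fun a => cond (c a) (f a) (g a) :=
  Primrec.cond hc h h'

@[fun_prop]
theorem primrec_cons {f : α → β} {g : α → List β} (h : Primrec f) (h' : Primrec g) :
    Primrec fun a => f a :: g a :=
  Primrec.list_cons.comp h h'

@[fun_prop]
theorem primrec_append {f g : α → List β} (h : Primrec f) (h' : Primrec g) :
    Primrec fun a => f a ++ g a :=
  Primrec.list_append.comp h h'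

@[fun_prop]
theorem primrec_length {f : α → List β} (h : Primrec f) : Primrec fun a => (f a).length :=
  Primrec.list_length.comp h

@[fun_prop]
theorem primrec_tail {f : α → List β} (h : Primrec f) : Primrec fun a => (f a).tail :=
  Primrec.list_tail.comp h

@[fun_prop]
theorem primrec_drop {f : α → List β} {n : α → ℕ} (h : Primrec f) (h' : Primrec n) :
    Primrec fun a => (f a).drop (n a) :=
  Primrec.list_drop.comp h' h

@[fun_prop]
theorem primrec_headI [Inhabited β] {f : α → List β} (h : Primrec f) :
    Primrec fun a => (f a).headI :=
  Primrec.list_headI.comp h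

@[fun_prop]
theorem primrec_range {f : α → ℕ} (h : Primrec f) : Primrec fun a => List.range (f a) :=
  Primrec.list_range.comp h

@[fun_prop]
theorem primrec_map {f : α → List β} {g : α → β → σ} (hf : Primrec f)
    (hg : Primrec fun p : α × β => g p.1 p.2) : Primrec fun a => (f a).map (g a) :=
  Primrec.list_map hf hg

@[fun_prop]
theorem primrec_flatMap {f : α → List β} {g : α → β → List σ} (hf : Primrec f)
    (hg : Primrec fun p : α × β => g p.1 p.2) : Primrec fun a => (f a).flatMap (g a) :=
  Primrec.list_flatMap hf hg

@[fun_prop]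
theorem primrec_foldr {f : α → List β} {g : α → σ} {h : α → β → σ → σ} (hf : Primrec f)
    (hg : Primrec g) (hh : Primrec fun p : α × β × σ => h p.1 p.2.1 p.2.2) :
    Primrec fun a => (f a).foldr (h a) (g a) :=
  Primrec.list_foldr (h := fun a p => h a p.1 p.2) hf hg hh

@[fun_prop]
theorem primrec_any {f : α → List β} {p : α → β → Bool} (hf : Primrec f)
    (hp : Primrec fun x : α × β => p x.1 x.2) : Primrec fun a => (f a).any (p a) := by
  have : Primrec fun a => (f a).foldr (fun x acc => p a x || acc) false := by
    refine primrec_foldr hf (by fun_prop) ?_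
    exact primrec_or (hp.comp (f := fun x : α × β => p x.1 x.2)
      (g := fun p : α × β × Bool => (p.1, p.2.1)) (by fun_prop)) (by fun_prop)
  refine this.of_eq fun a => ?_
  induction f a with
  | nil => rfl
  | cons x l ih => simp_all

@[fun_prop]
theorem primrec_all {f : α → List β} {p : α → β → Bool} (hf : Primrec f)
    (hp : Primrec fun x : α × β => p x.1 x.2) : Primrec fun a => (f a).all (p a) := by
  have : Primrec fun a => !((f a).any fun x => !(p a x)) := by
    refine primrec_not (primrec_any hf (primrec_not hp))
  refine this.of_eq fun a => ?_
  rw [Bool.eq_iff_iff]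
  simp

@[fun_prop]
theorem primrec_filter {f : α → List β} {p : α → β → Bool} (hf : Primrec f)
    (hp : Primrec fun x : α × β => p x.1 x.2) : Primrec fun a => (f a).filter (p a) := by
  have : Primrec fun a => (f a).flatMap fun x => bif p a x then [x] else [] :=
    primrec_flatMap hf (primrec_cond hp (by fun_prop) (by fun_prop))
  refine this.of_eq fun a => ?_
  induction f a with
  | nil => rfl
  | cons x l ih =>
    simp only [List.flatMap_cons, ih, List.filter_cons]
    cases p a x <;> rfl

@[fun_prop]
theorem primrec_contains {f : α → List ℕ} {g : α → ℕ} (hf : Primrec f) (hg : Primrec g) :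
    Primrec fun a => (f a).contains (g a) := by
  have : Primrec fun a => (f a).any fun x => decide (g a = x) := by fun_prop
  refine this.of_eq fun a => ?_
  rw [Bool.eq_iff_iff]
  simp

end primrec

/-- Equality test. -/
def eqN (a b : ℕ) : Bool := decide (a = b)

@[simp] theorem eqN_def (a b : ℕ) : eqN a b = decide (a = b) := rfl

@[fun_prop]
theorem primrec_eqN {α : Type*} [Primcodable α] {f g : α → ℕ} (h : Primrec f) (h' : Primrec g) :
    Primrec fun a => eqN (f a) (g a) := by
  unfold eqN; fun_prop

/-! ### Numbers as codes of lists and pairs. -/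

/-- The list coded by a number. -/
def decL (n : ℕ) : List ℕ := Denumerable.ofNat (List ℕ) n

/-- The code of a list of numbers. -/
abbrev encL : List ℕ → ℕ := codeList id

theorem decL_succ (n : ℕ) : decL (n + 1) = n.unpair.1 :: decL n.unpair.2 := by
  simp [decL, Denumerable.list_ofNat_succ]

@[simp] theorem decL_zero : decL 0 = [] := by
  simp [decL, Denumerable.list_ofNat_zero]

@[simp] theorem decL_codeList {α : Type} (c : α → ℕ) (l : List α) :
    decL (codeList c l) = l.map c := by
  induction l with
  | nil => simp [codeList]
  | cons a l ih => simp [codeList, decL_succ, ih]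

/-- The coding of lists in the problem statement is that of the `Encodable` instance. So coding and
decoding are primitive recursive. -/
theorem codeList_eq_encode (l : List ℕ) : encL l = Encodable.encode l := by
  induction l with
  | nil => rfl
  | cons a l ih => simp [codeList, ih, Encodable.encode_list_cons]

@[simp] theorem encL_decL (n : ℕ) : encL (decL n) = n := by
  rw [codeList_eq_encode, decL, Denumerable.encode_ofNat]

theorem codeList_eq_encL {α : Type} (c : α → ℕ) (l : List α) : codeList c l = encL (l.map c) := by
  rw [← encL_decL (codeList c l), decL_codeList]

@[fun_prop]
theorem primrec_decL {α : Type*} [Primcodable α] {f : α → ℕ} (h : Primrec f) :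
    Primrec fun a => decL (f a) :=
  (Primrec.ofNat (List ℕ)).comp h

@[fun_prop]
theorem primrec_encL {α : Type*} [Primcodable α] {f : α → List ℕ} (h : Primrec f) :
    Primrec fun a => codeList id (f a) :=
  (Primrec.encode.comp h).of_eq fun _ => (codeList_eq_encode _).symm

/-- First component of a coded pair. -/
def pfst (n : ℕ) : ℕ := n.unpair.1

/-- Second component of a coded pair. -/
def psnd (n : ℕ) : ℕ := n.unpair.2

@[simp] theorem pfst_pair (a b : ℕ) : pfst (Nat.pair a b) = a := by simp [pfst]

@[simp] theorem psnd_pair (a b : ℕ) : psnd (Nat.pair a b) = b := by simp [psnd]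

@[simp] theorem pair_pfst_psnd (n : ℕ) : Nat.pair (pfst n) (psnd n) = n := by simp [pfst, psnd]

@[fun_prop]
theorem primrec_pfst {α : Type*} [Primcodable α] {f : α → ℕ} (h : Primrec f) :
    Primrec fun a => pfst (f a) := by
  unfold pfst; fun_prop

@[fun_prop]
theorem primrec_psnd {α : Type*} [Primcodable α] {f : α → ℕ} (h : Primrec f) :
    Primrec fun a => psnd (f a) := by
  unfold psnd; fun_prop

/-! ### Sublists, words, association lists -/

/-- All sublists of a list. -/
def subs (l : List ℕ) : List (List ℕ) :=
  l.foldr (fun a acc => acc ++ acc.map fun s => a :: s) [[]]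

@[fun_prop]
theorem primrec_subs {α : Type*} [Primcodable α] {f : α → List ℕ} (h : Primrec f) :
    Primrec fun a => subs (f a) := by
  unfold subs; fun_prop

theorem mem_of_mem_subs {l s : List ℕ} (h : s ∈ subs l) : ∀ x ∈ s, x ∈ l := by
  induction l generalizing s with
  | nil => simp [subs] at h; simp [h]
  | cons a l ih =>
    simp only [subs, List.foldr_cons, List.mem_append, List.mem_map] at h
    rcases h with h | ⟨s, h, rfl⟩
    · exact fun x hx => List.mem_cons_of_mem _ (ih h x hx)
    · intro x hx
      rcases List.mem_cons.1 hx with rfl | hx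
      · simp
      · exact List.mem_cons_of_mem _ (ih h x hx)

/-- Every subset of a list is reached this way, which justifies the brute-force searches for closed
sets, repairs and pre-fixpoints. -/
theorem filter_mem_subs (p : ℕ → Bool) (l : List ℕ) : l.filter p ∈ subs l := by
  induction l with
  | nil => simp [subs]
  | cons a l ih =>
    simp only [subs, List.foldr_cons, List.mem_append, List.mem_map]
    by_cases h : p a
    · rw [List.filter_cons_of_pos h]; exact Or.inr ⟨_, ih, rfl⟩
    · rw [List.filter_cons_of_neg h]; exact Or.inl ih

/-- All words of length at most `n` over an alphabet. -/
def words (dom : List ℕ) (n : ℕ) : List (List ℕ) :=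
  (List.range n).foldr (fun _ acc => [] :: acc.flatMap fun l => dom.map fun d => d :: l) [[]]

@[fun_prop]
theorem primrec_words {α : Type*} [Primcodable α] {f : α → List ℕ} {g : α → ℕ} (h : Primrec f)
    (h' : Primrec g) : Primrec fun a => words (f a) (g a) := by
  unfold words; fun_prop

theorem mem_words {dom : List ℕ} {n : ℕ} {l : List ℕ} :
    l ∈ words dom n ↔ l.length ≤ n ∧ ∀ x ∈ l, x ∈ dom := by
  have key : ∀ (r : List ℕ) (l : List ℕ),
      l ∈ r.foldr (fun _ acc => [] :: acc.flatMap fun l => dom.map fun d => d :: l) [[]] ↔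
        l.length ≤ r.length ∧ ∀ x ∈ l, x ∈ dom := by
    intro r
    induction r with
    | nil =>
      intro l
      simp only [List.foldr_nil, List.mem_singleton, List.length_nil, Nat.le_zero_eq,
        List.length_eq_zero_iff]
      exact ⟨fun h => ⟨h, by simp [h]⟩, fun h => h.1⟩
    | cons a r ih =>
      intro l
      cases l with
      | nil => simp
      | cons d l =>
        simp only [List.foldr_cons, List.mem_cons, reduceCtorEq, List.mem_flatMap, ih, List.mem_map,
          List.cons.injEq, existsAndEq, true_and, and_true, false_or, List.length_cons,
          Nat.add_le_add_iff_right, forall_eq_or_imp]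
        tauto
  simpa [words] using key (List.range n) l

/-- Lookup in an association list: the value plus one, or zero. -/
def valO (l : List ℕ) (x : ℕ) : ℕ :=
  l.foldr (fun p acc => bif eqN (pfst p) x then psnd p + 1 else acc) 0

/-- The valuation given by an association list. -/
def val (l : List ℕ) (x : ℕ) : ℕ := valO l x - 1

@[fun_prop]
theorem primrec_valO {α : Type*} [Primcodable α] {f : α → List ℕ} {g : α → ℕ} (h : Primrec f)
    (h' : Primrec g) : Primrec fun a => valO (f a) (g a) := by
  unfold valO; fun_prop

@[fun_prop]
theorem primrec_val {α : Type*} [Primcodable α] {f : α → List ℕ} {g : α → ℕ} (h : Primrec f)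
    (h' : Primrec g) : Primrec fun a => val (f a) (g a) := by
  unfold val; fun_prop

@[simp] theorem valO_nil (x : ℕ) : valO [] x = 0 := rfl

theorem valO_cons (x d : ℕ) (l : List ℕ) (y : ℕ) :
    valO (Nat.pair x d :: l) y = if y = x then d + 1 else valO l y := by
  by_cases h : x = y
  · simp [valO, h]
  · simp [valO, h, Ne.symm h]

theorem val_cons (x d : ℕ) (l : List ℕ) :
    val (Nat.pair x d :: l) = Function.update (val l) x d := by
  funext y
  rw [val, valO_cons, Function.update_apply]
  split_ifs <;> simp [val]

theorem val_eq_of_valO {l : List ℕ} {x d : ℕ} (h : valO l x = d + 1) : val l x = d := by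
  simp [val, h]

theorem valO_ne_zero {l : List ℕ} {x : ℕ} : valO l x ≠ 0 ↔ ∃ p ∈ l, pfst p = x := by
  induction l with
  | nil => simp
  | cons p l ih =>
    by_cases h : pfst p = x
    · simp [valO, h]
    · have : valO (p :: l) x = valO l x := by simp [valO, h]
      simp [this, ih, h]

theorem mem_of_valO {l : List ℕ} {x d : ℕ} (h : valO l x = d + 1) : Nat.pair x d ∈ l := by
  induction l with
  | nil => simp at h
  | cons p l ih =>
    by_cases hp : pfst p = x
    · have : valO (p :: l) x = psnd p + 1 := by simp [valO, hp]
      rw [this] at h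
      have h : psnd p = d := by omega
      rw [← hp, ← h]; simp
    · have : valO (p :: l) x = valO l x := by simp [valO, hp]
      rw [this] at h
      exact List.mem_cons_of_mem _ (ih h)

/-- All extensions of an association list by values from `dom` for the variables `vs`. -/
def assign (vs dom base : List ℕ) : List (List ℕ) :=
  vs.foldr (fun x acc => acc.flatMap fun l => dom.map fun d => Nat.pair x d :: l) [base]

@[fun_prop]
theorem primrec_assign {α : Type*} [Primcodable α] {f g h : α → List ℕ} (hf : Primrec f)
    (hg : Primrec g) (hh : Primrec h) : Primrec fun a => assign (f a) (g a) (h a) := by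
  unfold assign; fun_prop

theorem mem_assign_cons {x : ℕ} {vs dom base l : List ℕ} :
    l ∈ assign (x :: vs) dom base ↔ ∃ l' ∈ assign vs dom base, ∃ d ∈ dom, l = Nat.pair x d :: l' := by
  simp only [assign, List.foldr_cons, List.mem_flatMap, List.mem_map]
  constructor
  · rintro ⟨l', h, d, hd, rfl⟩; exact ⟨l', h, d, hd, rfl⟩
  · rintro ⟨l', h, d, hd, rfl⟩; exact ⟨l', h, d, hd, rfl⟩

theorem valO_of_mem_assign {vs dom base l : List ℕ} (h : l ∈ assign vs dom base) (x : ℕ) :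
    (x ∈ vs → ∃ d ∈ dom, valO l x = d + 1) ∧ (x ∉ vs → valO l x = valO base x) := by
  induction vs generalizing l with
  | nil => simp only [assign, List.foldr_nil, List.mem_singleton] at h; simp [h]
  | cons y vs ih =>
    obtain ⟨l', h', d, hd, rfl⟩ := mem_assign_cons.1 h
    rw [valO_cons]
    by_cases hy : x = y
    · simp [hy, hd]
    · simpa [hy] using ih h'

/-- Lookup takes the first entry, so new entries override those of `base`, and repetitions in `vs`
do no harm. -/
theorem exists_mem_assign (vs dom base : List ℕ) (f : ℕ → ℕ) (hf : ∀ x ∈ vs, f x ∈ dom) :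
    ∃ l ∈ assign vs dom base, ∀ x, valO l x = if x ∈ vs then f x + 1 else valO base x := by
  induction vs with
  | nil => exact ⟨base, by simp [assign], by simp⟩
  | cons y vs ih =>
    obtain ⟨l, hl, hv⟩ := ih fun x hx => hf x (List.mem_cons_of_mem _ hx)
    refine ⟨Nat.pair y (f y) :: l, mem_assign_cons.2 ⟨l, hl, f y, hf y (by simp), rfl⟩, fun x => ?_⟩
    rw [valO_cons, hv]
    by_cases hy : x = y
    · simp [hy]
    · simp [hy]

/-! ### Reachability -/

/-- Reachability along a list of (coded) edges. -/
def reach (E : List ℕ) (a b : ℕ) : Bool :=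
  (subs (a :: E.map psnd)).all fun S => !(S.contains a) ||
    !(E.all fun e => !(S.contains (pfst e)) || S.contains (psnd e)) || S.contains b

@[fun_prop]
theorem primrec_reach {α : Type*} [Primcodable α] {E : α → List ℕ} {a b : α → ℕ} (hE : Primrec E)
    (ha : Primrec a) (hb : Primrec b) : Primrec fun x => reach (E x) (a x) (b x) := by
  unfold reach; fun_prop

/-- The test asks whether every set of vertices that contains `a` and is closed under the edges
contains `b`. Applied to the set of reachable vertices it gives a path, and conversely a closed set
contains everything reachable from it. -/
theorem reach_iff (E : List ℕ) (a b : ℕ) :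
    reach E a b = true ↔ Relation.ReflTransGen (fun x y => Nat.pair x y ∈ E) a b := by
  classical
  simp only [reach, List.all_eq_true, Bool.or_eq_true, Bool.not_eq_true', Bool.eq_false_iff,
    List.contains_iff_mem, ne_eq]
  constructor
  · intro h
    have h := h _ (filter_mem_subs
      (fun x => decide (Relation.ReflTransGen (fun x y => Nat.pair x y ∈ E) a x)) _)
    rcases h with (h | h) | h
    · exact absurd (by simp [Relation.ReflTransGen.refl]) h
    · refine absurd (fun e he => ?_) h
      rw [or_iff_not_imp_left, not_not]
      intro h'
      simp only [List.mem_filter, List.mem_cons, decide_eq_true_eq, List.mem_map] at h' ⊢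
      exact ⟨Or.inr ⟨e, he, rfl⟩, h'.2.tail (by simpa using he)⟩
    · simpa using (List.mem_filter.1 h).2
  · intro h S hS
    by_contra hc
    push Not at hc
    obtain ⟨⟨ha, hcl⟩, hb⟩ := hc
    refine hb ?_
    clear hb hS
    induction h with
    | refl => exact ha
    | tail _ h ih =>
      have := hcl _ h
      simp only [pfst_pair, psnd_pair] at this
      tauto

/-- Edges on codes join only codes, so a path starting at a code never leaves the image and lifts to
the coded objects. -/
theorem reflTransGen_image {α : Type*} {f : α → ℕ} (hf : Function.Injective f)
    {r : α → α → Prop} {s : ℕ → ℕ → Prop}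
    (h : ∀ x y, s x y ↔ ∃ a b, x = f a ∧ y = f b ∧ r a b) (a b : α) :
    Relation.ReflTransGen s (f a) (f b) ↔ Relation.ReflTransGen r a b := by
  constructor
  · intro h'
    suffices ∀ y, Relation.ReflTransGen s (f a) y → ∃ b, y = f b ∧ Relation.ReflTransGen r a b by
      obtain ⟨b', hb, h''⟩ := this _ h'
      rwa [hf hb]
    intro y hy
    induction hy with
    | refl => exact ⟨a, rfl, .refl⟩
    | tail _ h₁ ih =>
      obtain ⟨c, rfl, hc⟩ := ih
      obtain ⟨a', b', h₂, rfl, h₃⟩ := (h _ _).1 h₁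
      rw [← hf h₂] at h₃
      exact ⟨b', rfl, hc.tail h₃⟩
  · intro h'
    induction h' with
    | refl => exact .refl
    | tail _ h₁ ih => exact ih.tail ((h _ _).2 ⟨_, _, rfl, rfl, h₁⟩)

end ITKAB

namespace ITKAB

/-! ## Reasoning in DL-Lite on codes -/

section codes

variable {α : Type*} [Primcodable α]

/-- Inverse of a role, on codes. -/
def invC (r : ℕ) : ℕ := bif eqN (pfst r) 0 then Nat.pair 1 (psnd r) else Nat.pair 0 (psnd r)

@[fun_prop]
theorem primrec_invC {f : α → ℕ} (h : Primrec f) : Primrec fun a => invC (f a) := by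
  unfold invC; fun_prop

@[simp] theorem invC_code (R : DLRole) : invC R.code = R.inverse.code := by
  cases R <;> simp [invC, DLRole.code, DLRole.inverse]

/-- The positive concept inclusions of a coded TBox. -/
def tPosC (T : ℕ) : List ℕ := decL (pfst T)

/-- The negative concept inclusions of a coded TBox. -/
def tNegC (T : ℕ) : List ℕ := decL (pfst (psnd T))

/-- The positive role inclusions of a coded TBox. -/
def tPosR (T : ℕ) : List ℕ := decL (pfst (psnd (psnd T)))

/-- The negative role inclusions of a coded TBox. -/
def tNegR (T : ℕ) : List ℕ := decL (pfst (psnd (psnd (psnd T))))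

/-- The functionality assertions of a coded TBox. -/
def tFunc (T : ℕ) : List ℕ := decL (psnd (psnd (psnd (psnd T))))

/-- The edges of the role hierarchy. -/
def roleEdges (T : ℕ) : List ℕ :=
  tPosR T ++ (tPosR T).map fun p => Nat.pair (invC (pfst p)) (invC (psnd p))

/-- The edges of the concept hierarchy. -/
def concEdges (T : ℕ) : List ℕ :=
  tPosC T ++ (roleEdges T).map fun p => Nat.pair (Nat.pair 1 (pfst p)) (Nat.pair 1 (psnd p))

@[fun_prop]
theorem primrec_roleEdges {f : α → ℕ} (h : Primrec f) : Primrec fun a => roleEdges (f a) := by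
  unfold roleEdges tPosR; fun_prop

@[fun_prop]
theorem primrec_concEdges {f : α → ℕ} (h : Primrec f) : Primrec fun a => concEdges (f a) := by
  unfold concEdges tPosC; fun_prop

theorem tPosR_code (T : TBox) : tPosR T.code = T.posR.map (codePair DLRole.code DLRole.code) := by
  simp [tPosR, TBox.code]

theorem tPosC_code (T : TBox) :
    tPosC T.code = T.posC.map (codePair DLConcept.code DLConcept.code) := by
  simp [tPosC, TBox.code]

theorem mem_roleEdges (T : TBox) (x y : ℕ) : Nat.pair x y ∈ roleEdges T.code ↔
    ∃ R S : DLRole, x = R.code ∧ y = S.code ∧ T.roleStep R S := by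
  simp only [roleEdges, tPosR_code, List.mem_append, List.mem_map, codePair, Prod.exists,
    Nat.pair_eq_pair, TBox.roleStep, List.map_map, Function.comp_apply, pfst_pair, psnd_pair,
    invC_code]
  constructor
  · rintro (⟨R, S, h, rfl, rfl⟩ | ⟨R, S, h, rfl, rfl⟩)
    · exact ⟨R, S, rfl, rfl, Or.inl h⟩
    · exact ⟨_, _, rfl, rfl, Or.inr (by simpa using h)⟩
  · rintro ⟨R, S, rfl, rfl, h | h⟩
    · exact Or.inl ⟨R, S, h, rfl, rfl⟩
    · exact Or.inr ⟨_, _, h, by simp⟩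

theorem mem_concEdges (T : TBox) (x y : ℕ) : Nat.pair x y ∈ concEdges T.code ↔
    ∃ B C : DLConcept, x = B.code ∧ y = C.code ∧ T.concStep B C := by
  simp only [concEdges, tPosC_code, List.mem_append, List.mem_map, codePair, Prod.exists,
    Nat.pair_eq_pair, TBox.concStep]
  constructor
  · rintro (⟨B, C, h, rfl, rfl⟩ | ⟨p, h, rfl, rfl⟩)
    · exact ⟨B, C, rfl, rfl, Or.inl h⟩
    · obtain ⟨R, S, h₁, h₂, h⟩ := (mem_roleEdges T (pfst p) (psnd p)).1 (by simpa using h)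
      exact ⟨.ex R, .ex S, by rw [h₁]; rfl, by rw [h₂]; rfl, Or.inr ⟨R, S, rfl, rfl, h⟩⟩
  · rintro ⟨B, C, rfl, rfl, h | ⟨R, S, rfl, rfl, h⟩⟩
    · exact Or.inl ⟨B, C, h, rfl, rfl⟩
    · exact Or.inr ⟨_, (mem_roleEdges T _ _).2 ⟨R, S, rfl, rfl, h⟩, by simp [DLConcept.code]⟩

theorem reach_roleEdges (T : TBox) (R S : DLRole) :
    reach (roleEdges T.code) R.code S.code = true ↔ T.roleSub R S := by
  rw [reach_iff, reflTransGen_image DLRole.code_inj (mem_roleEdges T)]; rfl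

theorem reach_concEdges (T : TBox) (B C : DLConcept) :
    reach (concEdges T.code) B.code C.code = true ↔ T.concSub B C := by
  rw [reach_iff, reflTransGen_image DLConcept.code_inj (mem_concEdges T)]; rfl

/-- The alphabet of generated words, on codes. -/
def alphabetC (T : ℕ) : List ℕ :=
  ((tPosC T).flatMap fun p => bif eqN (pfst (psnd p)) 0 then [] else [psnd (psnd p)]) ++
  (tPosR T).flatMap fun p => [psnd p, invC (psnd p)]

@[fun_prop]
theorem primrec_alphabetC {f : α → ℕ} (h : Primrec f) : Primrec fun a => alphabetC (f a) := by
  unfold alphabetC tPosR tPosC; fun_prop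

theorem alphabetC_code (T : TBox) : alphabetC T.code = T.alphabet.map DLRole.code := by
  rw [alphabetC, TBox.alphabet, List.map_append, tPosR_code, tPosC_code, List.flatMap_map,
    List.flatMap_map, List.map_flatMap, List.map_flatMap]
  congr 2 <;> funext ⟨B, C⟩
  · cases C <;> simp [codePair, DLConcept.code]
  · simp [codePair]

/-! ### ABoxes -/

/-- The fact with a given code. -/
def decFact (n : ℕ) : Option Fact :=
  match pfst n with
  | 0 => some (.concept (pfst (psnd n)) (psnd (psnd n)))
  | 1 => some (.role (pfst (psnd n)) (pfst (psnd (psnd n))) (psnd (psnd (psnd n))))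
  | _ => none

/-- Codes of facts. -/
abbrev fcode : Fact → ℕ := Atom.code id

/-- Numbers with a tag of 2 or more code no fact. Lists of codes may contain such junk, and `decA`
ignores it. -/
theorem decFact_eq_some {n : ℕ} {F : Fact} : decFact n = some F ↔ fcode F = n := by
  constructor
  · intro h
    unfold decFact at h
    split at h
    · next h0 => cases h; simp [Atom.code, ← h0]
    · next h0 => cases h; simp [Atom.code, ← h0]
    · simp at h
  · rintro rfl
    cases F <;> simp [decFact, Atom.code]

/-- The ABox with a given list of codes of facts. -/
def decA (A : List ℕ) : ABox := (A.filterMap decFact).toFinset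

@[simp] theorem mem_decA {A : List ℕ} {F : Fact} : F ∈ decA A ↔ fcode F ∈ A := by
  simp [decA, decFact_eq_some]

/-- The constants of an ABox. -/
def adomL (A : List ℕ) : List ℕ :=
  A.flatMap fun n => bif eqN (pfst n) 0 then [psnd (psnd n)] else
    bif eqN (pfst n) 1 then [pfst (psnd (psnd n)), psnd (psnd (psnd n))] else []

@[fun_prop]
theorem primrec_adomL {f : α → List ℕ} (h : Primrec f) : Primrec fun a => adomL (f a) := by
  unfold adomL; fun_prop

theorem mem_adomL {A : List ℕ} {c : ℕ} : c ∈ adomL A ↔ c ∈ adom (decA A) := by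
  simp only [eqN_def, adomL, List.mem_flatMap, adom, Set.mem_ofPred_eq, mem_decA]
  constructor
  · rintro ⟨n, hn, hc⟩
    by_cases h0 : pfst n = 0
    · simp only [h0, decide_true, cond_true, List.mem_singleton] at hc
      refine ⟨.concept (pfst (psnd n)) c, ?_, by simp [Atom.terms]⟩
      rw [show fcode _ = n by simp [Atom.code, ← h0, hc]]; exact hn
    · by_cases h1 : pfst n = 1
      · simp only [h1, one_ne_zero, decide_false, cond_false, decide_true, cond_true] at hc
        refine ⟨.role (pfst (psnd n)) (pfst (psnd (psnd n))) (psnd (psnd (psnd n))), ?_, ?_⟩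
        · rw [show fcode _ = n by simp [Atom.code, ← h1]]; exact hn
        · simpa [Atom.terms] using hc
      · simp [h0, h1] at hc
  · rintro ⟨F, hF, hc⟩
    refine ⟨_, hF, ?_⟩
    cases F <;> simpa [Atom.code, Atom.terms] using hc

/-- Role facts, on codes. -/
def factC (A : List ℕ) (r c d : ℕ) : Bool :=
  bif eqN (pfst r) 0 then A.contains (Nat.pair 1 (Nat.pair (psnd r) (Nat.pair c d)))
  else A.contains (Nat.pair 1 (Nat.pair (psnd r) (Nat.pair d c)))

@[fun_prop]
theorem primrec_factC {A : α → List ℕ} {r c d : α → ℕ} (hA : Primrec A) (hr : Primrec r)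
    (hc : Primrec c) (hd : Primrec d) : Primrec fun a => factC (A a) (r a) (c a) (d a) := by
  unfold factC; fun_prop

theorem factC_iff (A : List ℕ) (R : DLRole) (c d : ℕ) :
    factC A R.code c d = true ↔ factRole (decA A) R c d := by
  cases R <;> simp [factC, DLRole.code, factRole, Atom.code]

/-- The functionality of the role facts, on codes. -/
def factFuncC (T : ℕ) (A : List ℕ) : Bool :=
  (tFunc T).all fun r => (adomL A).all fun c => (adomL A).all fun d => (adomL A).all fun d' =>
    !(factC A r c d) || !(factC A r c d') || eqN d d'

@[fun_prop]
theorem primrec_factFuncC {T : α → ℕ} {A : α → List ℕ} (hT : Primrec T) (hA : Primrec A) :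
    Primrec fun a => factFuncC (T a) (A a) := by
  unfold factFuncC tFunc; fun_prop

/-- Role facts relate only constants of the active domain, so bounded quantifiers suffice. -/
theorem factFuncC_iff (T : TBox) (A : List ℕ) :
    factFuncC T.code A = true ↔ FactFunc T (decA A) := by
  have : tFunc T.code = T.func.map DLRole.code := by simp [tFunc, TBox.code]
  simp only [eqN_def, factFuncC, this, List.all_eq_true, List.mem_map, forall_exists_index, and_imp,
    forall_apply_eq_imp_iff₂, Bool.or_eq_true, Bool.not_eq_true', Bool.eq_false_iff, ne_eq,
    factC_iff, mem_adomL, decide_eq_true_eq, FactFunc]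
  refine forall₂_congr fun R hR => ⟨fun h c d d' h₁ h₂ => ?_, fun h c _ d _ d' _ => ?_⟩
  · have := h c h₁.mem_adom.1 d h₁.mem_adom.2 d' h₂.mem_adom.2
    tauto
  · have := h c d d'
    tauto

/-- The singleton list, if a condition holds. -/
def sing (b : Bool) (y : ℕ) : List ℕ := bif b then [y] else []

@[fun_prop]
theorem primrec_sing {f : α → Bool} {g : α → ℕ} (h : Primrec f) (h' : Primrec g) :
    Primrec fun a => sing (f a) (g a) := by
  unfold sing; fun_prop

theorem mem_sing {b : Bool} {x y : ℕ} : x ∈ sing b y ↔ b = true ∧ x = y := by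
  cases b <;> simp [sing]

/-- The basic concepts asserted of a constant, on codes. -/
def baseL (A : List ℕ) (c : ℕ) : List ℕ :=
  A.flatMap fun n =>
    sing (eqN (pfst n) 0 && eqN (psnd (psnd n)) c) (Nat.pair 0 (pfst (psnd n))) ++
    sing (eqN (pfst n) 1 && eqN (pfst (psnd (psnd n))) c)
      (Nat.pair 1 (Nat.pair 0 (pfst (psnd n)))) ++
    sing (eqN (pfst n) 1 && eqN (psnd (psnd (psnd n))) c)
      (Nat.pair 1 (Nat.pair 1 (pfst (psnd n))))

@[fun_prop]
theorem primrec_baseL {f : α → List ℕ} {g : α → ℕ} (h : Primrec f) (h' : Primrec g) :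
    Primrec fun a => baseL (f a) (g a) := by
  unfold baseL; fun_prop

theorem mem_baseL {A : List ℕ} {c b : ℕ} :
    b ∈ baseL A c ↔ ∃ B : DLConcept, b = B.code ∧ baseC (decA A) c B := by
  simp only [eqN_def, baseL, List.mem_flatMap, List.mem_append, mem_sing, Bool.and_eq_true,
    decide_eq_true_eq]
  constructor
  · have hr : ∀ n ∈ A, pfst n = 1 →
        Atom.role (pfst (psnd n)) (pfst (psnd (psnd n))) (psnd (psnd (psnd n))) ∈ decA A := by
      intro n hn h1
      rw [mem_decA, show fcode _ = n by simp [Atom.code, ← h1]]; exact hn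
    rintro ⟨n, hn, (⟨⟨h0, rfl⟩, rfl⟩ | ⟨⟨h1, rfl⟩, rfl⟩) | ⟨⟨h1, rfl⟩, rfl⟩⟩
    · refine ⟨.name (pfst (psnd n)), rfl, mem_decA.2 ?_⟩
      rw [show fcode _ = n by simp [Atom.code, ← h0]]; exact hn
    · exact ⟨.ex (.name _), rfl, _, hr n hn h1⟩
    · exact ⟨.ex (.inv _), rfl, _, hr n hn h1⟩
  · rintro ⟨B | (P | P), rfl, h⟩
    · exact ⟨_, mem_decA.1 h, by simp [Atom.code, DLConcept.code]⟩
    · obtain ⟨d, h⟩ := h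
      exact ⟨_, mem_decA.1 h, by simp [Atom.code, DLConcept.code, DLRole.code]⟩
    · obtain ⟨d, h⟩ := h
      exact ⟨_, mem_decA.1 h, by simp [Atom.code, DLConcept.code, DLRole.code]⟩

/-- The roles asserted of a pair of constants, on codes. -/
def factL (A : List ℕ) (c d : ℕ) : List ℕ :=
  A.flatMap fun n =>
    sing (eqN (pfst n) 1 && eqN (pfst (psnd (psnd n))) c &&
      eqN (psnd (psnd (psnd n))) d) (Nat.pair 0 (pfst (psnd n))) ++
    sing (eqN (pfst n) 1 && eqN (pfst (psnd (psnd n))) d &&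
      eqN (psnd (psnd (psnd n))) c) (Nat.pair 1 (pfst (psnd n)))

@[fun_prop]
theorem primrec_factL {f : α → List ℕ} {g h : α → ℕ} (hf : Primrec f) (hg : Primrec g)
    (hh : Primrec h) : Primrec fun a => factL (f a) (g a) (h a) := by
  unfold factL; fun_prop

theorem mem_factL {A : List ℕ} {c d r : ℕ} :
    r ∈ factL A c d ↔ ∃ R : DLRole, r = R.code ∧ factRole (decA A) R c d := by
  simp only [eqN_def, factL, List.mem_flatMap, List.mem_append, mem_sing, Bool.and_eq_true,
    decide_eq_true_eq]
  constructor
  · have hr : ∀ n ∈ A, pfst n = 1 →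
        Atom.role (pfst (psnd n)) (pfst (psnd (psnd n))) (psnd (psnd (psnd n))) ∈ decA A := by
      intro n hn h1
      rw [mem_decA, show fcode _ = n by simp [Atom.code, ← h1]]; exact hn
    rintro ⟨n, hn, ⟨⟨⟨h1, rfl⟩, rfl⟩, rfl⟩ | ⟨⟨⟨h1, rfl⟩, rfl⟩, rfl⟩⟩
    · exact ⟨.name _, rfl, hr n hn h1⟩
    · exact ⟨.inv _, rfl, hr n hn h1⟩
  · rintro ⟨P | P, rfl, h⟩
    · exact ⟨_, mem_decA.1 h, by simp [Atom.code, DLRole.code]⟩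
    · exact ⟨_, mem_decA.1 h, by simp [Atom.code, DLRole.code]⟩

/-! ### The canonical model on codes -/

/-- Basic concepts of an element. -/
def wtpC (T : ℕ) (A : List ℕ) (c : ℕ) (ws : List ℕ) (b : ℕ) : Bool :=
  bif eqN (ws.length) 0 then (baseL A c).any fun b₀ => reach (concEdges T) b₀ b
  else reach (concEdges T) (Nat.pair 1 (invC ws.headI)) b

@[fun_prop]
theorem primrec_wtpC {T c b : α → ℕ} {A ws : α → List ℕ} (hT : Primrec T) (hA : Primrec A)
    (hc : Primrec c) (hws : Primrec ws) (hb : Primrec b) :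
    Primrec fun a => wtpC (T a) (A a) (c a) (ws a) (b a) := by
  unfold wtpC; fun_prop

theorem wtpC_iff (T : TBox) (A : List ℕ) (c : ℕ) (ws : List DLRole) (B : DLConcept) :
    wtpC T.code A c (ws.map DLRole.code) B.code = true ↔ wtp T (decA A) c ws B := by
  cases ws with
  | nil =>
    simp only [eqN_def, wtpC, List.map_nil, List.length_nil, decide_true, cond_true, List.any_eq_true,
      mem_baseL, wtp]
    constructor
    · rintro ⟨_, ⟨B₀, rfl, h⟩, h'⟩
      exact ⟨B₀, h, (reach_concEdges T _ _).1 h'⟩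
    · rintro ⟨B₀, h, h'⟩
      exact ⟨_, ⟨B₀, rfl, h⟩, (reach_concEdges T _ _).2 h'⟩
  | cons R ws =>
    simpa [wtpC, wtp, DLConcept.code] using reach_concEdges T (.ex R.inverse) B

/-- The element has a successor already. -/
def whasC (A : List ℕ) (c : ℕ) (ws : List ℕ) (r : ℕ) : Bool :=
  bif eqN (ws.length) 0 then (baseL A c).contains (Nat.pair 1 r)
  else eqN r (invC ws.headI)

@[fun_prop]
theorem primrec_whasC {c r : α → ℕ} {A ws : α → List ℕ} (hA : Primrec A) (hc : Primrec c)
    (hws : Primrec ws) (hr : Primrec r) :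
    Primrec fun a => whasC (A a) (c a) (ws a) (r a) := by
  unfold whasC; fun_prop

theorem whasC_iff (A : List ℕ) (c : ℕ) (ws : List DLRole) (R : DLRole) :
    whasC A c (ws.map DLRole.code) R.code = true ↔ whas (decA A) c ws R := by
  cases ws with
  | nil =>
    simp only [eqN_def, whasC, List.map_nil, List.length_nil, decide_true, cond_true,
      List.contains_iff_mem, mem_baseL, whas]
    constructor
    · rintro ⟨B, h, h'⟩
      obtain rfl : DLConcept.ex R = B := DLConcept.code_inj h
      exact h'
    · exact fun h => ⟨.ex R, rfl, h⟩
  | cons S ws =>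
    simp [whasC, whas, DLRole.code_inj.eq_iff]

/-- The generated words. -/
def wvalidC (T : ℕ) (A : List ℕ) (c : ℕ) (ws : List ℕ) : Bool :=
  -- The recursion of `wvalid` along the word becomes one condition per suffix, so no separate
  -- recursion is needed.
  (List.range ws.length).all fun i =>
    wtpC T A c (ws.drop (i + 1)) (Nat.pair 1 (ws.drop i).headI) &&
      !(whasC A c (ws.drop (i + 1)) (ws.drop i).headI)

@[fun_prop]
theorem primrec_wvalidC {T c : α → ℕ} {A ws : α → List ℕ} (hT : Primrec T) (hA : Primrec A)
    (hc : Primrec c) (hws : Primrec ws) :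
    Primrec fun a => wvalidC (T a) (A a) (c a) (ws a) := by
  unfold wvalidC; fun_prop

theorem wvalidC_iff (T : TBox) (A : List ℕ) (c : ℕ) (ws : List DLRole) :
    wvalidC T.code A c (ws.map DLRole.code) = true ↔ wvalid T (decA A) c ws := by
  induction ws with
  | nil => simp [wvalidC, wvalid]
  | cons R ws ih =>
    rw [wvalid, ← ih]
    have h₁ := wtpC_iff T A c ws (.ex R)
    have h₂ := whasC_iff A c ws R
    simp only [DLConcept.code] at h₁
    rw [← h₁, ← h₂]
    simp only [wvalidC, List.map_cons, List.length_cons, List.range_succ_eq_map, List.all_cons,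
      List.drop_succ_cons, List.drop_zero, List.headI_cons, List.all_map, Bool.and_eq_true,
      Bool.not_eq_true', Function.comp_def, Bool.eq_false_iff, ne_eq, Nat.succ_eq_add_one]
    tauto

/-- Codes of words. -/
def wcode (w : Word) : ℕ := Nat.pair w.1 (codeList DLRole.code w.2)

/-- The roles of the canonical model. -/
def canRelC (T : ℕ) (A : List ℕ) (r w w' : ℕ) : Bool :=
  (eqN (psnd w) 0 && eqN (psnd w') 0 &&
    (factL A (pfst w) (pfst w')).any fun s => reach (roleEdges T) s r) ||
  (eqN (pfst w) (pfst w') && !(eqN (psnd w') 0) &&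
    eqN (encL (decL (psnd w')).tail) (psnd w) &&
    wvalidC T A (pfst w) (decL (psnd w')) && reach (roleEdges T) (decL (psnd w')).headI r) ||
  (eqN (pfst w) (pfst w') && !(eqN (psnd w) 0) &&
    eqN (encL (decL (psnd w)).tail) (psnd w') &&
    wvalidC T A (pfst w) (decL (psnd w)) && reach (roleEdges T) (invC (decL (psnd w)).headI) r)

@[fun_prop]
theorem primrec_canRelC {T r w w' : α → ℕ} {A : α → List ℕ} (hT : Primrec T) (hA : Primrec A)
    (hr : Primrec r) (hw : Primrec w) (hw' : Primrec w') :
    Primrec fun a => canRelC (T a) (A a) (r a) (w a) (w' a) := by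
  unfold canRelC; fun_prop

theorem codeList_eq_zero {β : Type} {c : β → ℕ} {l : List β} : codeList c l = 0 ↔ l = [] := by
  cases l <;> simp [codeList]

theorem canRelC_iff (T : TBox) (A : List ℕ) (R : DLRole) (w w' : Word) :
    canRelC T.code A R.code (wcode w) (wcode w') = true ↔ CanRel T (decA A) R w w' := by
  obtain ⟨c, ws⟩ := w
  obtain ⟨c', ws'⟩ := w'
  have hinj := codeList_inj DLRole.code_inj
  simp only [eqN_def, canRelC, wcode, pfst_pair, psnd_pair, codeList_eq_zero, decL_codeList,
    Bool.or_eq_true, Bool.and_eq_true, decide_eq_true_eq, List.any_eq_true, mem_factL,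
    Bool.not_eq_true', decide_eq_false_iff_not, wvalidC_iff]
  constructor
  · rintro ((⟨⟨rfl, rfl⟩, _, ⟨S, rfl, hS⟩, h⟩ | ⟨⟨⟨⟨rfl, h₁⟩, h₂⟩, h₃⟩, h₄⟩) |
      ⟨⟨⟨⟨rfl, h₁⟩, h₂⟩, h₃⟩, h₄⟩)
    · exact .fact hS ((reach_roleEdges T _ _).1 h)
    · cases ws' with
      | nil => exact absurd rfl h₁
      | cons S ws' =>
        simp only [List.map_cons, List.tail_cons, ← codeList_eq_encL] at h₂
        obtain rfl := hinj h₂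
        exact .child h₃ ((reach_roleEdges T _ _).1 h₄)
    · cases ws with
      | nil => exact absurd rfl h₁
      | cons S ws =>
        simp only [List.map_cons, List.tail_cons, ← codeList_eq_encL] at h₂
        obtain rfl := hinj h₂
        exact .parent h₃ ((reach_roleEdges T _ _).1 (by simpa using h₄))
  · intro h
    cases h with
    | @fact S _ _ _ h h' => exact Or.inl (Or.inl ⟨⟨rfl, rfl⟩, _, ⟨S, rfl, h⟩, (reach_roleEdges T _ _).2 h'⟩)
    | child h h' =>
      refine Or.inl (Or.inr ⟨⟨⟨⟨rfl, by simp⟩, ?_⟩, h⟩, (reach_roleEdges T _ _).2 h'⟩)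
      simp [← codeList_eq_encL]
    | parent h h' =>
      refine Or.inr ⟨⟨⟨⟨rfl, by simp⟩, ?_⟩, h⟩, ?_⟩
      · simp [← codeList_eq_encL]
      · simpa using (reach_roleEdges T _ _).2 h'

/-! ### Matches of conjunctive queries -/

/-- Values of query terms, on codes. -/
def wvalC (bound v e : List ℕ) (t : ℕ) : ℕ :=
  bif eqN (pfst t) 0 then
    bif bound.contains (psnd t) then val e (psnd t) else Nat.pair (val v (psnd t)) 0
  else Nat.pair (psnd t) 0

@[fun_prop]
theorem primrec_wvalC {t : α → ℕ} {bound v e : α → List ℕ} (hb : Primrec bound) (hv : Primrec v)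
    (he : Primrec e) (ht : Primrec t) :
    Primrec fun a => wvalC (bound a) (v a) (e a) (t a) := by
  unfold wvalC; fun_prop

/-- Truth of a query atom in the canonical model, on codes. -/
def canSatC (T : ℕ) (A bound v e : List ℕ) (a : ℕ) : Bool :=
  bif eqN (pfst a) 0 then
    wvalidC T A (pfst (wvalC bound v e (psnd (psnd a))))
      (decL (psnd (wvalC bound v e (psnd (psnd a))))) &&
    wtpC T A (pfst (wvalC bound v e (psnd (psnd a))))
      (decL (psnd (wvalC bound v e (psnd (psnd a))))) (Nat.pair 0 (pfst (psnd a)))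
  else canRelC T A (Nat.pair 0 (pfst (psnd a))) (wvalC bound v e (pfst (psnd (psnd a))))
    (wvalC bound v e (psnd (psnd (psnd a))))

@[fun_prop]
theorem primrec_canSatC {T t : α → ℕ} {A bound v e : α → List ℕ} (hT : Primrec T) (hA : Primrec A)
    (hb : Primrec bound) (hv : Primrec v) (he : Primrec e) (ht : Primrec t) :
    Primrec fun a => canSatC (T a) (A a) (bound a) (v a) (e a) (t a) := by
  unfold canSatC; fun_prop

theorem canSatC_iff (T : TBox) (A bound v e : List ℕ) (e' : ℕ → Word)
    (he : ∀ x, wcode (e' x) = if x ∈ bound then val e x else Nat.pair (val v x) 0)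
    (a : Atom QTerm) :
    canSatC T.code A bound v e (a.code QTerm.code) = true ↔ CanSat T (decA A) e' a := by
  have ht : ∀ t : QTerm, wvalC bound v e t.code = wcode (wval e' t) := by
    rintro (x | c)
    · simp only [eqN_def, wvalC, QTerm.code, pfst_pair, psnd_pair, decide_true, cond_true, wval, he]
      by_cases hx : x ∈ bound
      · simp [hx]
      · simp [hx]
    · simp [wvalC, QTerm.code, wval, wcode, codeList]
  cases a with
  | concept N t =>
    simp only [eqN_def, canSatC, Atom.code, pfst_pair, psnd_pair, decide_true, cond_true, ht, CanSat]
    simp only [wcode, pfst_pair, psnd_pair, decL_codeList, Bool.and_eq_true, wvalidC_iff]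
    rw [show Nat.pair 0 N = (DLConcept.name N).code from rfl, wtpC_iff]
  | role P t t' =>
    simp only [eqN_def, canSatC, Atom.code, pfst_pair, psnd_pair, one_ne_zero, decide_false, cond_false,
      ht, CanSat]
    rw [show Nat.pair 0 P = (DLRole.name P).code from rfl, canRelC_iff]

/-- The candidate values of the bound variables. -/
def candC (T : ℕ) (A : List ℕ) (n : ℕ) : List ℕ :=
  Nat.pair 0 0 :: (adomL A).flatMap fun c =>
    (words (alphabetC T) ((alphabetC T).length + n + 1)).map fun ws => Nat.pair c (encL ws)

@[fun_prop]
theorem primrec_candC {T n : α → ℕ} {A : α → List ℕ} (hT : Primrec T) (hA : Primrec A)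
    (hn : Primrec n) : Primrec fun a => candC (T a) (A a) (n a) := by
  unfold candC; fun_prop

theorem mem_candC (T : TBox) (A : List ℕ) (n x : ℕ) :
    x ∈ candC T.code A n ↔ ∃ w : Word, x = wcode w ∧ (w = (0, []) ∨ (w.1 ∈ adom (decA A) ∧
      (∀ R ∈ w.2, R ∈ T.alphabet) ∧ w.2.length ≤ T.alphabet.length + n + 1)) := by
  simp only [candC, List.mem_cons, List.mem_flatMap, mem_adomL, List.mem_map, mem_words,
    alphabetC_code, List.length_map]
  constructor
  · rintro (rfl | ⟨c, hc, ws, ⟨hl, hw⟩, rfl⟩)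
    · exact ⟨(0, []), rfl, Or.inl rfl⟩
    · obtain ⟨ws, rfl⟩ : ∃ ws' : List DLRole, ws = ws'.map DLRole.code := by
        have : ∀ x ∈ ws, x ∈ Set.range DLRole.code := fun x hx => by
          obtain ⟨R, _, h⟩ := hw x hx; exact ⟨R, h⟩
        obtain ⟨l, hl⟩ := (Set.mem_range (f := List.map DLRole.code)).1
          (by rw [Set.range_list_map]; exact this)
        exact ⟨l, hl.symm⟩
      refine ⟨(c, ws), by rw [wcode, codeList_eq_encL], Or.inr ⟨hc, fun R hR => ?_, by simpa using hl⟩⟩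
      obtain ⟨S, hS, h⟩ := hw _ (List.mem_map_of_mem hR)
      rwa [← DLRole.code_inj h]
  · rintro ⟨⟨c, ws⟩, rfl, h | ⟨h₁, h₂, h₃⟩⟩
    · simp only [h]; exact Or.inl rfl
    · refine Or.inr ⟨c, h₁, ws.map DLRole.code, ⟨by simpa using h₃, ?_⟩, ?_⟩
      · intro x hx
        obtain ⟨R, hR, rfl⟩ := List.mem_map.1 hx
        exact ⟨R, h₂ R hR, rfl⟩
      · rw [wcode, codeList_eq_encL]

/-- Evaluation of unions of conjunctive queries in the canonical model. -/
def canUCQC (T : ℕ) (A : List ℕ) (q : ℕ) (v : List ℕ) : Bool :=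
  (decL q).any fun d =>
    (assign (decL (pfst d)) (candC T A (decL (pfst d)).length) []).any fun e =>
      (decL (psnd d)).all fun a => canSatC T A (decL (pfst d)) v e a

@[fun_prop]
theorem primrec_canUCQC {T q : α → ℕ} {A v : α → List ℕ} (hT : Primrec T) (hA : Primrec A)
    (hq : Primrec q) (hv : Primrec v) : Primrec fun a => canUCQC (T a) (A a) (q a) (v a) := by
  unfold canUCQC; fun_prop

/-- The search ranges over finitely many candidate words only. It is complete because every match
can be replaced by one with values among them, by `CanMatch.exists_bounded`. -/
theorem canUCQC_iff (T : TBox) (A : List ℕ) (q : UCQ) (v : List ℕ) :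
    canUCQC T.code A (codeList CQ.code q) v = true ↔ (can T (decA A)).satUCQ q (val v) := by
  rw [can_satUCQ_iff]
  simp only [canUCQC, decL_codeList, List.any_eq_true, List.mem_map, exists_exists_and_eq_and,
    CQ.code, pfst_pair, psnd_pair, List.all_eq_true, forall_exists_index, and_imp,
    forall_apply_eq_imp_iff₂, List.map_id]
  refine exists_congr fun d => and_congr_right fun _ => ?_
  constructor
  · rintro ⟨e, he, h⟩
    have hval : ∀ x, ∃ w : Word, wcode w = if x ∈ d.bound then val e x else Nat.pair (val v x) 0 := by
      intro x
      by_cases hx : x ∈ d.bound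
      · obtain ⟨k, hk, hk'⟩ := (valO_of_mem_assign he x).1 hx
        obtain ⟨w, rfl, _⟩ := (mem_candC _ _ _ _).1 hk
        exact ⟨w, by simp [hx, val_eq_of_valO hk']⟩
      · exact ⟨(val v x, []), by simp [hx, wcode, codeList]⟩
    choose e' he' using hval
    refine ⟨e', fun x hx => ?_, fun a ha => (canSatC_iff T A _ v e e' he' a).1 (h a ha)⟩
    have := he' x
    simp only [hx, if_false, wcode, Nat.pair_eq_pair, codeList_eq_zero] at this
    exact Prod.ext this.1 this.2
  · rintro ⟨e₀, h₀⟩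
    obtain ⟨e', h, hb⟩ := h₀.exists_bounded
    obtain ⟨e, he, hv⟩ := exists_mem_assign d.bound (candC T.code A d.bound.length) []
      (fun x => wcode (e' x)) (fun x hx => (mem_candC _ _ _ _).2 ⟨_, rfl, hb x hx⟩)
    refine ⟨e, he, fun a ha => (canSatC_iff T A _ v e e' (fun x => ?_) a).2 (h.2 a ha)⟩
    by_cases hx : x ∈ d.bound
    · have := hv x
      simp only [hx, if_true] at this ⊢
      rw [val_eq_of_valO this]
    · simp [hx, h.1 x hx, wcode, codeList]

/-! ### Consistency and consistent query answering -/

/-- Code of an atom saying that a term belongs to a basic concept. -/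
def concAtomC (z t b : ℕ) : ℕ :=
  bif eqN (pfst b) 0 then Nat.pair 0 (Nat.pair (psnd b) t)
  else bif eqN (pfst (psnd b)) 0 then
    Nat.pair 1 (Nat.pair (psnd (psnd b)) (Nat.pair t (Nat.pair 0 z)))
  else Nat.pair 1 (Nat.pair (psnd (psnd b)) (Nat.pair (Nat.pair 0 z) t))

@[fun_prop]
theorem primrec_concAtomC {z t b : α → ℕ} (hz : Primrec z) (ht : Primrec t) (hb : Primrec b) :
    Primrec fun a => concAtomC (z a) (t a) (b a) := by
  unfold concAtomC; fun_prop

theorem concAtomC_code (z : ℕ) (t : QTerm) (B : DLConcept) :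
    concAtomC z t.code B.code = (B.toAtom z t).code QTerm.code := by
  rcases B with N | (P | P) <;>
    simp [concAtomC, DLConcept.code, DLRole.code, DLConcept.toAtom, Atom.code, QTerm.code]

/-- Code of a role atom. -/
def roleAtomC (t t' r : ℕ) : ℕ :=
  bif eqN (pfst r) 0 then Nat.pair 1 (Nat.pair (psnd r) (Nat.pair t t'))
  else Nat.pair 1 (Nat.pair (psnd r) (Nat.pair t' t))

@[fun_prop]
theorem primrec_roleAtomC {t t' r : α → ℕ} (ht : Primrec t) (ht' : Primrec t') (hr : Primrec r) :
    Primrec fun a => roleAtomC (t a) (t' a) (r a) := by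
  unfold roleAtomC; fun_prop

theorem roleAtomC_code (t t' : QTerm) (R : DLRole) :
    roleAtomC t.code t'.code R.code = (R.toAtom t t').code QTerm.code := by
  cases R <;> simp [roleAtomC, DLRole.code, DLRole.toAtom, Atom.code]

/-- Code of a Boolean query with two atoms. -/
def cqC (a b : ℕ) : ℕ := Nat.pair (encL [0, 1, 2]) (encL [a, b])

@[fun_prop]
theorem primrec_cqC {f g : α → ℕ} (h : Primrec f) (h' : Primrec g) :
    Primrec fun a => cqC (f a) (g a) := by
  unfold cqC
  exact primrec_natPair (.const _) (by fun_prop)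

/-- Code of a variable. -/
def varC (x : ℕ) : ℕ := Nat.pair 0 x

/-- Codes of the violations of the negative concept inclusions. -/
def violConcC (T : ℕ) : List ℕ :=
  (tNegC T).map fun p => cqC (concAtomC 1 (varC 0) (pfst p)) (concAtomC 2 (varC 0) (psnd p))

@[fun_prop]
theorem primrec_violConcC {T : α → ℕ} (hT : Primrec T) : Primrec fun a => violConcC (T a) := by
  unfold violConcC tNegC; fun_prop

/-- Codes of the violations of the negative role inclusions. -/
def violRoleC (T : ℕ) : List ℕ :=
  (tNegR T).map fun p =>
    cqC (roleAtomC (varC 0) (varC 1) (pfst p)) (roleAtomC (varC 0) (varC 1) (psnd p))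

@[fun_prop]
theorem primrec_violRoleC {T : α → ℕ} (hT : Primrec T) : Primrec fun a => violRoleC (T a) := by
  unfold violRoleC tNegR; fun_prop

/-- Code of the violations of the negative inclusions. -/
def violationsC (T : ℕ) : ℕ := encL (violConcC T ++ violRoleC T)

@[fun_prop]
theorem primrec_violationsC {T : α → ℕ} (hT : Primrec T) :
    Primrec fun a => violationsC (T a) := by
  unfold violationsC; fun_prop

theorem violationsC_code (T : TBox) : violationsC T.code = codeList CQ.code T.violations := by
  have hC : tNegC T.code = T.negC.map (codePair DLConcept.code DLConcept.code) := by
    simp [tNegC, TBox.code]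
  have hR : tNegR T.code = T.negR.map (codePair DLRole.code DLRole.code) := by
    simp [tNegR, TBox.code]
  rw [codeList_eq_encL, violationsC, violConcC, violRoleC, hC, hR, TBox.violations,
    List.map_append, List.map_map, List.map_map, List.map_map, List.map_map]
  refine congrArg encL (congrArg₂ _ ?_ ?_)
  · refine List.map_congr_left fun p _ => ?_
    simp only [Function.comp_apply, codePair, pfst_pair, psnd_pair, CQ.code, cqC,
      Nat.pair_eq_pair, true_and]
    rw [show varC 0 = (QTerm.var 0).code from rfl, concAtomC_code, concAtomC_code]
    rfl
  · refine List.map_congr_left fun p _ => ?_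
    simp only [Function.comp_apply, codePair, pfst_pair, psnd_pair, CQ.code, cqC,
      Nat.pair_eq_pair, true_and]
    rw [show varC 0 = (QTerm.var 0).code from rfl,
      show varC 1 = (QTerm.var 1).code from rfl, roleAtomC_code, roleAtomC_code]
    rfl

/-- Consistency, on codes. -/
def consC (T : ℕ) (A : List ℕ) : Bool := factFuncC T A && !(canUCQC T A (violationsC T) [])

@[fun_prop]
theorem primrec_consC {T : α → ℕ} {A : α → List ℕ} (hT : Primrec T) (hA : Primrec A) :
    Primrec fun a => consC (T a) (A a) := by
  unfold consC; fun_prop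

theorem consC_iff {T : TBox} (hT : T.IsDLLiteA) (A : List ℕ) :
    consC T.code A = true ↔ Consistent T (decA A) := by
  rw [consistent_iff hT (val []), consC, violationsC_code]
  simp [factFuncC_iff, Bool.eq_false_iff, canUCQC_iff]

/-- Repairs, on codes. -/
def repairC (T : ℕ) (A R : List ℕ) : Bool :=
  consC T R && (subs A).all fun R' => !(consC T R') || !(R.all fun x => R'.contains x) ||
    R'.all fun x => R.contains x

@[fun_prop]
theorem primrec_repairC {T : α → ℕ} {A R : α → List ℕ} (hT : Primrec T) (hA : Primrec A)
    (hR : Primrec R) : Primrec fun a => repairC (T a) (A a) (R a) := by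
  unfold repairC; fun_prop

/-- Consistent query answering, on codes. -/
def cqaC (T : ℕ) (A : List ℕ) (q : ℕ) (v : List ℕ) : Bool :=
  -- Numbers that code no fact are removed, because `repairC` compares lists, and inclusion of lists
  -- matches inclusion of ABoxes only without them.
  (subs A).all fun R => !(repairC T (A.filter fun n => decide (pfst n < 2))
    (R.filter fun n => decide (pfst n < 2))) || canUCQC T (R.filter fun n => decide (pfst n < 2)) q v

@[fun_prop]
theorem primrec_cqaC {T q : α → ℕ} {A v : α → List ℕ} (hT : Primrec T) (hA : Primrec A)
    (hq : Primrec q) (hv : Primrec v) : Primrec fun a => cqaC (T a) (A a) (q a) (v a) := by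
  unfold cqaC; fun_prop

theorem decA_subset {R R' : List ℕ} (hR : ∀ n ∈ R, pfst n < 2) :
    decA R ⊆ decA R' ↔ ∀ n ∈ R, n ∈ R' := by
  constructor
  · intro h n hn
    have : ∃ F, decFact n = some F := by
      obtain h | h : pfst n = 0 ∨ pfst n = 1 := by have := hR n hn; omega
      · simp [decFact, h]
      · simp [decFact, h]
    obtain ⟨F, hF⟩ := this
    rw [decFact_eq_some] at hF
    subst hF
    exact mem_decA.1 (h (mem_decA.2 hn))
  · intro h F hF
    exact mem_decA.2 (h _ (mem_decA.1 hF))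

theorem pfst_fcode (F : Fact) : pfst (fcode F) < 2 := by
  cases F <;> simp [Atom.code]

theorem decA_filter (R : List ℕ) : decA (R.filter fun n => decide (pfst n < 2)) = decA R := by
  ext F
  simp only [mem_decA, List.mem_filter, decide_eq_true_eq, pfst_fcode, and_true]

theorem exists_mem_subs {A : List ℕ} {R : ABox} (h : R ⊆ decA A) : ∃ S ∈ subs A, decA S = R := by
  classical
  refine ⟨_, filter_mem_subs (fun n => decide (∃ F ∈ R, fcode F = n)) A, ?_⟩
  ext F
  simp only [mem_decA, List.mem_filter, decide_eq_true_eq]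
  constructor
  · rintro ⟨-, G, hG, h⟩
    rwa [← Atom.code_inj Function.injective_id h]
  · exact fun hF => ⟨mem_decA.1 (h hF), F, hF, rfl⟩

theorem repairC_iff {T : TBox} (hT : T.IsDLLiteA) {A R : List ℕ} (hA : ∀ n ∈ A, pfst n < 2)
    (hR : ∀ n ∈ R, n ∈ A) : repairC T.code A R = true ↔ IsRepair T (decA A) (decA R) := by
  simp only [repairC, Bool.and_eq_true, consC_iff hT, List.all_eq_true, Bool.or_eq_true,
    Bool.not_eq_true', Bool.eq_false_iff, ne_eq, List.contains_iff_mem, IsRepair, Maximal]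
  have hR2 : ∀ n ∈ R, pfst n < 2 := fun n hn => hA n (hR n hn)
  constructor
  · rintro ⟨h₁, h₂⟩
    refine ⟨⟨(decA_subset hR2).2 hR, h₁⟩, ?_⟩
    rintro B ⟨hB, hB'⟩ hle
    obtain ⟨S, hS, rfl⟩ := exists_mem_subs hB
    rcases h₂ S hS with (h | h) | h
    · exact absurd hB' h
    · exact absurd ((decA_subset hR2).1 hle) h
    · exact (decA_subset fun n hn => hA n (mem_of_mem_subs hS n hn)).2 h
  · rintro ⟨h₁, h₂⟩
    refine ⟨h₁.2, fun S hS => ?_⟩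
    have hS2 : ∀ n ∈ S, pfst n < 2 := fun n hn => hA n (mem_of_mem_subs hS n hn)
    by_cases hc : Consistent T (decA S)
    · by_cases hsub : ∀ n ∈ R, n ∈ S
      · right
        exact (decA_subset hS2).1 (h₂ ⟨(decA_subset hS2).2 (mem_of_mem_subs hS), hc⟩
          ((decA_subset hR2).2 hsub))
      · exact Or.inl (Or.inr hsub)
    · exact Or.inl (Or.inl hc)

/-- Each repair is the ABox of some sublist and is consistent, so `cqa_iff_can` reduces
AR-entailment to one query evaluation in each of finitely many canonical models. -/
theorem cqaC_iff {T : TBox} (hT : T.IsDLLiteA) (A : List ℕ) (q : UCQ) (v : List ℕ) :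
    cqaC T.code A (codeList CQ.code q) v = true ↔ cqa T (decA A) q (val v) := by
  rw [cqa_iff_can hT]
  have hrep : ∀ R ∈ subs A, repairC T.code (A.filter fun n => decide (pfst n < 2))
      (R.filter fun n => decide (pfst n < 2)) = true ↔ IsRepair T (decA A) (decA R) := by
    intro R hR
    rw [repairC_iff hT (by simp) ?_, decA_filter, decA_filter]
    intro n hn
    simp only [List.mem_filter] at hn ⊢
    exact ⟨mem_of_mem_subs hR n hn.1, hn.2⟩
  simp only [cqaC, List.all_eq_true, Bool.or_eq_true, Bool.not_eq_true', Bool.eq_false_iff, ne_eq,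
    canUCQC_iff, decA_filter]
  constructor
  · intro h R hR
    obtain ⟨S, hS, rfl⟩ := exists_mem_subs hR.prop.1
    rcases h S hS with h | h
    · exact absurd ((hrep S hS).2 hR) h
    · exact h
  · intro h S hS
    by_cases hR : IsRepair T (decA A) (decA S)
    · exact Or.inr (h _ hR)
    · exact Or.inl fun h' => hR ((hrep S hS).1 h')

end codes

end ITKAB

namespace ITKAB

/-! ## Evaluation of ECQs -/

theorem satUCQ_congr {I : Interp} {q : UCQ} {v v' : ℕ → ℕ} (h : ∀ x ∈ ucqFV q, v x = v' x)
    (hv : I.satUCQ q v) : I.satUCQ q v' := by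
  classical
  obtain ⟨d, hd, e, he, hat⟩ := hv
  refine ⟨d, hd, fun x => if x ∈ d.bound then e x else I.const (v' x), fun x hx => by simp [hx],
    fun a ha => ?_⟩
  have hterm : ∀ t ∈ a.terms,
      I.termVal (fun x => if x ∈ d.bound then e x else I.const (v' x)) t = I.termVal e t := by
    rintro (x | c) ht
    · by_cases hx : x ∈ d.bound
      · simp [Interp.termVal, hx]
      · simp only [Interp.termVal, hx, if_false]
        rw [he x hx, h x ⟨d, hd, hx, a, ha, _, ht, by simp [QTerm.vars]⟩]
    · rfl
  have h₀ := hat a ha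
  cases a with
  | concept N t =>
    simp only [Interp.satAtom] at h₀ ⊢
    rwa [hterm t (by simp [Atom.terms])]
  | role P t t' =>
    simp only [Interp.satAtom] at h₀ ⊢
    rwa [hterm t (by simp [Atom.terms]), hterm t' (by simp [Atom.terms])]

theorem cqa_congr {T : TBox} {A : ABox} {q : UCQ} {v v' : ℕ → ℕ}
    (h : ∀ x ∈ ucqFV q, v x = v' x) : cqa T A q v ↔ cqa T A q v' :=
  ⟨fun hq R hR I hI => satUCQ_congr h (hq R hR I hI),
    fun hq R hR I hI => satUCQ_congr (fun x hx => (h x hx).symm) (hq R hR I hI)⟩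

theorem ECQ.holds_congr {T : TBox} {A : ABox} (Q : ECQ) {v v' : ℕ → ℕ}
    (h : ∀ x ∈ Q.FV, v x = v' x) : Q.holds T A v ↔ Q.holds T A v' := by
  induction Q generalizing v v' with
  | atom q => exact cqa_congr h
  | neg Q ih => exact not_congr (ih h)
  | and Q₁ Q₂ ih₁ ih₂ =>
    exact and_congr (ih₁ fun x hx => h x (Or.inl hx)) (ih₂ fun x hx => h x (Or.inr hx))
  | ex y Q ih =>
    refine exists_congr fun d => and_congr_right fun _ => ih fun x hx => ?_
    by_cases hxy : x = y
    · simp [hxy]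
    · simp [hxy, h x ⟨hx, hxy⟩]

theorem pfst_le (n : ℕ) : pfst n ≤ n := Nat.unpair_left_le n

theorem psnd_le (n : ℕ) : psnd n ≤ n := Nat.unpair_right_le n

/-- Codes of subexpressions are strictly smaller as soon as the tag is positive. Tag 0 is reserved
for leaves, so recursion on codes terminates even on numbers that code nothing. -/
theorem psnd_lt {n : ℕ} (h : pfst n ≠ 0) : psnd n < n := by
  have := Nat.add_le_pair (pfst n) (psnd n)
  rw [pair_pfst_psnd] at this
  omega

/-- Evaluation of ECQs on codes. -/
def holdsC (T : ℕ) (A : List ℕ) (n : ℕ) (v : List ℕ) : Bool :=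
  if _h : pfst n = 0 then cqaC T A (psnd n) v
  else if pfst n = 1 then !(holdsC T A (psnd n) v)
  else if pfst n = 2 then holdsC T A (pfst (psnd n)) v && holdsC T A (psnd (psnd n)) v
  else (adomL A).any fun d => holdsC T A (psnd (psnd n)) (Nat.pair (pfst (psnd n)) d :: v)
termination_by n
decreasing_by
  all_goals have := psnd_lt _h
  all_goals have := pfst_le (psnd n)
  all_goals have := psnd_le (psnd n)
  all_goals omega

theorem holdsC_iff {T : TBox} (hT : T.IsDLLiteA) (A : List ℕ) (Q : ECQ) (v : List ℕ) :
    holdsC T.code A Q.code v = true ↔ Q.holds T (decA A) (val v) := by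
  induction Q generalizing v with
  | atom q => rw [holdsC]; simpa [ECQ.code, ECQ.holds] using cqaC_iff hT A q v
  | neg Q ih => rw [holdsC]; simp [ECQ.code, ECQ.holds, Bool.eq_false_iff, ih]
  | and Q₁ Q₂ ih₁ ih₂ => rw [holdsC]; simp [ECQ.code, ECQ.holds, ih₁, ih₂]
  | ex x Q ih => rw [holdsC]; simp [ECQ.code, ECQ.holds, ih, val_cons, mem_adomL]

/-! ### Evaluation of ECQs as course-of-values recursion. -/

/-- The recursive calls in the evaluation of an ECQ. -/
def holdsKids (b : ℕ × List ℕ × ℕ × List ℕ) : List (ℕ × List ℕ × ℕ × List ℕ) :=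
  bif eqN (pfst b.2.2.1) 0 then []
  else bif eqN (pfst b.2.2.1) 1 then [(b.1, b.2.1, psnd b.2.2.1, b.2.2.2)]
  else bif eqN (pfst b.2.2.1) 2 then [(b.1, b.2.1, pfst (psnd b.2.2.1), b.2.2.2),
    (b.1, b.2.1, psnd (psnd b.2.2.1), b.2.2.2)]
  else (adomL b.2.1).map fun d =>
    (b.1, b.2.1, psnd (psnd b.2.2.1), Nat.pair (pfst (psnd b.2.2.1)) d :: b.2.2.2)

/-- The value of an ECQ from the values of the recursive calls. -/
def holdsComb (b : ℕ × List ℕ × ℕ × List ℕ) (rs : List Bool) : Bool :=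
  bif eqN (pfst b.2.2.1) 0 then cqaC b.1 b.2.1 (psnd b.2.2.1) b.2.2.2
  else bif eqN (pfst b.2.2.1) 1 then !rs.headI
  else bif eqN (pfst b.2.2.1) 2 then rs.headI && rs.tail.headI
  else rs.any fun r => r

theorem holdsC_rec (b : ℕ × List ℕ × ℕ × List ℕ) :
    holdsComb b ((holdsKids b).map fun b => holdsC b.1 b.2.1 b.2.2.1 b.2.2.2) =
      holdsC b.1 b.2.1 b.2.2.1 b.2.2.2 := by
  obtain ⟨T, A, n, v⟩ := b
  conv_rhs => rw [holdsC]
  simp only [holdsComb, holdsKids, eqN_def]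
  by_cases h0 : pfst n = 0
  · simp [h0]
  by_cases h1 : pfst n = 1
  · simp [h1]
  by_cases h2 : pfst n = 2
  · simp [h2]
  simp [h0, h1, h2, List.any_map, Function.comp_def]

theorem primrec_holdsKids : Primrec holdsKids := by
  unfold holdsKids; fun_prop

theorem primrec_holdsComb :
    Primrec fun p : (ℕ × List ℕ × ℕ × List ℕ) × List Bool => holdsComb p.1 p.2 := by
  unfold holdsComb; fun_prop

/-- The valuation changes in recursive calls, so the recursion runs over whole argument tuples with
the code of the ECQ as measure. `Primrec.nat_omega_rec'` applies because the list of calls and the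
combination of their results are primitive recursive. -/
theorem primrec_holdsC_aux :
    Primrec fun b : ℕ × List ℕ × ℕ × List ℕ => holdsC b.1 b.2.1 b.2.2.1 b.2.2.2 := by
  refine Primrec.nat_omega_rec' (m := fun b => b.2.2.1) (l := holdsKids)
    (g := fun b rs => some (holdsComb b rs)) _ (by fun_prop) primrec_holdsKids
    (Primrec.option_some.comp primrec_holdsComb) ?_ fun b => congrArg some (holdsC_rec b)
  rintro ⟨T, A, n, v⟩ b' hb'
  simp only [holdsKids, eqN_def] at hb'
  by_cases h0 : pfst n = 0
  · simp [h0] at hb'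
  have h := psnd_lt h0
  have h' := pfst_le (psnd n)
  have h'' := psnd_le (psnd n)
  by_cases h1 : pfst n = 1
  · simp only [h1, one_ne_zero, decide_false, cond_false, decide_true, cond_true,
      List.mem_singleton] at hb'
    subst hb'; exact h
  by_cases h2 : pfst n = 2
  · simp only [h2, OfNat.ofNat_ne_zero, OfNat.ofNat_ne_one, decide_false, cond_false, decide_true,
      cond_true, List.mem_cons, List.not_mem_nil, or_false] at hb'
    rcases hb' with rfl | rfl
    · exact h'.trans_lt h
    · exact h''.trans_lt h
  · simp only [h0, h1, h2, decide_false, cond_false, List.mem_map] at hb'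
    obtain ⟨d, -, rfl⟩ := hb'
    exact h''.trans_lt h

@[fun_prop]
theorem primrec_holdsC {α : Type*} [Primcodable α] {T n : α → ℕ} {A v : α → List ℕ}
    (hT : Primrec T) (hA : Primrec A) (hn : Primrec n) (hv : Primrec v) :
    Primrec fun a => holdsC (T a) (A a) (n a) (v a) :=
  primrec_holdsC_aux.comp (hT.pair (hA.pair (hn.pair hv)))

end ITKAB

namespace ITKAB

/-! ## Successor states on codes -/

section succ

variable {α : Type*} [Primcodable α]

@[fun_prop]
theorem primrec_take {β : Type*} [Primcodable β] {f : α → List β} {n : α → ℕ} (h : Primrec f)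
    (h' : Primrec n) : Primrec fun a => (f a).take (n a) :=
  Primrec.list_take.comp h' h

/-- The terms of a coded atom. -/
def termsC (a : ℕ) : List ℕ :=
  bif eqN (pfst a) 0 then [psnd (psnd a)] else [pfst (psnd (psnd a)), psnd (psnd (psnd a))]

@[fun_prop]
theorem primrec_termsC {f : α → ℕ} (h : Primrec f) : Primrec fun a => termsC (f a) := by
  unfold termsC; fun_prop

theorem termsC_code {τ : Type} (c : τ → ℕ) (a : Atom τ) : termsC (a.code c) = a.terms.map c := by
  cases a <;> simp [termsC, Atom.code, Atom.terms]

/-- The free variables of a coded UCQ. -/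
def fvL (q : ℕ) : List ℕ :=
  (decL q).flatMap fun d => (decL (psnd d)).flatMap fun a => (termsC a).flatMap fun t =>
    sing (eqN (pfst t) 0 && !((decL (pfst d)).contains (psnd t))) (psnd t)

@[fun_prop]
theorem primrec_fvL {f : α → ℕ} (h : Primrec f) : Primrec fun a => fvL (f a) := by
  unfold fvL; fun_prop

theorem mem_fvL (q : UCQ) (x : ℕ) : x ∈ fvL (codeList CQ.code q) ↔ x ∈ ucqFV q := by
  have ht : ∀ t : QTerm, pfst t.code = 0 ∧ x = psnd t.code ↔ x ∈ t.vars := by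
    rintro (y | c) <;> simp [QTerm.code, QTerm.vars]
  simp only [fvL, decL_codeList, List.mem_flatMap, List.mem_map, exists_exists_and_eq_and, CQ.code,
    pfst_pair, psnd_pair, termsC_code, mem_sing, Bool.and_eq_true, eqN_def, decide_eq_true_eq,
    Bool.not_eq_true', Bool.eq_false_iff, ne_eq, List.contains_iff_mem, ucqFV, List.map_id,
    Set.mem_ofPred_eq]
  constructor
  · rintro ⟨d, hd, a, ha, t, htm, ⟨h₁, h₂⟩, h₃⟩
    exact ⟨d, hd, h₃ ▸ h₂, a, ha, t, htm, (ht t).1 ⟨h₁, h₃⟩⟩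
  · rintro ⟨d, hd, h₂, a, ha, t, htm, hx⟩
    obtain ⟨h₁, h₃⟩ := (ht t).2 hx
    exact ⟨d, hd, a, ha, t, htm, ⟨h₁, h₃ ▸ h₂⟩, h₃⟩

/-- Codes of service calls. -/
def scode (c : SCall) : ℕ := Nat.pair c.1 (encL c.2)

theorem scode_inj : Function.Injective scode := by
  rintro ⟨f, l⟩ ⟨g, m⟩ h
  simp only [scode, Nat.pair_eq_pair] at h
  rw [h.1, codeList_inj Function.injective_id h.2]

/-- Codes of ground terms. -/
def GTerm.code : GTerm → ℕ
  | .const c => Nat.pair 0 c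
  | .call s => Nat.pair 1 (scode s)

/-- Instantiation of effect terms, on codes. -/
def groundC (ρ : List ℕ) (t : ℕ) : ℕ :=
  bif eqN (pfst t) 0 then
    bif eqN (pfst (psnd t)) 0 then Nat.pair 0 (val ρ (psnd (psnd t)))
    else Nat.pair 0 (psnd (psnd t))
  else Nat.pair 1 (Nat.pair (pfst (psnd t)) (encL ((decL (psnd (psnd t))).map fun x => val ρ x)))

@[fun_prop]
theorem primrec_groundC {ρ : α → List ℕ} {t : α → ℕ} (hρ : Primrec ρ) (ht : Primrec t) :
    Primrec fun a => groundC (ρ a) (t a) := by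
  unfold groundC; fun_prop

theorem groundC_code (ρ : List ℕ) (t : ETerm) :
    groundC ρ t.code = (t.ground (val ρ)).code := by
  rcases t with (x | c) | ⟨f, args⟩ <;>
    simp [groundC, ETerm.code, QTerm.code, ETerm.ground, GTerm.code, scode]

/-- Instantiation of effect atoms, on codes. -/
def groundAtomC (ρ : List ℕ) (a : ℕ) : ℕ :=
  bif eqN (pfst a) 0 then Nat.pair 0 (Nat.pair (pfst (psnd a)) (groundC ρ (psnd (psnd a))))
  else Nat.pair 1 (Nat.pair (pfst (psnd a)) (Nat.pair (groundC ρ (pfst (psnd (psnd a))))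
    (groundC ρ (psnd (psnd (psnd a))))))

@[fun_prop]
theorem primrec_groundAtomC {ρ : α → List ℕ} {t : α → ℕ} (hρ : Primrec ρ) (ht : Primrec t) :
    Primrec fun a => groundAtomC (ρ a) (t a) := by
  unfold groundAtomC; fun_prop

theorem groundAtomC_code (ρ : List ℕ) (a : Atom ETerm) :
    groundAtomC ρ (a.code ETerm.code) = (a.map (ETerm.ground (val ρ))).code GTerm.code := by
  cases a <;> simp [groundAtomC, Atom.code, groundC_code, Atom.map]

/-- Replacement of service calls by their results, on codes. -/
def evalC (θ : List ℕ) (t : ℕ) : ℕ := bif eqN (pfst t) 0 then psnd t else val θ (psnd t)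

@[fun_prop]
theorem primrec_evalC {θ : α → List ℕ} {t : α → ℕ} (hθ : Primrec θ) (ht : Primrec t) :
    Primrec fun a => evalC (θ a) (t a) := by
  unfold evalC; fun_prop

/-- The function on service calls that is given by an association list. -/
def sval (θ : List ℕ) (c : SCall) : ℕ := val θ (scode c)

theorem evalC_code (θ : List ℕ) (t : GTerm) : evalC θ t.code = t.eval (sval θ) := by
  cases t <;> simp [evalC, GTerm.code, GTerm.eval, sval]

/-- Evaluation of the service calls of an atom, on codes. -/
def evalAtomC (θ : List ℕ) (a : ℕ) : ℕ :=
  bif eqN (pfst a) 0 then Nat.pair 0 (Nat.pair (pfst (psnd a)) (evalC θ (psnd (psnd a))))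
  else Nat.pair 1 (Nat.pair (pfst (psnd a)) (Nat.pair (evalC θ (pfst (psnd (psnd a))))
    (evalC θ (psnd (psnd (psnd a))))))

@[fun_prop]
theorem primrec_evalAtomC {θ : α → List ℕ} {t : α → ℕ} (hθ : Primrec θ) (ht : Primrec t) :
    Primrec fun a => evalAtomC (θ a) (t a) := by
  unfold evalAtomC; fun_prop

theorem evalAtomC_code (θ : List ℕ) (a : Atom GTerm) :
    evalAtomC θ (a.code GTerm.code) = fcode (a.map (GTerm.eval (sval θ))) := by
  cases a <;> simp [evalAtomC, Atom.code, evalC_code, Atom.map]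

/-- The answers to the condition of an effect `e`, extending `σ`. -/
def answersC (T : ℕ) (A ps σ : List ℕ) (e : ℕ) : List (List ℕ) :=
  (assign ((fvL (pfst e)).filter fun x => !(ps.contains x)) (adomL A) σ).filter fun ρ =>
    cqaC T A (pfst e) ρ && holdsC T A (pfst (psnd e)) ρ

@[fun_prop]
theorem primrec_answersC {T e : α → ℕ} {A ps σ : α → List ℕ} (hT : Primrec T) (hA : Primrec A)
    (hp : Primrec ps) (hσ : Primrec σ) (he : Primrec e) :
    Primrec fun a => answersC (T a) (A a) (ps a) (σ a) (e a) := by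
  unfold answersC; fun_prop

/-- The facts with service calls that an action `a` produces, on codes. -/
def doC (T : ℕ) (A : List ℕ) (a : ℕ) (σ : List ℕ) : List ℕ :=
  (decL (psnd a)).flatMap fun e => (answersC T A (decL (pfst a)) σ e).flatMap fun ρ =>
    (decL (psnd (psnd e))).map fun f => groundAtomC ρ f

@[fun_prop]
theorem primrec_doC {T e : α → ℕ} {A σ : α → List ℕ} (hT : Primrec T) (hA : Primrec A)
    (he : Primrec e) (hσ : Primrec σ) :
    Primrec fun a => doC (T a) (A a) (e a) (σ a) := by
  unfold doC; fun_prop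

theorem map_ground_congr {a : Atom ETerm} {ρ ρ' : ℕ → ℕ}
    (h : ∀ t ∈ a.terms, ∀ x ∈ t.vars, ρ x = ρ' x) :
    a.map (ETerm.ground ρ) = a.map (ETerm.ground ρ') := by
  have ht : ∀ t ∈ a.terms, ETerm.ground ρ t = ETerm.ground ρ' t := by
    rintro ((x | c) | ⟨f, args⟩) ht
    · simp only [ETerm.ground]; rw [h _ ht x (by simp [ETerm.vars, QTerm.vars])]
    · rfl
    · simp only [ETerm.ground]
      have : args.map ρ = args.map ρ' := List.map_congr_left fun x hx => h _ ht x hx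
      rw [this]
  cases a with
  | concept N t => simp only [Atom.map]; rw [ht t (by simp [Atom.terms])]
  | role P t t' =>
    simp only [Atom.map]; rw [ht t (by simp [Atom.terms]), ht t' (by simp [Atom.terms])]

/-- The program enumerates values only for the free variables of `q⁺` that are not parameters. By
well-formedness, `Q⁻` and the produced facts depend on no other variables besides the parameters. -/
theorem mem_doC {T : TBox} (hT : T.IsDLLiteA) (A : List ℕ) {a : Action} (ha : a.WF) (σ : List ℕ)
    (n : ℕ) : n ∈ doC T.code A a.code σ ↔
      ∃ F ∈ doFacts T (decA A) a (val σ), n = F.code GTerm.code := by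
  simp only [doC, answersC, Action.code, pfst_pair, psnd_pair, decL_codeList, List.mem_flatMap,
    List.mem_map, exists_exists_and_eq_and, Effect.code, List.mem_filter, Bool.and_eq_true,
    cqaC_iff hT, holdsC_iff hT, doFacts, Set.mem_ofPred_eq, groundAtomC_code, List.map_id]
  constructor
  · rintro ⟨e, he, ρ, ⟨hρ, hq, hQ⟩, f, hf, rfl⟩
    refine ⟨_, ⟨e, he, val ρ, fun p hp => ?_, fun x hx hxp => ?_, ⟨hq, hQ⟩, f, hf, rfl⟩, rfl⟩
    · have := (valO_of_mem_assign hρ p).2 (by simp [List.mem_filter, hp])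
      simp [val, this]
    · obtain ⟨d, hd, h⟩ := (valO_of_mem_assign hρ x).1 (by simp [List.mem_filter, hxp, mem_fvL, hx])
      rw [val_eq_of_valO h]; exact mem_adomL.1 hd
  · rintro ⟨F, ⟨e, he, ρ, hσ, hadom, ⟨hq, hQ⟩, f, hf, rfl⟩, rfl⟩
    obtain ⟨l, hl, hv⟩ := exists_mem_assign
      ((fvL (codeList CQ.code e.qpos)).filter fun x => !(a.params.contains x)) (adomL A) σ ρ
      (fun x hx => by
        simp only [List.mem_filter, mem_fvL, Bool.not_eq_true', Bool.eq_false_iff, ne_eq,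
          List.contains_iff_mem] at hx
        exact mem_adomL.2 (hadom x hx.1 hx.2))
    have hagree : ∀ x, x ∈ ucqFV e.qpos ∨ x ∈ a.params → val l x = ρ x := by
      intro x hx
      by_cases hp : x ∈ a.params
      · have := hv x
        rw [if_neg (by simp [List.mem_filter, hp])] at this
        rw [hσ x hp, val, this, val]
      · have hx := hx.resolve_right hp
        have := hv x
        rw [if_pos (by simp [List.mem_filter, hp, mem_fvL, hx])] at this
        exact val_eq_of_valO this
    refine ⟨e, he, l, ⟨hl, ?_, ?_⟩, f, hf, ?_⟩
    · exact (cqa_congr fun x hx => hagree x (Or.inl hx)).2 hq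
    · exact (e.qneg.holds_congr fun x hx => hagree x (ha.qneg e he x hx)).2 hQ
    · rw [map_ground_congr fun t ht x hx => hagree x (ha.facts e he f hf t ht x hx)]

/-- The service calls in a list of facts, on codes. -/
def callsC (D : List ℕ) : List ℕ :=
  D.flatMap fun a => ((termsC a).filter fun t => eqN (pfst t) 1).map fun t => psnd t

@[fun_prop]
theorem primrec_callsC {D : α → List ℕ} (hD : Primrec D) : Primrec fun a => callsC (D a) := by
  unfold callsC; fun_prop

theorem mem_callsC {D : List ℕ} {E : Set (Atom GTerm)}
    (h : ∀ n, n ∈ D ↔ ∃ F ∈ E, n = F.code GTerm.code) (n : ℕ) :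
    n ∈ callsC D ↔ ∃ c ∈ calls E, n = scode c := by
  simp only [callsC, List.mem_flatMap, h, List.mem_map, List.mem_filter, eqN_def,
    decide_eq_true_eq, calls, Set.mem_ofPred_eq]
  constructor
  · rintro ⟨_, ⟨F, hF, rfl⟩, t, ⟨ht, h1⟩, rfl⟩
    rw [termsC_code, List.mem_map] at ht
    obtain ⟨g, hg, rfl⟩ := ht
    cases g with
    | const c => simp [GTerm.code] at h1
    | call s => exact ⟨s, ⟨F, hF, hg⟩, by simp [GTerm.code]⟩
  · rintro ⟨c, ⟨F, hF, hc⟩, rfl⟩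
    refine ⟨_, ⟨F, hF, rfl⟩, (GTerm.call c).code, ⟨?_, ?_⟩, ?_⟩
    · rw [termsC_code]; exact List.mem_map_of_mem hc
    · simp [GTerm.code]
    · simp [GTerm.code]

/-! ### Successors of a coded state. -/

/-- The TBox of a coded KAB. -/
def kT (K : ℕ) : ℕ := pfst K

/-- The actions of a coded KAB. -/
def kActs (K : ℕ) : List ℕ := decL (pfst (psnd (psnd K)))

/-- The rules of a coded KAB. -/
def kRules (K : ℕ) : List ℕ := decL (psnd (psnd (psnd K)))

@[fun_prop]
theorem primrec_kT {K : α → ℕ} (h : Primrec K) : Primrec fun a => kT (K a) := by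
  unfold kT; fun_prop

@[fun_prop]
theorem primrec_kActs {K : α → ℕ} (h : Primrec K) : Primrec fun a => kActs (K a) := by
  unfold kActs; fun_prop

@[fun_prop]
theorem primrec_kRules {K : α → ℕ} (h : Primrec K) : Primrec fun a => kRules (K a) := by
  unfold kRules; fun_prop

@[simp] theorem kT_code (K : KAB) : kT K.code = K.tbox.code := by simp [kT, KAB.code]

@[simp] theorem kActs_code (K : KAB) : kActs K.code = K.actions.map Action.code := by
  simp [kActs, KAB.code]

@[simp] theorem kRules_code (K : KAB) : kRules K.code = K.rules.map (codePair ECQ.code id) := by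
  simp [kRules, KAB.code]

/-- The new service calls of an action. -/
def newCallsC (T : ℕ) (A m : List ℕ) (a : ℕ) (σ : List ℕ) : List ℕ :=
  (callsC (doC T A a σ)).filter fun c => eqN (valO m c) 0

@[fun_prop]
theorem primrec_newCallsC {T e : α → ℕ} {A m σ : α → List ℕ} (hT : Primrec T) (hA : Primrec A)
    (hm : Primrec m) (he : Primrec e) (hσ : Primrec σ) :
    Primrec fun a => newCallsC (T a) (A a) (m a) (e a) (σ a) := by
  unfold newCallsC; fun_prop

/-- The successors by the action `a` with parameters `σ` and results of new calls below `M`. -/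
def execC (T : ℕ) (M : ℕ) (A m : List ℕ) (a : ℕ) (σ : List ℕ) : List ℕ :=
  -- Since `θ` is `m` with entries for the new calls put in front, the same list evaluates all calls
  -- and serves as the next service call map. Old calls keep their results automatically.
  (assign (newCallsC T A m a σ) (List.range M) m).map fun θ =>
    Nat.pair (encL ((doC T A a σ).map fun f => evalAtomC θ f)) (encL θ)

@[fun_prop]
theorem primrec_execC {T M e : α → ℕ} {A m σ : α → List ℕ} (hT : Primrec T) (hM : Primrec M)
    (hA : Primrec A) (hm : Primrec m) (he : Primrec e) (hσ : Primrec σ) :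
    Primrec fun a => execC (T a) (M a) (A a) (m a) (e a) (σ a) := by
  unfold execC; fun_prop

/-- The successor states of `s` with results of new calls below `M`. -/
def succC (K M s : ℕ) : List ℕ :=
  (kRules K).flatMap fun r => (((kActs K).drop (psnd r)).take 1).flatMap fun a =>
    ((assign (decL (pfst a)) (adomL (decL (pfst s))) []).filter fun σ =>
      holdsC (kT K) (decL (pfst s)) (pfst r) σ).flatMap fun σ =>
        execC (kT K) M (decL (pfst s)) (decL (psnd s)) a σ

@[fun_prop]
theorem primrec_succC {K M s : α → ℕ} (hK : Primrec K) (hM : Primrec M) (hs : Primrec s) :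
    Primrec fun a => succC (K a) (M a) (s a) := by
  unfold succC; fun_prop

/-- The state with a given code. -/
def stOf (s : ℕ) : KState :=
  ⟨decA (decL (pfst s)), fun c => if valO (decL (psnd s)) (scode c) = 0 then none
    else some (val (decL (psnd s)) (scode c))⟩

theorem stOf_scmap_eq_some {s : ℕ} {c : SCall} {d : ℕ} :
    (stOf s).scmap c = some d ↔ valO (decL (psnd s)) (scode c) = d + 1 := by
  simp only [stOf, val]
  split_ifs with h
  · simp [h]
  · simp only [Option.some.injEq]; omega

theorem mem_take_one_drop {β : Type*} {l : List β} {i : ℕ} {a : β} :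
    a ∈ (l.drop i).take 1 ↔ l[i]? = some a := by
  rw [List.take_one, List.head?_drop]; simp

theorem mem_succC (K : KAB) (M s t : ℕ) : t ∈ succC K.code M s ↔
    ∃ r ∈ K.rules, ∃ a, K.actions[r.2]? = some a ∧
      ∃ σ ∈ assign a.params (adomL (decL (pfst s))) [],
        holdsC K.tbox.code (decL (pfst s)) r.1.code σ = true ∧
        t ∈ execC K.tbox.code M (decL (pfst s)) (decL (psnd s)) a.code σ := by
  simp only [succC, kRules_code, kActs_code, kT_code, List.mem_flatMap, List.mem_map,
    exists_exists_and_eq_and, codePair, pfst_pair, psnd_pair, mem_take_one_drop, List.mem_filter,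
    List.getElem?_map, Option.map_eq_some_iff, Action.code, decL_codeList, List.map_id, id]
  constructor
  · rintro ⟨r, hr, a, ha, σ, ⟨h₁, h₂⟩, h₃⟩
    exact ⟨r, hr, a, ha, σ, by simpa using h₁, h₂, h₃⟩
  · rintro ⟨r, hr, a, ha, σ, h₁, h₂, h₃⟩
    exact ⟨r, hr, a, ha, σ, ⟨by simpa using h₁, h₂⟩, h₃⟩

/-- The effect of an action under an association list of results of service calls. -/
theorem mem_execC {T : TBox} (hT : T.IsDLLiteA) {M : ℕ} {A m : List ℕ} {a : Action} (ha : a.WF)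
    {σ : List ℕ} {t : ℕ} (h : t ∈ execC T.code M A m a.code σ) :
    ∃ θ, t = Nat.pair (encL ((doC T.code A a.code σ).map fun f => evalAtomC θ f)) (encL θ) ∧
      (∀ c, c ∈ calls (doFacts T (decA A) a (val σ)) → valO m (scode c) = 0 →
        ∃ d < M, valO θ (scode c) = d + 1) ∧
      ∀ c, c ∉ calls (doFacts T (decA A) a (val σ)) ∨ valO m (scode c) ≠ 0 →
        valO θ (scode c) = valO m (scode c) := by
  simp only [execC, List.mem_map] at h
  obtain ⟨θ, hθ, rfl⟩ := h
  have hcalls : ∀ c, scode c ∈ newCallsC T.code A m a.code σ ↔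
      c ∈ calls (doFacts T (decA A) a (val σ)) ∧ valO m (scode c) = 0 := by
    intro c
    simp only [newCallsC, List.mem_filter, mem_callsC (mem_doC hT A ha σ), eqN_def,
      decide_eq_true_eq]
    refine and_congr_left fun _ => ⟨?_, fun h => ⟨c, h, rfl⟩⟩
    rintro ⟨c', h, h'⟩
    rwa [scode_inj h']
  refine ⟨θ, rfl, fun c hc hm => ?_, fun c hc => ?_⟩
  · obtain ⟨d, hd, h⟩ := (valO_of_mem_assign hθ _).1 ((hcalls c).2 ⟨hc, hm⟩)
    exact ⟨d, List.mem_range.1 hd, h⟩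
  · refine (valO_of_mem_assign hθ _).2 fun h => ?_
    have := (hcalls c).1 h
    tauto

theorem coe_decA_eval {T : TBox} (hT : T.IsDLLiteA) {A : List ℕ} {a : Action} (ha : a.WF)
    {σ θ : List ℕ} :
    (decA ((doC T.code A a.code σ).map fun f => evalAtomC θ f) : Set Fact) =
      Atom.map (GTerm.eval (sval θ)) '' doFacts T (decA A) a (val σ) := by
  ext F
  simp only [Finset.mem_coe, mem_decA, List.mem_map, mem_doC hT A ha, Set.mem_image]
  constructor
  · rintro ⟨_, ⟨G, hG, rfl⟩, h⟩
    rw [evalAtomC_code] at h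
    exact ⟨G, hG, Atom.code_inj Function.injective_id h⟩
  · rintro ⟨G, hG, rfl⟩
    exact ⟨_, ⟨G, hG, rfl⟩, evalAtomC_code _ _⟩

theorem step_of_mem_succC {K : KAB} (hK : K.WF) {M s t : ℕ} (h : t ∈ succC K.code M s) :
    K.Step (stOf s) (stOf t) := by
  obtain ⟨r, hr, a, ha, σ, hσ, hh, ht⟩ := (mem_succC K M s t).1 h
  have haK : a ∈ K.actions := List.mem_of_getElem? ha
  have haW := hK.actions a haK
  obtain ⟨θ, rfl, hθ₁, hθ₂⟩ := mem_execC hK.tbox haW ht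
  refine ⟨a, haK, val σ, ⟨r, hr, ha, fun p hp => ?_, (holdsC_iff hK.tbox _ _ _).1 hh⟩, sval θ, ?_, ?_,
    ?_, ?_⟩
  · obtain ⟨d, hd, h⟩ := (valO_of_mem_assign hσ p).1 hp
    rw [val_eq_of_valO h]; exact mem_adomL.1 hd
  · intro c hc d hd
    rw [stOf_scmap_eq_some] at hd
    rw [sval, val_eq_of_valO ((hθ₂ c (Or.inr (by omega))).trans hd)]
  · simp only [stOf, pfst_pair, decL_codeList, List.map_id]
    exact coe_decA_eval hK.tbox haW
  · intro c hc
    rw [stOf_scmap_eq_some]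
    simp only [psnd_pair, decL_codeList, List.map_id, sval]
    by_cases hm : valO (decL (psnd s)) (scode c) = 0
    · obtain ⟨d, -, h⟩ := hθ₁ c hc hm
      rw [val_eq_of_valO h, h]
    · have := hθ₂ c (Or.inr hm)
      rw [val]; omega
  · intro c hc
    simp only [stOf, psnd_pair, decL_codeList, List.map_id, hθ₂ c (Or.inl hc), val]

theorem doFacts_congr {T : TBox} {A : ABox} {a : Action} {σ σ' : ℕ → ℕ}
    (h : ∀ p ∈ a.params, σ p = σ' p) : doFacts T A a σ = doFacts T A a σ' := by
  ext F
  refine exists_congr fun e => and_congr_right fun _ => exists_congr fun ρ => and_congr_left fun _ => ?_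
  exact forall₂_congr fun p hp => by rw [h p hp]

theorem KState.ext' {s s' : KState} (h : s.abox = s'.abox) (h' : ∀ c, s.scmap c = s'.scmap c) :
    s = s' := by
  cases s; cases s'
  simp only [KState.mk.injEq]
  exact ⟨h, funext h'⟩

/-- Every result of an issued call occurs in the new ABox. So a bound on the constants of that ABox
bounds all values the enumeration has to try. -/
theorem mem_succC_of_step {K : KAB} (hK : K.WF) {M s : ℕ} {s' : KState} (h : K.Step (stOf s) s')
    (hM : ∀ c ∈ adom s'.abox, c < M) : ∃ t ∈ succC K.code M s, stOf t = s' := by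
  obtain ⟨a, haK, σ, ⟨r, hr, ha, hσ, hh⟩, θ, hθ, hA, hc, hn⟩ := h
  have haW := hK.actions a haK
  obtain ⟨σ', hσ', hσv⟩ := exists_mem_assign a.params (adomL (decL (pfst s))) [] σ
    (fun p hp => mem_adomL.2 (hσ p hp))
  have hagree : ∀ p ∈ a.params, σ p = val σ' p := fun p hp => by
    have := hσv p
    rw [if_pos hp] at this
    rw [val_eq_of_valO this]
  have hdo := doFacts_congr (T := K.tbox) (A := (stOf s).abox) hagree
  have hcalls := mem_callsC (mem_doC hK.tbox (decL (pfst s)) haW σ')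
  rw [hdo] at hθ hA hc hn
  have hlt : ∀ c ∈ calls (doFacts K.tbox (stOf s).abox a (val σ')), θ c < M := by
    rintro c ⟨F, hF, hcF⟩
    refine hM _ ⟨F.map (GTerm.eval θ), ?_, ?_⟩
    · rw [← Finset.mem_coe, hA]; exact ⟨F, hF, rfl⟩
    · have : (F.map (GTerm.eval θ)).terms = F.terms.map (GTerm.eval θ) := by cases F <;> rfl
      rw [this]
      exact List.mem_map.2 ⟨_, hcF, rfl⟩
  obtain ⟨θ', hθ', hθv⟩ := exists_mem_assign
    (newCallsC K.tbox.code (decL (pfst s)) (decL (psnd s)) a.code σ') (List.range M) (decL (psnd s))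
    -- The function `θ`, read on codes of service calls.
    (fun n => θ (pfst n, decL (psnd n))) (fun n hn => by
      simp only [newCallsC, List.mem_filter, hcalls] at hn
      obtain ⟨⟨c, hc, rfl⟩, -⟩ := hn
      simpa [scode] using hlt c hc)
  have hnew : ∀ c, c ∈ calls (doFacts K.tbox (stOf s).abox a (val σ')) →
      valO (decL (psnd s)) (scode c) = 0 → valO θ' (scode c) = θ c + 1 := by
    intro c hc hm
    rw [hθv, if_pos]
    · simp [scode]
    · simp only [newCallsC, List.mem_filter, hcalls]
      exact ⟨⟨c, hc, rfl⟩, by simp [hm]⟩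
  have hold : ∀ c, c ∉ calls (doFacts K.tbox (stOf s).abox a (val σ')) ∨
      valO (decL (psnd s)) (scode c) ≠ 0 → valO θ' (scode c) = valO (decL (psnd s)) (scode c) := by
    intro c hc
    rw [hθv, if_neg]
    simp only [newCallsC, List.mem_filter, hcalls, eqN_def, decide_eq_true_eq]
    rintro ⟨⟨c', hc', h⟩, h'⟩
    rw [← scode_inj h] at hc'
    exact hc.elim (fun h => h hc') (fun h => h h')
  have hval : ∀ c ∈ calls (doFacts K.tbox (stOf s).abox a (val σ')), sval θ' c = θ c ∧
      valO θ' (scode c) = θ c + 1 := by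
    intro c hc'
    by_cases hm : valO (decL (psnd s)) (scode c) = 0
    · have := hnew c hc' hm
      exact ⟨val_eq_of_valO this, this⟩
    · have h₁ := hold c (Or.inr hm)
      obtain ⟨d, hd⟩ := Nat.exists_eq_succ_of_ne_zero hm
      have h₂ := hθ c hc' d (stOf_scmap_eq_some.2 hd)
      rw [hd] at h₁
      exact ⟨by rw [sval, val_eq_of_valO h₁, h₂], by rw [h₁, h₂]⟩
  refine ⟨Nat.pair (encL ((doC K.tbox.code (decL (pfst s)) a.code σ').map fun f => evalAtomC θ' f))
    (encL θ'), (mem_succC K M s _).2 ⟨r, hr, a, ha, σ', hσ', ?_, ?_⟩, KState.ext' ?_ ?_⟩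
  · rw [holdsC_iff hK.tbox]
    -- The association list agrees with `σ` only on the parameters, which are exactly the free
    -- variables of the rule condition.
    refine (r.1.holds_congr fun x hx => ?_).1 hh
    obtain ⟨a', ha', hp⟩ := hK.rules r hr
    obtain rfl : a' = a := Option.some_inj.1 (ha'.symm.trans ha)
    exact hagree x ((hp x).1 hx)
  · exact List.mem_map.2 ⟨θ', hθ', rfl⟩
  · rw [← Finset.coe_inj, hA]
    simp only [stOf, pfst_pair, decL_codeList, List.map_id]
    rw [coe_decA_eval hK.tbox haW]
    refine Set.image_congr fun F hF => ?_
    have ht : ∀ t ∈ F.terms, GTerm.eval (sval θ') t = GTerm.eval θ t := by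
      rintro (c | c) ht
      · rfl
      · exact (hval c ⟨F, hF, ht⟩).1
    cases F with
    | concept N t => simp only [Atom.map]; rw [ht t (by simp [Atom.terms])]
    | role P t t' =>
      simp only [Atom.map]; rw [ht t (by simp [Atom.terms]), ht t' (by simp [Atom.terms])]
  · intro c
    by_cases hc' : c ∈ calls (doFacts K.tbox (stOf s).abox a (val σ'))
    · rw [hc c hc', stOf_scmap_eq_some]
      simpa using (hval c hc').2
    · rw [hn c hc']
      have := hold c (Or.inl hc')
      simp only [stOf, psnd_pair, decL_codeList, List.map_id, this, val]

end succ

end ITKAB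

namespace ITKAB

/-! ## Sizes of codes -/

theorem le_codeList {α : Type} {c : α → ℕ} {l : List α} {a : α} (h : a ∈ l) :
    c a ≤ codeList c l := by
  induction l with
  | nil => simp at h
  | cons b l ih =>
    rw [codeList]
    rcases List.mem_cons.1 h with rfl | h
    · exact (Nat.left_le_pair _ _).trans (Nat.le_succ _)
    · exact (ih h).trans ((Nat.right_le_pair _ _).trans (Nat.le_succ _))

theorem length_le_codeList {α : Type} {c : α → ℕ} (l : List α) : l.length ≤ codeList c l := by
  induction l with
  | nil => simp
  | cons b l ih =>
    rw [codeList, List.length_cons]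
    exact Nat.succ_le_succ (ih.trans (Nat.right_le_pair _ _))

theorem Atom.le_code {τ : Type} {c : τ → ℕ} {a : Atom τ} {t : τ} (h : t ∈ a.terms) :
    c t ≤ a.code c := by
  cases a with
  | concept N u =>
    simp only [Atom.terms, List.mem_singleton] at h
    subst h
    exact (Nat.right_le_pair _ _).trans (Nat.right_le_pair _ _)
  | role P u u' =>
    have h₀ : Nat.pair (c u) (c u') ≤ (Atom.role P u u').code c :=
      (Nat.right_le_pair _ _).trans (Nat.right_le_pair _ _)
    simp only [Atom.terms, List.mem_cons, List.not_mem_nil, or_false] at h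
    rcases h with rfl | rfl
    · exact (Nat.left_le_pair _ _).trans h₀
    · exact (Nat.right_le_pair _ _).trans h₀

/-- The concept or role name of an atom. -/
def Atom.pred {τ : Type} : Atom τ → ℕ
  | .concept N _ => N
  | .role P _ _ => P

@[simp] theorem Atom.pred_map {τ υ : Type} (g : τ → υ) (a : Atom τ) : (a.map g).pred = a.pred := by
  cases a <;> rfl

@[simp] theorem Atom.terms_map {τ υ : Type} (g : τ → υ) (a : Atom τ) :
    (a.map g).terms = a.terms.map g := by
  cases a <;> rfl

theorem Atom.map_map {τ υ ω : Type} (g : τ → υ) (h : υ → ω) (a : Atom τ) :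
    (a.map g).map h = a.map (h ∘ g) := by
  cases a <;> rfl

@[simp] theorem Atom.map_id {τ : Type} (a : Atom τ) : a.map id = a := by
  cases a <;> rfl

theorem Atom.map_congr {τ υ : Type} {g h : τ → υ} {a : Atom τ} (H : ∀ t ∈ a.terms, g t = h t) :
    a.map g = a.map h := by
  cases a with
  | concept N t => simp only [Atom.map]; rw [H t (by simp [Atom.terms])]
  | role P t t' =>
    simp only [Atom.map]; rw [H t (by simp [Atom.terms]), H t' (by simp [Atom.terms])]

theorem Atom.pred_le_code {τ : Type} {c : τ → ℕ} (a : Atom τ) : a.pred ≤ a.code c := by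
  cases a <;> exact (Nat.left_le_pair _ _).trans (Nat.right_le_pair _ _)

/-- Pairing dominates its components, so the code of an expression bounds every constant in it. A
permutation that fixes all numbers up to the code thus fixes these constants, and no list of them is
needed. -/
theorem const_le_code {q : UCQ} {d : CQ} (hd : d ∈ q) {a : Atom QTerm} (ha : a ∈ d.atoms) {c : ℕ}
    (hc : QTerm.const c ∈ a.terms) : c ≤ codeList CQ.code q :=
  calc c ≤ (QTerm.const c).code := Nat.right_le_pair _ _
    _ ≤ a.code QTerm.code := Atom.le_code hc
    _ ≤ codeList (Atom.code QTerm.code) d.atoms := le_codeList ha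
    _ ≤ d.code := Nat.right_le_pair _ _
    _ ≤ _ := le_codeList hd

theorem KAB.rule_le_code {K : KAB} {r : ECQ × ℕ} (hr : r ∈ K.rules) : r.1.code ≤ K.code :=
  calc r.1.code ≤ codePair ECQ.code id r := Nat.left_le_pair _ _
    _ ≤ codeList (codePair ECQ.code id) K.rules := le_codeList hr
    _ ≤ _ := (Nat.right_le_pair _ _).trans ((Nat.right_le_pair _ _).trans (Nat.right_le_pair _ _))

theorem KAB.action_le_code {K : KAB} {a : Action} (ha : a ∈ K.actions) : a.code ≤ K.code :=
  calc a.code ≤ codeList Action.code K.actions := le_codeList ha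
    _ ≤ _ := (Nat.left_le_pair _ _).trans ((Nat.right_le_pair _ _).trans (Nat.right_le_pair _ _))

theorem Effect.le_code {a : Action} {e : Effect} (he : e ∈ a.effects) : e.code ≤ a.code :=
  (le_codeList he).trans (Nat.right_le_pair _ _)

theorem Effect.qpos_le_code (e : Effect) : codeList CQ.code e.qpos ≤ e.code :=
  Nat.left_le_pair _ _

theorem Effect.qneg_le_code (e : Effect) : e.qneg.code ≤ e.code :=
  (Nat.left_le_pair _ _).trans (Nat.right_le_pair _ _)

theorem Effect.fact_le_code {e : Effect} {f : Atom ETerm} (hf : f ∈ e.facts) :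
    f.code ETerm.code ≤ e.code :=
  (le_codeList hf).trans ((Nat.right_le_pair _ _).trans (Nat.right_le_pair _ _))

/-! ## Renaming of constants -/

/-- The image of an ABox under a permutation of the constants. -/
def permA (π : Equiv.Perm ℕ) (A : ABox) : ABox := A.image (Atom.map π)

theorem mem_permA {π : Equiv.Perm ℕ} {A : ABox} {F : Fact} :
    F ∈ permA π A ↔ F.map π.symm ∈ A := by
  simp only [permA, Finset.mem_image]
  constructor
  · rintro ⟨G, hG, rfl⟩
    rw [Atom.map_map, π.symm_comp_self, Atom.map_id]; exact hG
  · intro h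
    exact ⟨_, h, by rw [Atom.map_map, π.self_comp_symm, Atom.map_id]⟩

@[simp] theorem permA_symm_permA (π : Equiv.Perm ℕ) (A : ABox) : permA π.symm (permA π A) = A := by
  ext F
  rw [mem_permA, mem_permA, Atom.map_map, Equiv.symm_symm, π.symm_comp_self, Atom.map_id]

@[simp] theorem permA_permA_symm (π : Equiv.Perm ℕ) (A : ABox) : permA π (permA π.symm A) = A := by
  simpa using permA_symm_permA π.symm A

theorem permA_mono {π : Equiv.Perm ℕ} {A B : ABox} (h : A ⊆ B) : permA π A ⊆ permA π B :=
  Finset.image_subset_image h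

theorem mem_adom_permA {π : Equiv.Perm ℕ} {A : ABox} {c : ℕ} (h : c ∈ adom A) :
    π c ∈ adom (permA π A) := by
  obtain ⟨F, hF, hc⟩ := h
  exact ⟨F.map π, Finset.mem_image_of_mem _ hF, by simpa using hc⟩

/-- Reinterpretation of the constants. -/
def Interp.rename (π : Equiv.Perm ℕ) (I : Interp) : Interp where
  Dom := I.Dom
  const := I.const ∘ π.symm
  una := I.una.comp π.symm.injective
  conc := I.conc
  role := I.role

theorem Interp.IsModel.rename {π : Equiv.Perm ℕ} {I : Interp} {T : TBox} {A : ABox} (h : I.IsModel T A) :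
    (I.rename π).IsModel T (permA π A) := by
  refine ⟨⟨h.1.posC, h.1.negC, h.1.posR, h.1.negR, h.1.func⟩, fun F hF => ?_⟩
  have := h.2 _ (mem_permA.1 hF)
  cases F <;> exact this

theorem Consistent.perm {π : Equiv.Perm ℕ} {T : TBox} {A : ABox} (h : Consistent T A) :
    Consistent T (permA π A) := by
  obtain ⟨I, hI⟩ := h
  exact ⟨_, hI.rename⟩

/-- The TBox mentions no constants, so renaming preserves consistency. A larger consistent subset of
the image could be renamed back. -/
theorem IsRepair.perm {π : Equiv.Perm ℕ} {T : TBox} {A R : ABox} (h : IsRepair T A R) :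
    IsRepair T (permA π A) (permA π R) := by
  refine ⟨⟨permA_mono h.1.1, h.1.2.perm⟩, fun B hB hRB => ?_⟩
  have h₁ := h.2 (y := permA π.symm B)
    ⟨by simpa using permA_mono (π := π.symm) hB.1, hB.2.perm⟩
    (by simpa using permA_mono (π := π.symm) hRB)
  simpa using permA_mono (π := π) h₁

theorem satUCQ_rename {π : Equiv.Perm ℕ} {I : Interp} {q : UCQ} {v : ℕ → ℕ}
    (hπ : ∀ c ≤ codeList CQ.code q, π c = c) (h : I.satUCQ q v) :
    (I.rename π).satUCQ q (π ∘ v) := by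
  obtain ⟨d, hd, e, he, hat⟩ := h
  refine ⟨d, hd, e, fun x hx => ?_, fun a ha => ?_⟩
  · simp [Interp.rename, he x hx]
  · have ht : ∀ t ∈ a.terms, (I.rename π).termVal e t = I.termVal e t := by
      rintro (x | c) ht
      · rfl
      · have : π.symm c = c := by rw [Equiv.symm_apply_eq, hπ c (const_le_code hd ha ht)]
        simp [Interp.termVal, Interp.rename, this]
    have h₀ := hat a ha
    cases a with
    | concept N t =>
      simp only [Interp.satAtom] at h₀ ⊢
      rw [ht t (by simp [Atom.terms])]
      exact h₀
    | role P t t' =>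
      simp only [Interp.satAtom] at h₀ ⊢
      rw [ht t (by simp [Atom.terms]), ht t' (by simp [Atom.terms])]
      exact h₀

/-- Permutations that fix the constants up to `n`. -/
def FixLe (n : ℕ) (π : Equiv.Perm ℕ) : Prop := ∀ c ≤ n, π c = c

theorem FixLe.mono {m n : ℕ} {π : Equiv.Perm ℕ} (h : FixLe n π) (hm : m ≤ n) : FixLe m π :=
  fun c hc => h c (hc.trans hm)

theorem FixLe.symm {n : ℕ} {π : Equiv.Perm ℕ} (h : FixLe n π) : FixLe n π.symm :=
  fun c hc => by rw [Equiv.symm_apply_eq, h c hc]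

theorem FixLe.mul {n : ℕ} {π π' : Equiv.Perm ℕ} (h : FixLe n π) (h' : FixLe n π') :
    FixLe n (π * π') := fun c hc => by rw [Equiv.Perm.mul_apply, h' c hc, h c hc]

/-- A repair of the renamed ABox and a model of it are pulled back along the inverse permutation.
Renaming an interpretation changes only the denotations of the constants. -/
theorem cqa_perm_aux {π : Equiv.Perm ℕ} {T : TBox} {A : ABox} {q : UCQ} {v : ℕ → ℕ}
    (hπ : FixLe (codeList CQ.code q) π) (h : cqa T A q v) : cqa T (permA π A) q (π ∘ v) := by
  intro R hR I hI
  have h₁ := h (permA π.symm R) (by simpa using hR.perm (π := π.symm)) _ hI.rename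
  have h₂ := satUCQ_rename hπ h₁
  have h₃ : (I.rename π.symm).rename π = I := by
    cases I; simp [Interp.rename, Function.comp_assoc]
  rwa [h₃] at h₂

theorem cqa_perm {π : Equiv.Perm ℕ} {T : TBox} {A : ABox} {q : UCQ} {v : ℕ → ℕ}
    (hπ : FixLe (codeList CQ.code q) π) : cqa T (permA π A) q (π ∘ v) ↔ cqa T A q v := by
  refine ⟨fun h => ?_, cqa_perm_aux hπ⟩
  have := cqa_perm_aux hπ.symm h
  rwa [permA_symm_permA, ← Function.comp_assoc, π.symm_comp_self, Function.id_comp] at this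

theorem comp_update_perm (π : Equiv.Perm ℕ) (v : ℕ → ℕ) (x d : ℕ) :
    π ∘ Function.update v x d = Function.update (π ∘ v) x (π d) :=
  Function.comp_update _ _ _ _

theorem exists_mem_adom_permA {π : Equiv.Perm ℕ} {A : ABox} {p : ℕ → Prop} :
    (∃ d ∈ adom (permA π A), p d) ↔ ∃ d ∈ adom A, p (π d) := by
  constructor
  · rintro ⟨d, hd, h⟩
    refine ⟨π.symm d, ?_, by simpa using h⟩
    simpa using mem_adom_permA (π := π.symm) hd
  · rintro ⟨d, hd, h⟩
    exact ⟨_, mem_adom_permA hd, h⟩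

/-- Genericity of queries: a permutation that fixes their constants changes neither AR-entailment
nor quantification over the active domain. -/
theorem ECQ.holds_perm {π : Equiv.Perm ℕ} {T : TBox} {A : ABox} (Q : ECQ) {v : ℕ → ℕ}
    (hπ : FixLe Q.code π) : Q.holds T (permA π A) (π ∘ v) ↔ Q.holds T A v := by
  induction Q generalizing v with
  | atom q => exact cqa_perm (hπ.mono (Nat.right_le_pair _ _))
  | neg Q ih => exact not_congr (ih (hπ.mono (Nat.right_le_pair _ _)))
  | and Q₁ Q₂ ih₁ ih₂ =>
    exact and_congr (ih₁ (hπ.mono ((Nat.left_le_pair _ _).trans (Nat.right_le_pair _ _))))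
      (ih₂ (hπ.mono ((Nat.right_le_pair _ _).trans (Nat.right_le_pair _ _))))
  | ex x Q ih =>
    simp only [ECQ.holds]
    rw [exists_mem_adom_permA]
    refine exists_congr fun d => and_congr_right fun _ => ?_
    rw [← comp_update_perm]
    exact ih (hπ.mono ((Nat.right_le_pair _ _).trans (Nat.right_le_pair _ _)))

/-- Renaming of the constants of a service call. -/
def permS (π : Equiv.Perm ℕ) (c : SCall) : SCall := (c.1, c.2.map π)

@[simp] theorem permS_symm_permS (π : Equiv.Perm ℕ) (c : SCall) : permS π.symm (permS π c) = c := by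
  simp [permS]

@[simp] theorem permS_permS_symm (π : Equiv.Perm ℕ) (c : SCall) : permS π (permS π.symm c) = c := by
  simp [permS]

/-- Renaming of the constants of a ground term. -/
def GTerm.perm (π : Equiv.Perm ℕ) : GTerm → GTerm
  | .const c => .const (π c)
  | .call s => .call (permS π s)

theorem ETerm.perm_ground {π : Equiv.Perm ℕ} {t : ETerm} (hπ : FixLe t.code π) (ρ : ℕ → ℕ) :
    (t.ground ρ).perm π = t.ground (π ∘ ρ) := by
  rcases t with (x | c) | ⟨f, args⟩
  · rfl
  · simp only [ETerm.ground, GTerm.perm]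
    rw [hπ c ((Nat.right_le_pair _ _).trans (Nat.right_le_pair _ _))]
  · simp [ETerm.ground, GTerm.perm, permS]

theorem doFacts_perm_aux {π : Equiv.Perm ℕ} {T : TBox} {A : ABox} {a : Action} {σ : ℕ → ℕ}
    (hπ : FixLe a.code π) {F : Atom GTerm} (h : F ∈ doFacts T A a σ) :
    F.map (GTerm.perm π) ∈ doFacts T (permA π A) a (π ∘ σ) := by
  obtain ⟨e, he, ρ, h₁, h₂, h₃, f, hf, rfl⟩ := h
  have hle := Effect.le_code he
  refine ⟨e, he, π ∘ ρ, fun p hp => by simp [h₁ p hp], fun x hx hp => mem_adom_permA (h₂ x hx hp),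
    ⟨?_, ?_⟩, f, hf, ?_⟩
  · exact (cqa_perm (hπ.mono (e.qpos_le_code.trans hle))).2 h₃.1
  · exact (e.qneg.holds_perm (hπ.mono (e.qneg_le_code.trans hle))).2 h₃.2
  · rw [Atom.map_map]
    exact Atom.map_congr fun t ht => ETerm.perm_ground
      (hπ.mono ((Atom.le_code ht).trans ((Effect.fact_le_code hf).trans hle))) ρ

theorem GTerm.perm_comp_symm (π : Equiv.Perm ℕ) : GTerm.perm π ∘ GTerm.perm π.symm = id := by
  funext t; cases t <;> simp [GTerm.perm]

theorem mem_doFacts_perm {π : Equiv.Perm ℕ} {T : TBox} {A : ABox} {a : Action} {σ : ℕ → ℕ}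
    (hπ : FixLe a.code π) {F : Atom GTerm} :
    F ∈ doFacts T (permA π A) a (π ∘ σ) ↔ F.map (GTerm.perm π.symm) ∈ doFacts T A a σ := by
  constructor
  · intro h
    have := doFacts_perm_aux hπ.symm h
    rwa [permA_symm_permA, ← Function.comp_assoc, π.symm_comp_self, Function.id_comp] at this
  · intro h
    have := doFacts_perm_aux hπ h
    rwa [Atom.map_map, GTerm.perm_comp_symm, Atom.map_id] at this

theorem mem_calls_perm {π : Equiv.Perm ℕ} {T : TBox} {A : ABox} {a : Action} {σ : ℕ → ℕ}
    (hπ : FixLe a.code π) {c : SCall} :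
    c ∈ calls (doFacts T (permA π A) a (π ∘ σ)) ↔ permS π.symm c ∈ calls (doFacts T A a σ) := by
  constructor
  · rintro ⟨F, hF, hc⟩
    exact ⟨_, (mem_doFacts_perm hπ).1 hF, by
      rw [Atom.terms_map]; exact List.mem_map.2 ⟨_, hc, rfl⟩⟩
  · rintro ⟨F, hF, hc⟩
    refine ⟨_, doFacts_perm_aux hπ hF, ?_⟩
    rw [Atom.terms_map]
    exact List.mem_map.2 ⟨_, hc, by simp [GTerm.perm]⟩

/-- Renaming of the constants of a state. -/
def KState.perm (π : Equiv.Perm ℕ) (s : KState) : KState :=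
  ⟨permA π s.abox, fun c => (s.scmap (permS π.symm c)).map π⟩

@[simp] theorem KState.perm_symm_perm (π : Equiv.Perm ℕ) (s : KState) :
    (s.perm π).perm π.symm = s := by
  apply KState.ext' <;> simp [KState.perm]

@[simp] theorem KState.perm_perm_symm (π : Equiv.Perm ℕ) (s : KState) :
    (s.perm π.symm).perm π = s := by
  simpa using KState.perm_symm_perm π.symm s

theorem KState.perm_mul (π π' : Equiv.Perm ℕ) (s : KState) :
    s.perm (π * π') = (s.perm π').perm π := by
  apply KState.ext'
  · simp [KState.perm, permA, Finset.image_image, Function.comp_def, Atom.map_map]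
  · intro c
    simp [KState.perm, permS, Function.comp_def, Equiv.Perm.mul_def]

@[simp] theorem KState.perm_one (s : KState) : s.perm 1 = s := by
  apply KState.ext'
  · ext F; simp [KState.perm, mem_permA, Equiv.Perm.one_def]
  · intro c; simp [KState.perm, permS, Equiv.Perm.one_def]

/-- Service calls are uninterpreted, so conjugating their evaluation by `π` gives another admissible
evaluation, and everything else in a step is generic. -/
theorem KAB.Step.perm {K : KAB} {s s' : KState} {π : Equiv.Perm ℕ} (hπ : FixLe K.code π)
    (h : K.Step s s') : K.Step (s.perm π) (s'.perm π) := by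
  obtain ⟨a, ha, σ, ⟨r, hr, hra, hσ, hh⟩, θ, hθ, hA, hc, hn⟩ := h
  have hπa := hπ.mono (KAB.action_le_code ha)
  refine ⟨a, ha, π ∘ σ, ⟨r, hr, hra, fun p hp => mem_adom_permA (hσ p hp),
    (r.1.holds_perm (hπ.mono (KAB.rule_le_code hr))).2 hh⟩,
    fun c => π (θ (permS π.symm c)), ?_, ?_, ?_, ?_⟩
  · intro c hc d hd
    rw [KState.perm, mem_calls_perm hπa] at hc
    simp only [KState.perm, Option.map_eq_some_iff] at hd
    obtain ⟨d, hd, rfl⟩ := hd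
    simp only [hθ _ hc d hd]
  · ext F
    simp only [KState.perm, Finset.mem_coe, Set.mem_image, mem_permA]
    rw [← Finset.mem_coe, hA]
    constructor
    · rintro ⟨G, hG, h⟩
      refine ⟨_, doFacts_perm_aux hπa hG, ?_⟩
      have h' := congrArg (Atom.map π) h
      rw [Atom.map_map, Atom.map_map, π.self_comp_symm, Atom.map_id] at h'
      rw [← h', Atom.map_map]
      congr 1
      funext t
      cases t <;> simp [GTerm.perm, GTerm.eval]
    · rintro ⟨G, hG, rfl⟩
      refine ⟨_, (mem_doFacts_perm hπa).1 hG, ?_⟩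
      rw [Atom.map_map, Atom.map_map]
      congr 1
      funext t
      cases t <;> simp [GTerm.perm, GTerm.eval]
  · intro c h
    rw [KState.perm, mem_calls_perm hπa] at h
    simp [KState.perm, hc _ h]
  · intro c h
    rw [KState.perm, mem_calls_perm hπa] at h
    simp [KState.perm, hn _ h]

/-! ## The constants of a state -/

/-- The constants that occur in a state. -/
def KState.supp (s : KState) : Set ℕ :=
  {x | x ∈ adom s.abox ∨ ∃ c d, s.scmap c = some d ∧ (x = d ∨ x ∈ c.2)}

theorem KState.perm_eq_self {π : Equiv.Perm ℕ} {s : KState} (h : ∀ x ∈ s.supp, π x = x) :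
    s.perm π = s := by
  have hF : ∀ F ∈ s.abox, F.map π = F := fun F hF => by
    conv_rhs => rw [← Atom.map_id F]
    exact Atom.map_congr fun t ht => h t (Or.inl ⟨F, hF, ht⟩)
  have hc : ∀ c d, s.scmap c = some d → π d = d ∧ permS π c = c := fun c d hcd => by
    refine ⟨h d (Or.inr ⟨c, d, hcd, Or.inl rfl⟩), ?_⟩
    rw [permS, List.map_congr_left (g := id) fun x hx => h x (Or.inr ⟨c, d, hcd, Or.inr hx⟩)]
    simp
  apply KState.ext'
  · simp only [KState.perm, permA]
    exact (Finset.image_congr fun F h => hF F h).trans Finset.image_id'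
  · intro c
    apply Option.ext
    intro d
    simp only [KState.perm, Option.map_eq_some_iff]
    constructor
    · rintro ⟨d, hd, rfl⟩
      obtain ⟨h₁, h₂⟩ := hc _ _ hd
      rw [permS_permS_symm] at h₂
      rw [h₁, h₂, hd]
    · intro hd
      obtain ⟨h₁, h₂⟩ := hc _ _ hd
      exact ⟨d, by rw [← h₂, permS_symm_permS, hd], h₁⟩

theorem KState.mem_supp_perm {π : Equiv.Perm ℕ} {s : KState} {x : ℕ} (h : x ∈ (s.perm π).supp) :
    ∃ y ∈ s.supp, π y = x := by
  rcases h with ⟨F, hF, hx⟩ | ⟨c, d, hcd, hx⟩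
  · rw [KState.perm, mem_permA] at hF
    exact ⟨π.symm x, Or.inl ⟨_, hF, by rw [Atom.terms_map]; exact List.mem_map_of_mem hx⟩, by simp⟩
  · simp only [KState.perm, Option.map_eq_some_iff] at hcd
    obtain ⟨d, hd, rfl⟩ := hcd
    rcases hx with rfl | hx
    · exact ⟨d, Or.inr ⟨_, _, hd, Or.inl rfl⟩, rfl⟩
    · exact ⟨π.symm x, Or.inr ⟨_, _, hd, Or.inr (List.mem_map_of_mem hx)⟩, by simp⟩

/-- The constants and service calls in the facts produced by an action. -/
theorem doFacts_terms {T : TBox} {A : ABox} {a : Action} {σ : ℕ → ℕ} (ha : a.WF)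
    (hσ : ∀ p ∈ a.params, σ p ∈ adom A) {F : Atom GTerm} (hF : F ∈ doFacts T A a σ) :
    F.pred ≤ a.code ∧ (∀ c, GTerm.const c ∈ F.terms → c ≤ a.code ∨ c ∈ adom A) ∧
      ∀ f l, GTerm.call (f, l) ∈ F.terms → f ≤ a.code ∧ l.length ≤ a.code ∧ ∀ x ∈ l, x ∈ adom A := by
  obtain ⟨e, he, ρ, h₁, h₂, h₃, f, hf, rfl⟩ := hF
  have hle := (Effect.fact_le_code hf).trans (Effect.le_code he)
  have hρ : ∀ t ∈ f.terms, ∀ x ∈ t.vars, ρ x ∈ adom A := by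
    intro t ht x hx
    by_cases hp : x ∈ a.params
    · rw [h₁ x hp]; exact hσ x hp
    · exact h₂ x ((ha.facts e he f hf t ht x hx).resolve_right hp) hp
  refine ⟨by simpa using (Atom.pred_le_code f).trans hle, fun c hc => ?_, fun g l hl => ?_⟩
  · simp only [Atom.terms_map, List.mem_map] at hc
    obtain ⟨(x | d) | ⟨g, args⟩, ht, h⟩ := hc
    · simp only [ETerm.ground, GTerm.const.injEq] at h
      subst h
      exact Or.inr (hρ _ ht x (by simp [ETerm.vars, QTerm.vars]))
    · simp only [ETerm.ground, GTerm.const.injEq] at h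
      subst h
      exact Or.inl (((Nat.right_le_pair _ _).trans (Nat.right_le_pair _ _)).trans
        ((Atom.le_code ht).trans hle))
    · simp [ETerm.ground] at h
  · simp only [Atom.terms_map, List.mem_map] at hl
    obtain ⟨(x | d) | ⟨g, args⟩, ht, h⟩ := hl
    · simp [ETerm.ground] at h
    · simp [ETerm.ground] at h
    · simp only [ETerm.ground, GTerm.call.injEq, Prod.mk.injEq] at h
      obtain ⟨rfl, rfl⟩ := h
      have hc := (Atom.le_code (c := ETerm.code) ht).trans hle
      have h₁ : Nat.pair g (codeList id args) ≤ (ETerm.call g args).code := Nat.right_le_pair _ _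
      refine ⟨(Nat.left_le_pair _ _).trans (h₁.trans hc), ?_, ?_⟩
      · rw [List.length_map]
        exact (length_le_codeList args).trans ((Nat.right_le_pair _ _).trans (h₁.trans hc))
      · intro y hy
        obtain ⟨x, hx, rfl⟩ := List.mem_map.1 hy
        exact hρ _ ht x hx

theorem calls_args {T : TBox} {A : ABox} {a : Action} {σ : ℕ → ℕ} (ha : a.WF)
    (hσ : ∀ p ∈ a.params, σ p ∈ adom A) {c : SCall} (hc : c ∈ calls (doFacts T A a σ)) :
    c.1 ≤ a.code ∧ c.2.length ≤ a.code ∧ ∀ x ∈ c.2, x ∈ adom A := by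
  obtain ⟨F, hF, hc⟩ := hc
  exact (doFacts_terms ha hσ hF).2.2 _ _ hc

theorem mem_adom_of_calls {A : ABox} {θ : SCall → ℕ} {D : Set (Atom GTerm)}
    (hA : (A : Set Fact) = Atom.map (GTerm.eval θ) '' D) {c : SCall} (hc : c ∈ calls D) :
    θ c ∈ adom A := by
  obtain ⟨F, hF, hc⟩ := hc
  refine ⟨F.map (GTerm.eval θ), ?_, ?_⟩
  · rw [← Finset.mem_coe, hA]; exact ⟨F, hF, rfl⟩
  · rw [Atom.terms_map]; exact List.mem_map.2 ⟨_, hc, rfl⟩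

/-- Arguments of the issued calls come from the old ABox and their results occur in the new one. So
the service call map never holds a constant that the ABoxes along the run did not show. -/
theorem KAB.Step.supp {K : KAB} (hK : K.WF) {s s' : KState} (h : K.Step s s') {x : ℕ}
    (hx : x ∈ s'.supp) : x ∈ s.supp ∨ x ∈ adom s'.abox := by
  obtain ⟨a, ha, σ, ⟨r, hr, hra, hσ, hh⟩, θ, hθ, hA, hc, hn⟩ := h
  rcases hx with hx | ⟨c, d, hcd, hx⟩
  · exact Or.inr hx
  · by_cases hcD : c ∈ calls (doFacts K.tbox s.abox a σ)
    · rcases hx with rfl | hx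
      · rw [hc c hcD, Option.some_inj] at hcd
        subst hcd
        exact Or.inr (mem_adom_of_calls hA hcD)
      · exact Or.inl (Or.inl ((calls_args (hK.actions a ha) hσ hcD).2.2 x hx))
    · rw [hn c hcD] at hcd
      exact Or.inl (Or.inr ⟨c, d, hcd, hx⟩)

/-- The results of the service calls of a step can be changed by any map that fixes the constants
of the specification and those of the state. -/
theorem KAB.Step.relabel {K : KAB} (hK : K.WF) {s s' : KState} (h : K.Step s s') {f : ℕ → ℕ}
    (hf : ∀ c ≤ K.code, f c = c) (hfs : ∀ c ∈ s.supp, f c = c) :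
    ∃ s'', K.Step s s'' ∧ s''.abox = s'.abox.image (Atom.map f) := by
  classical
  obtain ⟨a, ha, σ, ⟨r, hr, hra, hσ, hh⟩, θ, hθ, hA, hc, hn⟩ := h
  refine ⟨⟨s'.abox.image (Atom.map f), fun c => if c ∈ calls (doFacts K.tbox s.abox a σ) then
    some (f (θ c)) else s.scmap c⟩, ⟨a, ha, σ, ⟨r, hr, hra, hσ, hh⟩, f ∘ θ, ?_, ?_, ?_, ?_⟩, rfl⟩
  · intro c hc d hd
    rw [Function.comp_apply, hθ c hc d hd]
    exact hfs d (Or.inr ⟨c, d, hd, Or.inl rfl⟩)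
  · rw [Finset.coe_image, hA, Set.image_image]
    refine Set.image_congr fun F hF => ?_
    rw [Atom.map_map]
    refine Atom.map_congr fun t ht => ?_
    cases t with
    | const c =>
      simp only [Function.comp_apply, GTerm.eval]
      -- A constant in a produced fact comes from the specification or from the current ABox, and
      -- `f` fixes both. Injectivity of `f` plays no role.
      rcases (doFacts_terms (hK.actions a ha) hσ hF).2.1 c ht with h | h
      · exact hf c (h.trans (KAB.action_le_code ha))
      · exact hfs c (Or.inl h)
    | call c => rfl
  · intro c hc; simp [hc]
  · intro c hc; simp [hc]

end ITKAB

namespace ITKAB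

/-! ## Monotonicity and bisimulation -/

/-- Both polarities are treated together because negation swaps them. -/
theorem MuForm.sem_mono (T : TBox) (U : TransSys) {Z : ℕ} (φ : MuForm) {b : Bool}
    (hφ : Polarity Z b φ) {v : ℕ → ℕ} {V : ℕ → Set U.St} {X Y : Set U.St} (hXY : X ⊆ Y) :
    (b = true → φ.sem T U v (Function.update V Z X) ⊆ φ.sem T U v (Function.update V Z Y)) ∧
    (b = false → φ.sem T U v (Function.update V Z Y) ⊆ φ.sem T U v (Function.update V Z X)) := by
  induction φ generalizing b v V with
  | query Q => exact ⟨fun _ => subset_rfl, fun _ => subset_rfl⟩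
  | neg φ ih =>
    have := ih hφ (v := v) (V := V)
    exact ⟨fun h => Set.compl_subset_compl.2 (this.2 (by simp [h])),
      fun h => Set.compl_subset_compl.2 (this.1 (by simp [h]))⟩
  | and φ ψ ih₁ ih₂ =>
    exact ⟨fun h => Set.inter_subset_inter ((ih₁ hφ.1).1 h) ((ih₂ hφ.2).1 h),
      fun h => Set.inter_subset_inter ((ih₁ hφ.1).2 h) ((ih₂ hφ.2).2 h)⟩
  | ex x φ ih =>
    exact ⟨fun h s ⟨d, hd, hs⟩ => ⟨d, hd, (ih hφ).1 h hs⟩,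
      fun h s ⟨d, hd, hs⟩ => ⟨d, hd, (ih hφ).2 h hs⟩⟩
  | dia φ ih =>
    exact ⟨fun h s ⟨d, hd, hs⟩ => ⟨d, hd, (ih hφ).1 h hs⟩,
      fun h s ⟨d, hd, hs⟩ => ⟨d, hd, (ih hφ).2 h hs⟩⟩
  | pvar Y' =>
    by_cases h : Y' = Z
    · subst h
      have hb : b = true := hφ rfl
      simpa [sem, hb] using hXY
    · simp [sem, h]
  | mu Y' φ ih =>
    by_cases h : Y' = Z
    · subst h
      simp [sem]
    · have hφ : Polarity Z b φ := hφ.resolve_left h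
      refine ⟨fun hb => Set.sInter_subset_sInter fun W hW => ?_,
        fun hb => Set.sInter_subset_sInter fun W hW => ?_⟩
      · have hW : φ.sem T U v (Function.update (Function.update V Z Y) Y' W) ⊆ W := hW
        change φ.sem T U v (Function.update (Function.update V Z X) Y' W) ⊆ W
        -- Bringing the update at `Z` outermost allows the induction hypothesis to be used; a
        -- pre-fixpoint for the larger set is then one for the smaller set.
        rw [Function.update_comm (Ne.symm h)] at hW ⊢
        exact ((ih hφ).1 hb).trans hW
      · have hW : φ.sem T U v (Function.update (Function.update V Z X) Y' W) ⊆ W := hW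
        change φ.sem T U v (Function.update (Function.update V Z Y) Y' W) ⊆ W
        rw [Function.update_comm (Ne.symm h)] at hW ⊢
        exact ((ih hφ).2 hb).trans hW

/-! ### Abstractions and invariance of the logic under renaming. -/

/-- A finite abstraction of the transition system of `K`: its states denote states of `K` with
constants below `M`, and its steps are those of `K` up to renamings of constants other than those
up to `n`, those of the given state, and any `n` further ones. -/
structure Abstraction (K : KAB) (n M : ℕ) (F : TransSys) (st : F.St → KState) : Prop where
  init : st F.init = K.init
  abox : ∀ i, F.abox i = (st i).abox
  bound : ∀ i, ∀ c ∈ (st i).supp, c < M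
  sound : ∀ i j, F.step i j → K.Step (st i) (st j)
  complete : ∀ i s', K.Step (st i) s' → ∀ E : Finset ℕ, (∀ e ∈ E, e < M) → E.card ≤ n →
    ∃ π, FixLe n π ∧ (∀ c ∈ (st i).supp, π c = c) ∧ (∀ c ∈ E, π c = c) ∧
      ∃ j, F.step i j ∧ st j = s'.perm π

/-- `s` and `i` are the same up to a renaming of constants that maps `a` to `b` for every
`(a, b) ∈ P` and fixes the constants up to `n`. -/
def Rel (n : ℕ) {K : KAB} {F : TransSys} (st : F.St → KState) (P : List (ℕ × ℕ)) (s : K.itSys.St)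
    (i : F.St) : Prop :=
  ∃ π, FixLe n π ∧ st i = s.1.perm π ∧ ∀ p ∈ P, π p.1 = p.2

/-- A zigzag closes up through `π₃ * π₂⁻¹ * π₁`, and the detour respects `P` because all three
permutations do. The fixpoint case needs this to match sets of states on the two sides. -/
theorem Rel.trans {n : ℕ} {K : KAB} {F : TransSys} {st : F.St → KState} {P : List (ℕ × ℕ)}
    {s s' : K.itSys.St} {i i' : F.St} (h₁ : Rel n st P s i) (h₂ : Rel n st P s' i)
    (h₃ : Rel n st P s' i') : Rel n st P s i' := by
  obtain ⟨π₁, hπ₁, e₁, p₁⟩ := h₁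
  obtain ⟨π₂, hπ₂, e₂, p₂⟩ := h₂
  obtain ⟨π₃, hπ₃, e₃, p₃⟩ := h₃
  refine ⟨π₃ * (π₂.symm * π₁), hπ₃.mul (hπ₂.symm.mul hπ₁), ?_, fun p hp => ?_⟩
  · rw [KState.perm_mul, KState.perm_mul, ← e₁, e₂, KState.perm_symm_perm, e₃]
  · rw [Equiv.Perm.mul_apply, Equiv.Perm.mul_apply, p₁ p hp, ← p₂ p hp, Equiv.symm_apply_apply,
      p₃ p hp, p₂ p hp]

theorem Rel.mono {n : ℕ} {K : KAB} {F : TransSys} {st : F.St → KState} {P P' : List (ℕ × ℕ)}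
    {s : K.itSys.St} {i : F.St} (h : Rel n st P s i) (hP : ∀ p ∈ P', p ∈ P) : Rel n st P' s i := by
  obtain ⟨π, h₁, h₂, h₃⟩ := h
  exact ⟨π, h₁, h₂, fun p hp => h₃ p (hP p hp)⟩

/-- The list `P` records the pairs of values given to individual variables on the two sides,
including values that have left the active domain. `P.length + φ.code ≤ n` says that the values held
now, plus those that quantifiers in `φ` can still add, fit into what the abstraction can keep fixed
during a step. -/
theorem MuForm.sem_compat {K : KAB} {n M : ℕ} {F : TransSys} {st : F.St → KState}
    (hF : Abstraction K n M F st) (hKn : K.code ≤ n) (φ : MuForm) (hφ : φ.Monotone)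
    {P : List (ℕ × ℕ)} (hn : P.length + φ.code ≤ n) (hM : ∀ p ∈ P, p.2 < M) {v v' : ℕ → ℕ}
    (hv : ∀ x ∈ φ.FV, (v x, v' x) ∈ P) {V : ℕ → Set K.itSys.St} {V' : ℕ → Set F.St}
    (hV : ∀ Z ∈ φ.PV, ∀ s i, Rel n st P s i → (s ∈ V Z ↔ i ∈ V' Z)) {s : K.itSys.St} {i : F.St}
    (hs : Rel n st P s i) :
    s ∈ φ.sem K.tbox K.itSys v V ↔ i ∈ φ.sem K.tbox F v' V' := by
  induction φ generalizing P v v' V V' s i with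
  | query Q =>
    obtain ⟨π, hπ, e, hP⟩ := hs
    change Q.holds K.tbox s.1.abox v ↔ Q.holds K.tbox (F.abox i) v'
    have hQ : Q.code ≤ n := (Nat.right_le_pair 0 _).trans (le_trans (Nat.le_add_left _ _) hn)
    rw [hF.abox, e, ← Q.holds_perm (hπ.mono hQ)]
    exact Q.holds_congr fun x hx => hP _ (hv x hx)
  | neg φ ih =>
    have hle : φ.code ≤ (neg φ).code := Nat.right_le_pair _ _
    exact not_congr (ih hφ (by omega) hM hv hV hs)
  | and φ ψ ih₁ ih₂ =>
    have hle : Nat.pair φ.code ψ.code ≤ (and φ ψ).code := Nat.right_le_pair _ _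
    have hle₁ := Nat.left_le_pair φ.code ψ.code
    have hle₂ := Nat.right_le_pair φ.code ψ.code
    exact and_congr
      (ih₁ hφ.1 (by omega) hM (fun x hx => hv x (Or.inl hx)) (fun Z hZ => hV Z (Or.inl hZ)) hs)
      (ih₂ hφ.2 (by omega) hM (fun x hx => hv x (Or.inr hx)) (fun Z hZ => hV Z (Or.inr hZ)) hs)
  | ex x φ ih =>
    -- The tag 3 makes the code drop by at least one, which pays for the pair that the quantifier
    -- adds to `P`.
    have hle : 3 + Nat.pair x φ.code ≤ (ex x φ).code := Nat.add_le_pair _ _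
    have hle₁ := Nat.right_le_pair x φ.code
    have key : ∀ π, FixLe n π → st i = s.1.perm π → (∀ p ∈ P, π p.1 = p.2) → ∀ d ∈ adom s.1.abox,
        (s ∈ φ.sem K.tbox K.itSys (Function.update v x d) V ↔
          i ∈ φ.sem K.tbox F (Function.update v' x (π d)) V') := by
      intro π hπ e hP d hd
      have hd' : π d ∈ adom (st i).abox := by rw [e]; exact mem_adom_permA hd
      refine ih hφ (P := (d, π d) :: P) (by simp only [List.length_cons]; omega) ?_ ?_ ?_ ?_
      · intro p hp
        rcases List.mem_cons.1 hp with rfl | hp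
        · exact hF.bound i _ (Or.inl hd')
        · exact hM p hp
      · intro y hy
        by_cases hyx : y = x
        · subst hyx; simp
        · simpa [hyx] using Or.inr (hv y ⟨hy, hyx⟩)
      · intro Z hZ s i h
        exact hV Z hZ s i (h.mono fun p hp => List.mem_cons_of_mem _ hp)
      · refine ⟨π, hπ, e, fun p hp => ?_⟩
        rcases List.mem_cons.1 hp with rfl | hp
        · rfl
        · exact hP p hp
    obtain ⟨π, hπ, e, hP⟩ := hs
    change (∃ d ∈ adom s.1.abox, s ∈ φ.sem K.tbox K.itSys (Function.update v x d) V) ↔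
      ∃ d ∈ adom (F.abox i), i ∈ φ.sem K.tbox F (Function.update v' x d) V'
    rw [hF.abox, e]
    refine Iff.trans ?_ exists_mem_adom_permA.symm
    exact exists_congr fun d => and_congr_right fun hd => key π hπ e hP d hd
  | dia φ ih =>
    have hle : φ.code ≤ (dia φ).code := Nat.right_le_pair _ _
    have ih := fun s i => ih hφ (by omega) hM hv hV (s := s) (i := i)
    obtain ⟨π, hπ, e, hP⟩ := hs
    constructor
    · rintro ⟨s', hs', h⟩
      have hstep : K.Step (st i) (s'.1.perm π) := e ▸ KAB.Step.perm (hπ.mono hKn) hs'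
      -- The abstract step may rename fresh constants, but must not move the values that the
      -- variables have on the abstract side.
      obtain ⟨π', hπ', -, hE, j, hj, ej⟩ := hF.complete i _ hstep (P.map Prod.snd).toFinset
        (fun c hc => by
          simp only [List.mem_toFinset, List.mem_map] at hc
          obtain ⟨p, hp, rfl⟩ := hc
          exact hM p hp)
        ((List.toFinset_card_le _).trans (by rw [List.length_map]; omega))
      refine ⟨j, hj, (ih s' j ⟨π' * π, hπ'.mul hπ, by rw [ej, KState.perm_mul], fun p hp => ?_⟩).1 h⟩
      rw [Equiv.Perm.mul_apply, hP p hp]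
      exact hE _ (by simpa using ⟨p.1, hp⟩)
    · rintro ⟨j, hj, h⟩
      have hstep : K.Step s.1 ((st j).perm π.symm) := by
        have := KAB.Step.perm (hπ.symm.mono hKn) (hF.sound i j hj)
        rwa [e, KState.perm_symm_perm] at this
      exact ⟨⟨_, s.2.tail hstep⟩, hstep, (ih _ j ⟨π, hπ, by simp, hP⟩).2 h⟩
  | pvar Z => exact hV Z rfl s i hs
  | mu Z φ ih =>
    have hle : Nat.pair Z φ.code ≤ (mu Z φ).code := Nat.right_le_pair _ _
    have hle₁ := Nat.right_le_pair Z φ.code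
    have hmU : ∀ {X Y}, X ⊆ Y → φ.sem K.tbox K.itSys v (Function.update V Z X) ⊆
        φ.sem K.tbox K.itSys v (Function.update V Z Y) := fun h => (φ.sem_mono _ _ hφ.1 h).1 rfl
    have hmF : ∀ {X Y}, X ⊆ Y → φ.sem K.tbox F v' (Function.update V' Z X) ⊆
        φ.sem K.tbox F v' (Function.update V' Z Y) := fun h => (φ.sem_mono _ _ hφ.1 h).1 rfl
    have ih : ∀ {X : Set K.itSys.St} {X' : Set F.St},
        (∀ s i, Rel n st P s i → (s ∈ X ↔ i ∈ X')) → ∀ s i, Rel n st P s i →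
        (s ∈ φ.sem K.tbox K.itSys v (Function.update V Z X) ↔
          i ∈ φ.sem K.tbox F v' (Function.update V' Z X')) := by
      intro X X' hX s i hs
      refine ih hφ.2 (by omega) hM hv (fun Y hY s i h => ?_) hs
      by_cases hYZ : Y = Z
      · subst hYZ; simpa using hX s i h
      · simpa [hYZ] using hV Y ⟨hY, hYZ⟩ s i h
    have hLU : ∀ X, φ.sem K.tbox K.itSys v (Function.update V Z X) ⊆ X →
        (mu Z φ).sem K.tbox K.itSys v V ⊆ X := fun X hX => Set.sInter_subset_of_mem hX
    have hLF : ∀ X, φ.sem K.tbox F v' (Function.update V' Z X) ⊆ X →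
        (mu Z φ).sem K.tbox F v' V' ⊆ X := fun X hX => Set.sInter_subset_of_mem hX
    have hfU : φ.sem K.tbox K.itSys v (Function.update V Z ((mu Z φ).sem K.tbox K.itSys v V)) ⊆
        (mu Z φ).sem K.tbox K.itSys v V :=
      Set.subset_sInter fun X hX => (hmU (hLU X hX)).trans hX
    have hfF : φ.sem K.tbox F v' (Function.update V' Z ((mu Z φ).sem K.tbox F v' V')) ⊆
        (mu Z φ).sem K.tbox F v' V' :=
      Set.subset_sInter fun X hX => (hmF (hLF X hX)).trans hX
    constructor
    · intro h
      -- `X` pulls the abstract fixpoint back along `Rel`, and `X'` is the image of `X`. By the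
      -- zigzag property the two sets correspond, so the induction hypothesis applies to them and
      -- shows that `X` is a pre-fixpoint, using that `X'` lies in the abstract fixpoint.
      let X : Set K.itSys.St := {s | ∀ i, Rel n st P s i → i ∈ (mu Z φ).sem K.tbox F v' V'}
      let X' : Set F.St := {i | ∃ s ∈ X, Rel n st P s i}
      have hX : ∀ s i, Rel n st P s i → (s ∈ X ↔ i ∈ X') := fun s i hs =>
        ⟨fun h => ⟨s, h, hs⟩, fun ⟨s₁, h₁, r₁⟩ i₁ r => h₁ i₁ (r₁.trans hs r)⟩
      have hX' : X' ⊆ (mu Z φ).sem K.tbox F v' V' := fun i ⟨s, h, r⟩ => h i r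
      exact hLU X (fun s h i r => hfF (hmF hX' ((ih hX s i r).1 h))) h i hs
    · intro h
      -- The same argument with the two systems exchanged.
      let X' : Set F.St := {i | ∀ s, Rel n st P s i → s ∈ (mu Z φ).sem K.tbox K.itSys v V}
      let X : Set K.itSys.St := {s | ∃ i ∈ X', Rel n st P s i}
      have hX : ∀ s i, Rel n st P s i → (s ∈ X ↔ i ∈ X') := fun s i hs =>
        ⟨fun ⟨i₁, h₁, r₁⟩ s₁ r => h₁ s₁ (r.trans hs r₁), fun h => ⟨i, h, hs⟩⟩
      have hX' : X ⊆ (mu Z φ).sem K.tbox K.itSys v V := fun s ⟨i, h, r⟩ => h s r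
      exact hLF X' (fun i h s r => hfU (hmU hX' ((ih hX s i r).2 h))) h s hs

theorem KAB.satisfies_iff_abstraction {K : KAB} {n M : ℕ} {F : TransSys} {st : F.St → KState}
    (hF : Abstraction K n M F st) (hKn : K.code ≤ n) {φ : MuForm} (hφ : φ.IsSentence)
    (hn : φ.code ≤ n) (v' : ℕ → ℕ) (V' : ℕ → Set F.St) :
    K.Satisfies φ ↔ F.init ∈ φ.sem K.tbox F v' V' := by
  have h : ∀ v V, K.itSys.init ∈ φ.sem K.tbox K.itSys v V ↔ F.init ∈ φ.sem K.tbox F v' V' := by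
    intro v V
    refine φ.sem_compat hF hKn hφ.monotone (P := []) (by simpa using hn) (by simp)
      (by simp [hφ.fv]) (by simp [hφ.pv]) ⟨1, fun c _ => rfl, ?_, by simp⟩
    rw [KState.perm_one]; exact hF.init
  exact ⟨fun hK => (h v' fun _ => ∅).1 (hK _ _), fun hf v V => (h v V).2 hf⟩

end ITKAB

namespace ITKAB

/-! ## Finite abstractions on codes -/

section

variable {α : Type*} [Primcodable α]

/-- The constants of a coded state. -/
def suppL (s : ℕ) : List ℕ :=
  adomL (decL (pfst s)) ++ (decL (psnd s)).flatMap fun p =>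
    -- Looking the call up again, instead of taking the second component of `p`, ignores results in
    -- overridden entries.
    val (decL (psnd s)) (pfst p) :: decL (psnd (pfst p))

@[fun_prop]
theorem primrec_suppL {s : α → ℕ} (h : Primrec s) : Primrec fun a => suppL (s a) := by
  unfold suppL; fun_prop

theorem scode_mk (n : ℕ) : scode (pfst n, decL (psnd n)) = n := by simp [scode]

theorem mem_suppL {s c : ℕ} : c ∈ suppL s ↔ c ∈ (stOf s).supp := by
  simp only [suppL, List.mem_append, mem_adomL, List.mem_flatMap, List.mem_cons]
  refine or_congr Iff.rfl ⟨?_, ?_⟩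
  · rintro ⟨p, hp, h⟩
    have h₀ : valO (decL (psnd s)) (pfst p) ≠ 0 := valO_ne_zero.2 ⟨p, hp, rfl⟩
    refine ⟨(pfst (pfst p), decL (psnd (pfst p))), val (decL (psnd s)) (pfst p), ?_, h⟩
    rw [stOf_scmap_eq_some, scode_mk, val]
    omega
  · rintro ⟨⟨f, l⟩, d, h, hc⟩
    rw [stOf_scmap_eq_some] at h
    refine ⟨_, mem_of_valO h, ?_⟩
    rw [pfst_pair, val_eq_of_valO h]
    simpa [scode] using hc

/-- Inclusion of coded states. -/
def leC (s t : ℕ) : Bool :=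
  (((decL (pfst s)).filter fun x => decide (pfst x < 2)).all fun x => (decL (pfst t)).contains x) &&
    (decL (psnd s)).all fun p =>
      eqN (valO (decL (psnd s)) (pfst p)) (valO (decL (psnd t)) (pfst p))

@[fun_prop]
theorem primrec_leC {s t : α → ℕ} (hs : Primrec s) (ht : Primrec t) :
    Primrec fun a => leC (s a) (t a) := by
  unfold leC; fun_prop

/-- Equality of coded states. -/
def eqvC (s t : ℕ) : Bool := leC s t && leC t s

@[fun_prop]
theorem primrec_eqvC {s t : α → ℕ} (hs : Primrec s) (ht : Primrec t) :
    Primrec fun a => eqvC (s a) (t a) := by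
  unfold eqvC; fun_prop

theorem leC_iff {s t : ℕ} : leC s t = true ↔ (stOf s).abox ⊆ (stOf t).abox ∧
    ∀ c d, (stOf s).scmap c = some d → (stOf t).scmap c = some d := by
  simp only [leC, Bool.and_eq_true, List.all_eq_true, List.mem_filter, decide_eq_true_eq,
    List.contains_iff_mem, eqN_def]
  refine and_congr ⟨fun h F hF => ?_, fun h x hx => ?_⟩ ⟨fun h c d hc => ?_, fun h p hp => ?_⟩
  · simp only [stOf, mem_decA] at hF ⊢
    exact h _ ⟨hF, pfst_fcode F⟩
  · obtain ⟨F, rfl⟩ : ∃ F, fcode F = x := by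
      have hx := hx.2
      have : (decFact x).isSome := by
        unfold decFact
        interval_cases h : pfst x <;> simp
      obtain ⟨F, hF⟩ := Option.isSome_iff_exists.1 this
      exact ⟨F, decFact_eq_some.1 hF⟩
    have := @h F (by simpa [stOf] using hx.1)
    simpa [stOf] using this
  · rw [stOf_scmap_eq_some] at hc ⊢
    have := h _ (mem_of_valO hc)
    rw [pfst_pair] at this
    rw [← this, hc]
  · have h₀ : valO (decL (psnd s)) (pfst p) ≠ 0 := valO_ne_zero.2 ⟨p, hp, rfl⟩
    obtain ⟨d, hd⟩ := Nat.exists_eq_succ_of_ne_zero h₀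
    have := h (pfst (pfst p), decL (psnd (pfst p))) d (by rw [stOf_scmap_eq_some, scode_mk, hd])
    rw [stOf_scmap_eq_some, scode_mk] at this
    rw [hd, this]

theorem eqvC_iff {s t : ℕ} : eqvC s t = true ↔ stOf s = stOf t := by
  rw [eqvC, Bool.and_eq_true, leC_iff, leC_iff]
  constructor
  · rintro ⟨⟨h₁, h₂⟩, h₃, h₄⟩
    exact KState.ext' (h₁.antisymm h₃) fun c => Option.ext fun d => ⟨h₂ c d, h₄ c d⟩
  · intro h
    simp [h]

/-- The code of the initial state. -/
def initC (K : ℕ) : ℕ := Nat.pair (pfst (psnd K)) 0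

@[fun_prop]
theorem primrec_initC {K : α → ℕ} (h : Primrec K) : Primrec fun a => initC (K a) := by
  unfold initC; fun_prop

theorem stOf_initC (K : KAB) : stOf (initC K.code) = K.init := by
  apply KState.ext'
  · ext F
    simp only [stOf, initC, KAB.code, pfst_pair, psnd_pair, decL_codeList, mem_decA, KAB.init,
      List.mem_toFinset]
    exact List.mem_map_of_injective (Atom.code_inj Function.injective_id)
  · intro c; simp [stOf, initC, KAB.init]

/-- `w` codes a bound `M` on constants, a bound `k` on the number of constants of a state, and a
list of states that is closed under steps with constants below `M`. -/
def checkC (n K w : ℕ) : Bool :=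
  -- With `k` the second bound, two tasks need room below `M`. Keeping the constants up to `n`, the
  -- state and `n` further values fixed while placing `k` new ones takes `(n + 1) + k + n + k`.
  -- Placing `k + 1` new ones without further values takes `(n + 1) + k + (k + 1)`.
  decide (2 * n + 2 * pfst (psnd w) + 2 ≤ pfst w) &&
  ((decL (psnd (psnd w))).contains (initC K) &&
    (decL (psnd (psnd w))).all fun s =>
      ((suppL s).all fun c => decide (c < pfst w)) &&
      (decide (((List.range (pfst w)).filter fun c => (suppL s).contains c).length ≤
          pfst (psnd w)) &&
        (succC K (pfst w) s).all fun t =>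
          !((suppL t).all fun c => decide (c < pfst w)) ||
            (decL (psnd (psnd w))).any fun u => eqvC u t))

@[fun_prop]
theorem primrec_checkC {n K w : α → ℕ} (hn : Primrec n) (hK : Primrec K) (hw : Primrec w) :
    Primrec fun a => checkC (n a) (K a) (w a) := by
  unfold checkC; fun_prop

theorem checkC_iff {n K w : ℕ} : checkC n K w = true ↔ 2 * n + 2 * pfst (psnd w) + 2 ≤ pfst w ∧
    initC K ∈ decL (psnd (psnd w)) ∧ ∀ s ∈ decL (psnd (psnd w)),
      (∀ c ∈ (stOf s).supp, c < pfst w) ∧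
      ((List.range (pfst w)).filter fun c => (suppL s).contains c).length ≤ pfst (psnd w) ∧
      ∀ t ∈ succC K (pfst w) s, (∀ c ∈ (stOf t).supp, c < pfst w) →
        ∃ u ∈ decL (psnd (psnd w)), stOf u = stOf t := by
  simp only [checkC, Bool.and_eq_true, decide_eq_true_eq, List.contains_iff_mem, List.all_eq_true,
    Bool.or_eq_true, Bool.not_eq_true', Bool.eq_false_iff, ne_eq, List.any_eq_true, eqvC_iff,
    mem_suppL, imp_iff_not_or]

/-- The step relation of a finite abstraction. -/
def edgeC (K M i j : ℕ) : Bool := (succC K M i).any fun t => eqvC j t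

@[fun_prop]
theorem primrec_edgeC {K M i j : α → ℕ} (hK : Primrec K) (hM : Primrec M) (hi : Primrec i)
    (hj : Primrec j) : Primrec fun a => edgeC (K a) (M a) (i a) (j a) := by
  unfold edgeC; fun_prop

end

/-! ### From certificates to abstractions. -/

/-- The transition system on a list of coded states. -/
def finSys (K M : ℕ) (L : List ℕ) (h : initC K ∈ L) : TransSys where
  St := {i // i ∈ L}
  init := ⟨initC K, h⟩
  abox i := decA (decL (pfst i.1))
  step i j := edgeC K M i.1 j.1 = true

/-- The elements of `N` are moved one at a time, each by a transposition with a number below `M`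
that is neither in `F` nor used already. -/
theorem exists_perm_lt (F N : Finset ℕ) (h : Disjoint F N) {M : ℕ} (hM : F.card + N.card ≤ M) :
    ∃ π : Equiv.Perm ℕ, (∀ x ∈ F, π x = x) ∧ ∀ x ∈ N, π x < M := by
  induction N using Finset.induction_on with
  | empty => exact ⟨1, by simp, by simp⟩
  | insert a N ha ih =>
    rw [Finset.disjoint_insert_right] at h
    rw [Finset.card_insert_of_notMem ha] at hM
    obtain ⟨π, hF, hN⟩ := ih h.2 (by omega)
    obtain ⟨c, hc, hcF⟩ := Finset.exists_mem_notMem_of_card_lt_card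
      (s := F ∪ N.image π) (t := Finset.range M)
      (lt_of_le_of_lt (Finset.card_union_le _ _)
        (by have := Finset.card_image_le (s := N) (f := π); rw [Finset.card_range]; omega))
    rw [Finset.mem_union, not_or] at hcF
    refine ⟨Equiv.swap (π a) c * π, fun x hx => ?_, fun x hx => ?_⟩
    · rw [Equiv.Perm.mul_apply, hF x hx]
      refine Equiv.swap_apply_of_ne_of_ne (fun h' => ?_) fun h' => hcF.1 (h' ▸ hx)
      have : a = x := π.injective (by rw [← h', hF x hx])
      exact h.1 (this ▸ hx)
    · rw [Equiv.Perm.mul_apply]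
      rcases Finset.mem_insert.1 hx with rfl | hx
      · rw [Equiv.swap_apply_left]; exact Finset.mem_range.1 hc
      · rw [Equiv.swap_apply_of_ne_of_ne]
        · exact hN x hx
        · intro h'; exact ha (π.injective h' ▸ hx)
        · rintro rfl; exact hcF.2 (Finset.mem_image_of_mem _ hx)

theorem mem_adom_image {A : ABox} {f : ℕ → ℕ} {c : ℕ} :
    c ∈ adom (A.image (Atom.map f)) ↔ ∃ x ∈ adom A, f x = c := by
  constructor
  · rintro ⟨F, hF, hc⟩
    obtain ⟨G, hG, rfl⟩ := Finset.mem_image.1 hF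
    rw [Atom.terms_map, List.mem_map] at hc
    obtain ⟨x, hx, rfl⟩ := hc
    exact ⟨x, ⟨G, hG, hx⟩, rfl⟩
  · rintro ⟨x, ⟨G, hG, hx⟩, rfl⟩
    exact ⟨_, Finset.mem_image_of_mem _ hG, by
      rw [Atom.terms_map]; exact List.mem_map_of_mem hx⟩

/-- A certified step to a state with constants below the bound. -/
theorem exists_edge {K : KAB} (hK : K.WF) {n w : ℕ} (h : checkC n K.code w = true) {i : ℕ}
    (hi : i ∈ decL (psnd (psnd w))) {s : KState} (hs : K.Step (stOf i) s)
    (hb : ∀ c ∈ s.supp, c < pfst w) :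
    ∃ j ∈ decL (psnd (psnd w)), edgeC K.code (pfst w) i j = true ∧ stOf j = s := by
  obtain ⟨-, -, h⟩ := checkC_iff.1 h
  obtain ⟨t, ht, rfl⟩ := mem_succC_of_step hK hs fun c hc => hb c (Or.inl hc)
  obtain ⟨u, hu, e⟩ := (h i hi).2.2 t ht hb
  exact ⟨u, hu, List.any_eq_true.2 ⟨t, ht, eqvC_iff.2 e⟩, e⟩

theorem card_le_of_checkC {n K w : ℕ} (h : checkC n K w = true) {i : ℕ}
    (hi : i ∈ decL (psnd (psnd w))) {S : Finset ℕ} (hS : ∀ c ∈ S, c ∈ (stOf i).supp) :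
    S.card ≤ pfst (psnd w) := by
  obtain ⟨-, -, h⟩ := checkC_iff.1 h
  refine le_trans ?_ (h i hi).2.1
  refine (Finset.card_le_card (fun c hc => ?_)).trans (List.toFinset_card_le _)
  simp only [List.mem_toFinset, List.mem_filter, List.mem_range, List.contains_iff_mem, mem_suppL]
  exact ⟨(h i hi).1 c (hS c hc), hS c hc⟩

/-- Soundness of certificates. Arbitrary steps must be simulated although the certificate speaks
only of successors with constants below `M`. A step that introduces few constants is renamed below
`M`. A step with too many new constants cannot exist, since collapsing them would give a listed
state that violates the bound `k`. -/
theorem abstraction_of_checkC {K : KAB} (hK : K.WF) {n w : ℕ} (hn : K.code ≤ n)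
    (h : checkC n K.code w = true) (hinit : initC K.code ∈ decL (psnd (psnd w))) :
    Abstraction K n (pfst w) (finSys K.code (pfst w) (decL (psnd (psnd w))) hinit)
      fun i => stOf i.1 := by
  obtain ⟨hM, -, hL⟩ := checkC_iff.1 h
  refine ⟨stOf_initC K, fun i => rfl, fun i => (hL i.1 i.2).1, fun i j hij => ?_,
    fun i s hs E hE hEn => ?_⟩
  · obtain ⟨t, ht, e⟩ := List.any_eq_true.1 hij
    rw [eqvC_iff.1 e]
    exact step_of_mem_succC hK ht
  · obtain ⟨i, hi⟩ := i
    change K.Step (stOf i) s at hs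
    have hSb := (hL i hi).1
    have hSk : (suppL i).toFinset.card ≤ pfst (psnd w) :=
      card_le_of_checkC h hi fun c hc => mem_suppL.1 (List.mem_toFinset.1 hc)
    let S := Finset.range (n + 1) ∪ (suppL i).toFinset
    have hS : S.card ≤ n + 1 + pfst (psnd w) :=
      (Finset.card_union_le _ _).trans (by rw [Finset.card_range]; omega)
    have hmS : ∀ {c}, c ∈ S ↔ c ≤ n ∨ c ∈ (stOf i).supp := fun {c} => by
      simp [S, mem_suppL]
    have hSM : ∀ {c}, c ∈ S → c < pfst w := fun {c} hc => by
      rcases hmS.1 hc with hc | hc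
      · omega
      · exact hSb c hc
    have hfin : (adom s.abox).Finite := by
      refine (s.abox.biUnion fun F => F.terms.toFinset).finite_toSet.subset ?_
      rintro c ⟨F, hF, hc⟩
      simpa using ⟨F, hF, hc⟩
    let N := hfin.toFinset \ S
    -- Otherwise `k + 1` of the new constants are kept apart below `M` and all other new ones are
    -- identified with one of them. This is still a step by `KAB.Step.relabel`, and it ends in a
    -- listed state with more than `k` constants.
    have hNk : N.card ≤ pfst (psnd w) := by
      by_contra! hlt
      obtain ⟨T, hTN, hT⟩ := Finset.exists_subset_card_eq (Nat.succ_le_of_lt hlt)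
      have hST : Disjoint S T := Finset.disjoint_of_subset_right hTN Finset.disjoint_sdiff
      obtain ⟨π, hπS, hπT⟩ := exists_perm_lt S T hST (M := pfst w) (by omega)
      obtain ⟨a, ha⟩ : T.Nonempty := Finset.card_pos.1 (by omega)
      let f : ℕ → ℕ := fun x => if x ∈ S ∨ x ∈ T then π x else π a
      have hfS : ∀ x ∈ S, f x = x := fun x hx => by simp [f, hx, hπS x hx]
      have hfT : ∀ x ∈ T, f x = π x := fun x hx => by simp [f, hx]
      have hfM : ∀ x, f x < pfst w := fun x => by
        by_cases hx : x ∈ S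
        · rw [hfS x hx]; exact hSM hx
        · by_cases hxT : x ∈ T
          · rw [hfT x hxT]; exact hπT x hxT
          · simpa [f, hx, hxT] using hπT a ha
      obtain ⟨s', hs', e⟩ := hs.relabel hK (f := f)
        (fun c hc => hfS c (hmS.2 (Or.inl (hc.trans hn)))) fun c hc => hfS c (hmS.2 (Or.inr hc))
      obtain ⟨j, hj, -, ej⟩ := exists_edge hK h hi hs' fun c hc => by
        rcases hs'.supp hK hc with hc | hc
        · exact hSb c hc
        · rw [e, mem_adom_image] at hc
          obtain ⟨x, -, rfl⟩ := hc
          exact hfM x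
      have := card_le_of_checkC h hj (S := T.image f) fun c hc => by
        obtain ⟨x, hx, rfl⟩ := Finset.mem_image.1 hc
        rw [ej]
        refine Or.inl ?_
        rw [e, mem_adom_image]
        exact ⟨x, hfin.mem_toFinset.1 (Finset.mem_sdiff.1 (hTN hx)).1, rfl⟩
      rw [Finset.card_image_of_injOn, hT] at this
      · omega
      · intro x hx y hy hxy
        rw [hfT x hx, hfT y hy] at hxy
        exact π.injective hxy
    -- New constants that belong to `E` are already below `M` and must stay, so only those outside
    -- `E` are moved.
    obtain ⟨π, hπS, hπN⟩ := exists_perm_lt (S ∪ E) (N \ E)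
      (Finset.disjoint_left.2 fun x hx hx' => by
        simp only [N, Finset.mem_sdiff, Finset.mem_union] at hx hx'; tauto) (M := pfst w)
      (by
        have := Finset.card_union_le S E
        have := Finset.card_le_card (Finset.sdiff_subset (s := N) (t := E))
        omega)
    have hπ : FixLe n π := fun c hc => hπS c (Finset.mem_union_left _ (hmS.2 (Or.inl hc)))
    have hπi : ∀ c ∈ (stOf i).supp, π c = c := fun c hc =>
      hπS c (Finset.mem_union_left _ (hmS.2 (Or.inr hc)))
    have hstep := hs.perm (hπ.mono hn)
    rw [KState.perm_eq_self hπi] at hstep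
    obtain ⟨j, hj, hij, e⟩ := exists_edge hK h hi hstep fun c hc => by
      obtain ⟨x, hx, rfl⟩ := KState.mem_supp_perm hc
      by_cases hxE : x ∈ E
      · rw [hπS x (Finset.mem_union_right _ hxE)]; exact hE x hxE
      · by_cases hxS : x ∈ S
        · rw [hπS x (Finset.mem_union_left _ hxS)]; exact hSM hxS
        · refine hπN x (Finset.mem_sdiff.2 ⟨Finset.mem_sdiff.2 ⟨?_, hxS⟩, hxE⟩)
          rw [Set.Finite.mem_toFinset]
          exact (hs.supp hK hx).resolve_left fun h => hxS (hmS.2 (Or.inr h))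
    exact ⟨π, hπ, hπi, fun c hc => hπS c (Finset.mem_union_right _ hc), ⟨j, hj⟩, hij, e⟩

end ITKAB

namespace ITKAB

/-! ## Run-bounded systems have finite abstractions -/

/-- Names of predicates and service functions, and numbers of arguments, are bounded by `n`. -/
def KState.NamesLe (n : ℕ) (s : KState) : Prop :=
  (∀ F ∈ s.abox, F.pred ≤ n) ∧ ∀ c d, s.scmap c = some d → c.1 ≤ n ∧ c.2.length ≤ n

theorem KAB.namesLe_init (K : KAB) : K.init.NamesLe K.code := by
  refine ⟨fun F hF => ?_, fun c d h => by simp [KAB.init] at h⟩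
  have hF : F ∈ K.abox := List.mem_toFinset.1 hF
  calc F.pred ≤ F.code id := Atom.pred_le_code F
    _ ≤ codeList (Atom.code id) K.abox := le_codeList hF
    _ ≤ _ := (Nat.left_le_pair _ _).trans (Nat.right_le_pair _ _)

theorem KAB.Step.namesLe {K : KAB} (hK : K.WF) {s s' : KState} (h : K.Step s s')
    (hs : s.NamesLe K.code) : s'.NamesLe K.code := by
  obtain ⟨a, ha, σ, ⟨r, hr, hra, hσ, hh⟩, θ, hθ, hA, hc, hn⟩ := h
  have hle := KAB.action_le_code ha
  refine ⟨fun F hF => ?_, fun c d hcd => ?_⟩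
  · rw [← Finset.mem_coe, hA] at hF
    obtain ⟨G, hG, rfl⟩ := hF
    rw [Atom.pred_map]
    exact (doFacts_terms (hK.actions a ha) hσ hG).1.trans hle
  · by_cases hcD : c ∈ calls (doFacts K.tbox s.abox a σ)
    · have := calls_args (hK.actions a ha) hσ hcD
      exact ⟨this.1.trans hle, this.2.1.trans hle⟩
    · rw [hn c hcD] at hcd
      exact hs.2 c d hcd

theorem finite_lists (n M : ℕ) : {l : List ℕ | l.length ≤ n ∧ ∀ x ∈ l, x < M}.Finite := by
  refine (List.finite_toSet (words (List.range M) n)).subset ?_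
  rintro l ⟨h₁, h₂⟩
  exact mem_words.2 ⟨h₁, fun x hx => List.mem_range.2 (h₂ x hx)⟩

/-- The facts with names up to `n` and constants below `M`. -/
theorem finite_facts (n M : ℕ) : {F : Fact | F.pred ≤ n ∧ ∀ c ∈ F.terms, c < M}.Finite := by
  have h := (Set.finite_Iic n).prod ((Set.finite_Iio M).prod (Set.finite_Iio M))
  refine ((h.image fun p => Atom.concept p.1 p.2.1).union
    (h.image fun p => Atom.role p.1 p.2.1 p.2.2)).subset ?_
  rintro (⟨N, t⟩ | ⟨P, t, t'⟩) ⟨h₁, h₂⟩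
  · refine Or.inl ⟨(N, t, t), ⟨h₁, ?_, ?_⟩, rfl⟩ <;> exact h₂ t (by simp [Atom.terms])
  · exact Or.inr ⟨(P, t, t'), ⟨h₁, h₂ t (by simp [Atom.terms]), h₂ t' (by simp [Atom.terms])⟩, rfl⟩

theorem finite_calls (n M : ℕ) :
    {p : SCall × ℕ | p.1.1 ≤ n ∧ p.1.2.length ≤ n ∧ (∀ c ∈ p.1.2, c < M) ∧ p.2 < M}.Finite := by
  refine (((Set.finite_Iic n).prod (finite_lists n M)).prod (Set.finite_Iio M)).subset ?_
  rintro ⟨⟨f, l⟩, d⟩ ⟨h₁, h₂, h₃, h₄⟩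
  exact ⟨⟨h₁, h₂, h₃⟩, h₄⟩

/-- The graph of the service call map. -/
def KState.graph (s : KState) : Set (SCall × ℕ) := {p | s.scmap p.1 = some p.2}

theorem KState.eq_of_graph {s s' : KState} (h : s.abox = s'.abox) (h' : s.graph = s'.graph) :
    s = s' :=
  KState.ext' h fun c => Option.ext fun d => (Set.ext_iff.1 h' (c, d) : _)

theorem KState.graph_subset {n M : ℕ} {s : KState} (h : s.NamesLe n) (hM : ∀ c ∈ s.supp, c < M) :
    s.graph ⊆ {p | p.1.1 ≤ n ∧ p.1.2.length ≤ n ∧ (∀ c ∈ p.1.2, c < M) ∧ p.2 < M} :=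
  fun ⟨c, d⟩ hp => ⟨(h.2 c d hp).1, (h.2 c d hp).2, fun x hx => hM x (Or.inr ⟨c, d, hp, Or.inr hx⟩),
    hM d (Or.inr ⟨c, d, hp, Or.inl rfl⟩)⟩

/-- A state is determined by its set of facts and the graph of its service call map. Both are
subsets of finite sets once names, numbers of arguments and constants are bounded. -/
theorem finite_states (n M : ℕ) :
    {s : KState | s.NamesLe n ∧ ∀ c ∈ s.supp, c < M}.Finite := by
  have h₁ := (finite_facts n M).powerset
  have h₂ := (finite_calls n M).powerset
  refine Set.Finite.of_finite_image (f := fun s : KState => ((s.abox : Set Fact), s.graph))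
    ((h₁.prod h₂).subset ?_) ?_
  · rintro _ ⟨s, ⟨hn, hM⟩, rfl⟩
    exact ⟨fun F hF => ⟨hn.1 F hF, fun c hc => hM c (Or.inl ⟨F, hF, hc⟩)⟩, s.graph_subset hn hM⟩
  · intro s _ s' _ h
    simp only [Prod.mk.injEq, Finset.coe_inj] at h
    exact KState.eq_of_graph h.1 h.2

theorem valO_scmap {l : List (SCall × ℕ)} (hl : ∀ c d d', (c, d) ∈ l → (c, d') ∈ l → d = d')
    (c : SCall) (d : ℕ) : valO (l.map fun p => Nat.pair (scode p.1) p.2) (scode c) = d + 1 ↔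
      (c, d) ∈ l := by
  constructor
  · intro h
    obtain ⟨⟨c', d'⟩, hp, h⟩ := List.mem_map.1 (mem_of_valO h)
    rw [Nat.pair_eq_pair] at h
    obtain ⟨h₁, rfl⟩ := h
    rwa [← scode_inj h₁]
  · intro h
    have h₀ : valO (l.map fun p => Nat.pair (scode p.1) p.2) (scode c) ≠ 0 :=
      valO_ne_zero.2 ⟨_, List.mem_map_of_mem h, by simp⟩
    obtain ⟨e, he⟩ := Nat.exists_eq_succ_of_ne_zero h₀
    obtain ⟨⟨c', d'⟩, hp, h'⟩ := List.mem_map.1 (mem_of_valO he)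
    rw [Nat.pair_eq_pair] at h'
    obtain ⟨h₁, rfl⟩ := h'
    obtain rfl : c' = c := scode_inj h₁
    rw [he, hl c' _ _ h hp]

theorem exists_stOf {s : KState} (h : s.graph.Finite) : ∃ i, stOf i = s := by
  refine ⟨Nat.pair (encL (s.abox.toList.map fcode))
    (encL (h.toFinset.toList.map fun p => Nat.pair (scode p.1) p.2)), KState.ext' ?_ fun c => ?_⟩
  · ext F
    simp only [stOf, pfst_pair, decL_codeList, List.map_id, mem_decA]
    rw [List.mem_map_of_injective (Atom.code_inj Function.injective_id), Finset.mem_toList]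
  · refine Option.ext fun d => ?_
    rw [stOf_scmap_eq_some, psnd_pair, decL_codeList, List.map_id, valO_scmap]
    · simp [KState.graph]
    · intro c d d' h₁ h₂
      simp only [Finset.mem_toList, Set.Finite.mem_toFinset, KState.graph, Set.mem_ofPred_eq] at h₁ h₂
      exact Option.some_inj.1 (h₁.symm.trans h₂)

/-- The constants of a reachable state occur along a run that leads to it. -/
theorem exists_run {K : KAB} (hK : K.WF) (s : K.itSys.St) :
    ∃ (τ : ℕ → K.itSys.St) (N : ℕ), K.itSys.IsRun τ N ∧ τ N = s ∧
      ∀ c ∈ s.1.supp, ∃ i ≤ N, c ∈ adom (K.itSys.abox (τ i)) := by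
  obtain ⟨s, hs⟩ := s
  induction hs with
  | refl =>
    refine ⟨fun _ => K.itSys.init, 0, ⟨rfl, by simp⟩, rfl, fun c hc => ⟨0, le_rfl, ?_⟩⟩
    rcases hc with hc | ⟨c, d, h, -⟩
    · exact hc
    · simp [KAB.init] at h
  | @tail s s' hs h ih =>
    obtain ⟨τ, N, hτ, e, hc⟩ := ih
    have key : ∀ t : K.itSys.St, K.Step (τ N).1 t.1 → ∃ (τ : ℕ → K.itSys.St) (N : ℕ),
        K.itSys.IsRun τ N ∧ τ N = t ∧
          ∀ c ∈ t.1.supp, ∃ i ≤ N, c ∈ adom (K.itSys.abox (τ i)) := by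
      intro t h
      -- The values beyond `N + 1` are irrelevant, because the run is only required to follow steps
      -- up to that index.
      refine ⟨fun i => if i ≤ N then τ i else t, N + 1, ⟨by simpa using hτ.1, fun i hi => ?_⟩,
        if_neg (by omega), fun c hc' => ?_⟩
      · have hi : i < N + 1 := by exact_mod_cast hi
        rcases Nat.lt_succ_iff_lt_or_eq.1 hi with hi | rfl
        · simpa [hi.le, Nat.succ_le_iff, hi] using hτ.2 i (by exact_mod_cast hi)
        · simp only [le_refl, if_true, Nat.succ_le_iff, lt_irrefl, if_false]
          exact h
      · rcases h.supp hK hc' with hc' | hc'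
        · rw [e] at hc'
          obtain ⟨i, hi, hci⟩ := hc c hc'
          exact ⟨i, hi.trans (Nat.le_succ _), by simpa [hi] using hci⟩
        · refine ⟨N + 1, le_rfl, ?_⟩
          simp only [Nat.succ_le_iff, lt_irrefl, if_false]
          exact hc'
    exact key _ (by rw [e]; exact h)

/-- Here boundedness along runs, and not just of single ABoxes, is needed: the service call map
remembers constants of all earlier ABoxes. -/
theorem supp_card_le {K : KAB} (hK : K.WF) {b : ℕ}
    (hb : ∀ (τ : ℕ → K.itSys.St) (N : ℕ∞), K.itSys.IsRun τ N →
      {c : ℕ | ∃ i : ℕ, (i : ℕ∞) ≤ N ∧ c ∈ adom (K.itSys.abox (τ i))}.encard < b)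
    (s : K.itSys.St) {S : Finset ℕ} (hS : ∀ c ∈ S, c ∈ s.1.supp) : S.card ≤ b := by
  obtain ⟨τ, N, hτ, -, hc⟩ := exists_run hK s
  have h₁ : (S : Set ℕ).encard ≤ _ := Set.encard_le_encard fun c hcS => by
    obtain ⟨i, hi, h⟩ := hc c (hS c hcS)
    exact (show c ∈ {c : ℕ | ∃ i : ℕ, (i : ℕ∞) ≤ (N : ℕ∞) ∧ c ∈ adom (K.itSys.abox (τ i))} from
      ⟨i, by exact_mod_cast hi, h⟩)
  have h₂ := h₁.trans (hb τ N hτ).le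
  rw [Set.encard_coe_eq_coe_finsetCard] at h₂
  exact_mod_cast h₂

/-- The certificate lists the reachable states with constants below `M`, with the run bound `b` as
`k`. Closure is immediate, since a successor of a reachable state is reachable. -/
theorem exists_checkC {K : KAB} (hK : K.WF) (hb : K.itSys.RunBounded) {n : ℕ} (hn : K.code ≤ n) :
    ∃ w, checkC n K.code w = true := by
  obtain ⟨b, hb⟩ := hb
  -- The least value that `checkC` admits; it also exceeds every constant of the initial ABox, as
  -- these are at most `K.code`.
  let M := 2 * n + 2 * b + 2
  let R : Set KState := {s | Relation.ReflTransGen K.Step K.init s ∧ ∀ c ∈ s.supp, c < M}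
  have hR : ∀ s ∈ R, s.NamesLe K.code ∧ ∀ c ∈ s.supp, c < M := by
    rintro s ⟨hs, hM⟩
    refine ⟨?_, hM⟩
    clear hM
    induction hs with
    | refl => exact K.namesLe_init
    | tail hs h ih => exact h.namesLe hK ih
  have hRfin : R.Finite := (finite_states K.code M).subset hR
  have hcode : ∀ s : KState, ∃ i, s ∈ R → stOf i = s := fun s => by
    by_cases hs : s ∈ R
    · obtain ⟨i, hi⟩ := exists_stOf
        ((finite_calls K.code M).subset (s.graph_subset (hR s hs).1 (hR s hs).2))
      exact ⟨i, fun _ => hi⟩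
    · exact ⟨0, fun h => absurd h hs⟩
  choose f hf using hcode
  have hinit : K.init ∈ R := by
    refine ⟨.refl, fun c hc => ?_⟩
    rcases hc with ⟨F, hF, hc⟩ | ⟨c, d, h, -⟩
    · have hF : F ∈ K.abox := List.mem_toFinset.1 hF
      have : c ≤ K.code :=
        calc c ≤ F.code id := Atom.le_code (c := id) hc
          _ ≤ codeList (Atom.code id) K.abox := le_codeList hF
          _ ≤ _ := (Nat.left_le_pair _ _).trans (Nat.right_le_pair _ _)
      omega
    · simp [KAB.init] at h
  -- A state has many codes and `checkC` asks for the particular code `initC`, which `f` need not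
  -- choose, so it is added.
  let L := initC K.code :: hRfin.toFinset.toList.map f
  have hL : ∀ i ∈ L, stOf i ∈ R := by
    intro i hi
    rcases List.mem_cons.1 hi with rfl | hi
    · rw [stOf_initC]; exact hinit
    · obtain ⟨s, hs, rfl⟩ := List.mem_map.1 hi
      have hs : s ∈ R := by simpa using hs
      rwa [hf s hs]
  refine ⟨Nat.pair M (Nat.pair b (encL L)), checkC_iff.2 ?_⟩
  simp only [pfst_pair, psnd_pair, decL_codeList, List.map_id]
  refine ⟨le_rfl, by simp [L], fun s hs => ⟨(hL s hs).2, ?_, fun t ht hM => ?_⟩⟩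
  · rw [← List.toFinset_card_of_nodup (List.nodup_range.filter _)]
    refine supp_card_le hK hb ⟨stOf s, (hL s hs).1⟩ fun c hc => ?_
    simp only [List.mem_toFinset, List.mem_filter, List.contains_iff_mem, mem_suppL] at hc
    exact hc.2
  · have ht : stOf t ∈ R := ⟨(hL s hs).1.tail (step_of_mem_succC hK ht), hM⟩
    refine ⟨f (stOf t), List.mem_cons_of_mem _ (List.mem_map.2 ⟨_, by simpa using ht, rfl⟩), ?_⟩
    exact hf _ ht

end ITKAB

namespace ITKAB

/-! ## Evaluation of formulae over finite abstractions -/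

/-- Evaluation of the formula coded by `n` in the state `s` of the finite transition system on `L`.
In mode `0` this is the truth value of the formula; in mode `1`, for `V` starting with a set of
states `X`, it tells whether the formula is true in some state outside `X`. -/
def semC (K M : ℕ) (L : List ℕ) (mode n s : ℕ) (v V : List ℕ) : Bool :=
  if mode = 0 then
    if _h₀ : pfst n = 0 then holdsC (kT K) (decL (pfst s)) (psnd n) v
    else if pfst n = 5 then (decL (val V (psnd n))).contains s
    else if pfst n = 1 then !(semC K M L 0 (psnd n) s v V)
    else if pfst n = 2 then
      semC K M L 0 (pfst (psnd n)) s v V && semC K M L 0 (psnd (psnd n)) s v V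
    else if pfst n = 3 then (adomL (decL (pfst s))).any fun d =>
      semC K M L 0 (psnd (psnd n)) s (Nat.pair (pfst (psnd n)) d :: v) V
    else if pfst n = 4 then (L.filter fun t => edgeC K M s t).any fun t =>
      semC K M L 0 (psnd n) t v V
    -- A state lies in the least fixpoint iff no set `X` without it is a pre-fixpoint. Mode 1 checks
    -- that `X` is not a pre-fixpoint by looking for a state outside `X` where the body holds.
    else ((subs L).filter fun X => !(X.contains s)).all fun X =>
      semC K M L 1 (psnd (psnd n)) s v (Nat.pair (pfst (psnd n)) (encL X) :: V)
  else (L.filter fun t => !((decL (psnd V.headI)).contains t)).any fun t => semC K M L 0 n t v V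
-- Doubling makes room for mode 1, which calls mode 0 on the same formula.
termination_by 2 * n + (if mode = 0 then 0 else 1)
decreasing_by
  all_goals first
    | (have := psnd_lt _h₀
       have := pfst_le (psnd n)
       have := psnd_le (psnd n)
       split_ifs <;> omega)
    | (split_ifs <;> omega)

/-! ### Evaluation of formulae as course-of-values recursion. -/

/-- The recursive calls in the evaluation of a formula. -/
def semKids (b : (ℕ × ℕ × List ℕ) × ℕ × ℕ × ℕ × List ℕ × List ℕ) :
    List ((ℕ × ℕ × List ℕ) × ℕ × ℕ × ℕ × List ℕ × List ℕ) :=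
  bif eqN b.2.1 0 then
    bif eqN (pfst b.2.2.1) 0 then []
    else bif eqN (pfst b.2.2.1) 5 then []
    else bif eqN (pfst b.2.2.1) 1 then [(b.1, 0, psnd b.2.2.1, b.2.2.2)]
    else bif eqN (pfst b.2.2.1) 2 then
      [(b.1, 0, pfst (psnd b.2.2.1), b.2.2.2), (b.1, 0, psnd (psnd b.2.2.1), b.2.2.2)]
    else bif eqN (pfst b.2.2.1) 3 then (adomL (decL (pfst b.2.2.2.1))).map fun d =>
      (b.1, 0, psnd (psnd b.2.2.1), b.2.2.2.1, Nat.pair (pfst (psnd b.2.2.1)) d :: b.2.2.2.2.1,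
        b.2.2.2.2.2)
    else bif eqN (pfst b.2.2.1) 4 then
      (b.1.2.2.filter fun t => edgeC b.1.1 b.1.2.1 b.2.2.2.1 t).map fun t =>
        (b.1, 0, psnd b.2.2.1, t, b.2.2.2.2)
    else ((subs b.1.2.2).filter fun X => !(X.contains b.2.2.2.1)).map fun X =>
      (b.1, 1, psnd (psnd b.2.2.1), b.2.2.2.1, b.2.2.2.2.1,
        Nat.pair (pfst (psnd b.2.2.1)) (encL X) :: b.2.2.2.2.2)
  else (b.1.2.2.filter fun t => !((decL (psnd b.2.2.2.2.2.headI)).contains t)).map fun t =>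
    (b.1, 0, b.2.2.1, t, b.2.2.2.2)

/-- The value of a formula from the values of the recursive calls. -/
def semComb (b : (ℕ × ℕ × List ℕ) × ℕ × ℕ × ℕ × List ℕ × List ℕ) (rs : List Bool) : Bool :=
  bif eqN b.2.1 0 then
    bif eqN (pfst b.2.2.1) 0 then
      holdsC (kT b.1.1) (decL (pfst b.2.2.2.1)) (psnd b.2.2.1) b.2.2.2.2.1
    else bif eqN (pfst b.2.2.1) 5 then
      (decL (val b.2.2.2.2.2 (psnd b.2.2.1))).contains b.2.2.2.1
    else bif eqN (pfst b.2.2.1) 1 then !rs.headI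
    else bif eqN (pfst b.2.2.1) 2 then rs.headI && rs.tail.headI
    else bif eqN (pfst b.2.2.1) 3 then rs.any fun r => r
    else bif eqN (pfst b.2.2.1) 4 then rs.any fun r => r
    else rs.all fun r => r
  else rs.any fun r => r

theorem semC_rec (b : (ℕ × ℕ × List ℕ) × ℕ × ℕ × ℕ × List ℕ × List ℕ) :
    semComb b ((semKids b).map fun b =>
      semC b.1.1 b.1.2.1 b.1.2.2 b.2.1 b.2.2.1 b.2.2.2.1 b.2.2.2.2.1 b.2.2.2.2.2) =
      semC b.1.1 b.1.2.1 b.1.2.2 b.2.1 b.2.2.1 b.2.2.2.1 b.2.2.2.2.1 b.2.2.2.2.2 := by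
  obtain ⟨⟨K, M, L⟩, mode, n, s, v, V⟩ := b
  conv_rhs => rw [semC]
  simp only [semComb, semKids, eqN_def]
  by_cases hm : mode = 0
  swap
  · simp only [hm, decide_false, cond_false, if_false, List.map_map, List.any_map]
    rfl
  by_cases h0 : pfst n = 0
  · simp [hm, h0]
  by_cases h5 : pfst n = 5
  · simp [hm, h5]
  by_cases h1 : pfst n = 1
  · simp [hm, h1]
  by_cases h2 : pfst n = 2
  · simp [hm, h2]
  by_cases h3 : pfst n = 3
  · simp only [hm, h3, List.any_map]
    simp [Function.comp_def]
  by_cases h4 : pfst n = 4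
  · simp only [hm, h4, List.any_map]
    simp [Function.comp_def]
  simp only [hm, h0, h1, h2, h3, h4, h5, List.all_map]
  simp [Function.comp_def]

theorem primrec_semKids : Primrec semKids := by
  unfold semKids; fun_prop

theorem primrec_semComb : Primrec fun p : ((ℕ × ℕ × List ℕ) × ℕ × ℕ × ℕ × List ℕ × List ℕ) ×
    List Bool => semComb p.1 p.2 := by
  unfold semComb; fun_prop

theorem primrec_semC_aux : Primrec fun b : (ℕ × ℕ × List ℕ) × ℕ × ℕ × ℕ × List ℕ × List ℕ =>
    semC b.1.1 b.1.2.1 b.1.2.2 b.2.1 b.2.2.1 b.2.2.2.1 b.2.2.2.2.1 b.2.2.2.2.2 := by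
  refine Primrec.nat_omega_rec' (m := fun b => 2 * b.2.2.1 + bif eqN b.2.1 0 then 0 else 1)
    (l := semKids) (g := fun b rs => some (semComb b rs)) _ (by fun_prop) primrec_semKids
    (Primrec.option_some.comp primrec_semComb) ?_ fun b => congrArg some (semC_rec b)
  rintro ⟨⟨K, M, L⟩, mode, n, s, v, V⟩ b' hb'
  simp only [semKids, eqN_def] at hb' ⊢
  by_cases hm : mode = 0
  swap
  · simp only [hm, decide_false, cond_false, List.mem_map] at hb' ⊢
    obtain ⟨t, -, rfl⟩ := hb'
    simp
  by_cases h0 : pfst n = 0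
  · simp [hm, h0] at hb'
  have h := psnd_lt h0
  have h' := pfst_le (psnd n)
  have h'' := psnd_le (psnd n)
  by_cases h5 : pfst n = 5
  · simp [hm, h5] at hb'
  by_cases h1 : pfst n = 1
  · simp [hm, h1] at hb'
    subst hb'; simpa [hm] using h
  by_cases h2 : pfst n = 2
  · simp [hm, h2] at hb'
    rcases hb' with rfl | rfl
    · simpa [hm] using h'.trans_lt h
    · simpa [hm] using h''.trans_lt h
  by_cases h3 : pfst n = 3
  · simp [hm, h3] at hb'
    obtain ⟨d, -, rfl⟩ := hb'
    simpa [hm] using h''.trans_lt h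
  by_cases h4 : pfst n = 4
  · simp [hm, h4] at hb'
    obtain ⟨d, -, rfl⟩ := hb'
    simpa [hm] using h
  simp [hm, h0, h1, h2, h3, h4, h5] at hb'
  obtain ⟨X, -, rfl⟩ := hb'
  simp [hm]
  omega

@[fun_prop]
theorem primrec_semC {α : Type*} [Primcodable α] {K M mode n s : α → ℕ} {L v V : α → List ℕ}
    (hK : Primrec K) (hM : Primrec M) (hL : Primrec L) (hm : Primrec mode) (hn : Primrec n)
    (hs : Primrec s) (hv : Primrec v) (hV : Primrec V) :
    Primrec fun a => semC (K a) (M a) (L a) (mode a) (n a) (s a) (v a) (V a) :=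
  primrec_semC_aux.comp ((hK.pair (hM.pair hL)).pair (hm.pair (hn.pair (hs.pair (hv.pair hV)))))

/-- States correspond to entries of `L`, so sets of states are represented by sublists and the
intersection of all pre-fixpoints becomes a finite conjunction. Predicate variables missing from `V`
denote the empty set, since lookup gives 0, the code of the empty list. -/
theorem semC_iff {K : KAB} (hK : K.WF) {M : ℕ} {L : List ℕ} {F : TransSys} {c : F.St → ℕ}
    (hc : Function.Injective c) (hcL : ∀ i, c i ∈ L) (hLc : ∀ t ∈ L, ∃ i, c i = t)
    (habox : ∀ i, F.abox i = decA (decL (pfst (c i))))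
    (hstep : ∀ i j, F.step i j ↔ edgeC K.code M (c i) (c j) = true) (φ : MuForm)
    (v V : List ℕ) (i : F.St) :
    semC K.code M L 0 φ.code (c i) v V = true ↔
      i ∈ φ.sem K.tbox F (val v) fun Z => {j | c j ∈ decL (val V Z)} := by
  induction φ generalizing v V i with
  | query Q =>
    rw [semC]
    simp only [MuForm.code, pfst_pair, psnd_pair, if_true, kT_code, dite_true, MuForm.sem,
      Set.mem_ofPred_eq, habox]
    exact holdsC_iff hK.tbox _ _ _
  | neg φ ih =>
    rw [semC]
    simp [MuForm.code, MuForm.sem, ← ih]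
  | and φ ψ ih₁ ih₂ =>
    rw [semC]
    simp [MuForm.code, MuForm.sem, ← ih₁, ← ih₂]
  | ex x φ ih =>
    rw [semC]
    simp [MuForm.code, MuForm.sem, ih, val_cons, mem_adomL, habox]
  | dia φ ih =>
    rw [semC]
    simp only [MuForm.code, pfst_pair, psnd_pair, MuForm.sem, Set.mem_ofPred_eq,
      OfNat.ofNat_ne_zero, OfNat.ofNat_ne_one, if_false, if_true, dite_false,
      List.any_eq_true, List.mem_filter, Nat.reduceEqDiff, hstep]
    constructor
    · rintro ⟨t, ⟨ht, he⟩, h⟩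
      obtain ⟨j, rfl⟩ := hLc t ht
      exact ⟨j, he, (ih v V j).1 h⟩
    · rintro ⟨j, he, h⟩
      exact ⟨_, ⟨hcL j, he⟩, (ih v V j).2 h⟩
  | pvar Z =>
    rw [semC]
    simp [MuForm.code, MuForm.sem]
  | mu Z φ ih =>
    have hupd : ∀ X : List ℕ, (fun Y => {j | c j ∈ decL (val (Nat.pair Z (encL X) :: V) Y)}) =
        Function.update (fun Y => {j | c j ∈ decL (val V Y)}) Z {j | c j ∈ X} := by
      intro X
      funext Y
      rw [val_cons]
      by_cases h : Y = Z
      · subst h; simp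
      · simp [h]
    have hmode : ∀ X : List ℕ, semC K.code M L 1 φ.code (c i) v (Nat.pair Z (encL X) :: V) = true ↔
        ¬ φ.sem K.tbox F (val v) (Function.update (fun Y => {j | c j ∈ decL (val V Y)}) Z
          {j | c j ∈ X}) ⊆ {j | c j ∈ X} := by
      intro X
      rw [semC, ← hupd, Set.not_subset]
      simp only [one_ne_zero, if_false, List.any_eq_true, List.mem_filter, List.headI,
        psnd_pair, Bool.not_eq_true', Bool.eq_false_iff, ne_eq, List.contains_iff_mem,
        decL_codeList, List.map_id]
      constructor
      · rintro ⟨t, ⟨ht, htX⟩, h⟩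
        obtain ⟨j, rfl⟩ := hLc t ht
        exact ⟨j, (ih v _ j).1 h, htX⟩
      · rintro ⟨j, h, htX⟩
        exact ⟨_, ⟨hcL j, htX⟩, (ih v _ j).2 h⟩
    rw [semC]
    simp only [MuForm.code, pfst_pair, psnd_pair, OfNat.ofNat_ne_zero, OfNat.ofNat_ne_one, if_false,
      if_true, dite_false, List.all_eq_true, List.mem_filter, Nat.reduceEqDiff, hmode,
      Bool.not_eq_true', Bool.eq_false_iff, ne_eq, List.contains_iff_mem]
    constructor
    · intro h
      refine Set.mem_sInter.2 fun X hX => ?_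
      classical
      by_contra hi
      -- An arbitrary set of states, turned into the sublist of `L` that represents it.
      let p : ℕ → Bool := fun t => decide (∃ j ∈ X, c j = t)
      have hmem : ∀ j, c j ∈ L.filter p ↔ j ∈ X := fun j => by
        simp [p, hcL, hc.eq_iff]
      have hp : {j | c j ∈ L.filter p} = X := Set.ext hmem
      refine h (L.filter p) ⟨filter_mem_subs p L, fun h' => hi ((hmem i).1 h')⟩ ?_
      rw [hp]; exact hX
    · rintro h X ⟨-, hX⟩ hsub
      exact hX (Set.mem_sInter.1 h _ hsub)

/-! ## The decision procedure -/

/-- The answer given by a certificate. -/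
def answerC (n w : ℕ) : Option Bool :=
  bif checkC n (pfst n) w then some (semC (pfst n) (pfst w) (decL (psnd (psnd w))) 0 (psnd n)
    (initC (pfst n)) [] []) else none

theorem primrec_answerC : Primrec₂ answerC := by
  have h : Primrec fun p : ℕ × ℕ => some (semC (pfst p.1) (pfst p.2) (decL (psnd (psnd p.2))) 0
      (psnd p.1) (initC (pfst p.1)) [] []) := Primrec.option_some.comp (by fun_prop)
  unfold answerC
  exact primrec_cond (by fun_prop) h (Primrec.const none)

/-- The instance code bounds both the code of `K` and that of `φ`. So as `n` it covers all constants
of the specification and all values that the variables of `φ` can hold. -/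
theorem answerC_iff {K : KAB} {φ : MuForm} (hK : K.WF) (hφ : φ.IsSentence) {w : ℕ} {b : Bool}
    (h : b ∈ answerC (instanceCode K φ) w) : b = true ↔ K.Satisfies φ := by
  have hn₁ : K.code ≤ instanceCode K φ := Nat.left_le_pair _ _
  have hn₂ : φ.code ≤ instanceCode K φ := Nat.right_le_pair _ _
  have e₁ : pfst (instanceCode K φ) = K.code := pfst_pair _ _
  have e₂ : psnd (instanceCode K φ) = φ.code := psnd_pair _ _
  rw [answerC, e₁, e₂] at h
  cases hc : checkC (instanceCode K φ) K.code w with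
  | false => simp [hc] at h
  | true =>
    simp only [hc, cond_true, Option.mem_def, Option.some.injEq] at h
    have hinit := (checkC_iff.1 hc).2.1
    rw [← h, KAB.satisfies_iff_abstraction (abstraction_of_checkC hK hn₁ hc hinit) hn₁ hφ hn₂]
    exact semC_iff hK (F := finSys K.code (pfst w) (decL (psnd (psnd w))) hinit)
      (c := fun i => i.1) Subtype.val_injective (fun i => i.2) (fun t ht => ⟨⟨t, ht⟩, rfl⟩)
      (fun _ => rfl) (fun _ _ => Iff.rfl) φ [] [] ⟨_, hinit⟩

end ITKAB

/-- Verification of closed formulae over run-bounded it-KABs is decidable: one algorithm halts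
with the correct answer on every instance whose KAB is run-bounded. -/
theorem mainTheorem6 :
    ∃ decide : ℕ →. Bool, Partrec decide ∧
      ∀ (K : ITKAB.KAB) (φ : ITKAB.MuForm),
        K.WF → φ.IsSentence → K.itSys.RunBounded →
          ∃ b ∈ decide (ITKAB.instanceCode K φ), (b = true ↔ K.Satisfies φ) := by
  refine ⟨fun n => Nat.rfindOpt (ITKAB.answerC n),
    Partrec.rfindOpt ITKAB.primrec_answerC.to_comp, fun K φ hK hφ hb => ?_⟩
  obtain ⟨w, hw⟩ := ITKAB.exists_checkC hK hb (n := ITKAB.instanceCode K φ) (Nat.left_le_pair _ _)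
  have hdom : (Nat.rfindOpt (ITKAB.answerC (ITKAB.instanceCode K φ))).Dom := by
    refine Nat.rfindOpt_dom.2 ⟨w, ITKAB.semC K.code (ITKAB.pfst w) (ITKAB.decL (ITKAB.psnd (ITKAB.psnd w))) 0
      (ITKAB.psnd (ITKAB.instanceCode K φ)) (ITKAB.initC K.code) [] [], ?_⟩
    rw [ITKAB.answerC, show ITKAB.pfst (ITKAB.instanceCode K φ) = K.code from ITKAB.pfst_pair _ _,
      hw, cond_true]
    rfl
  -- The certificate that the search finds need not be the one from run-boundedness, but any
  -- accepted certificate gives the right answer.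
  obtain ⟨w, hb⟩ := Nat.rfindOpt_spec (Part.get_mem hdom)
  exact ⟨_, Part.get_mem hdom, ITKAB.answerC_iff hK hφ hb⟩
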